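/- Let $G=(V,E)$ be a finite simple undirected graph. Let $\nu(V)$ denote the maximum number of edges of a matching of $G$. A set $B\subseteq E$ is a blocking set if there is a vector $x\in\mathbb{R}^V$ with $x\ge 0$ and $\sum_{i\in V}x_i\le\nu(V)$ such that $x_i+x_j\ge 1$ for every edge $ij\in E\setminus B$. For a real number $\omega\ge 1$, $G$ is $\omega$-sparse if for every $S\subseteq V$ the induced subgraph $G[S]$ has at most $\omega|S|$ edges. There is a polynomial-time algorithm which, given the adjacency matrix of a graph $G$, computes a set $B$ of edges such that the following holds for every real $\omega\ge 1$: if $G$ is $\omega$-sparse, then $B$ is a blocking set of $G$ and $|B|\le(8\omega+2)\,|B^*|$, where $B^*$ is a blocking set of $G$ of minimum size. Neither the algorithm nor its running time, which is bounded by a polynomial in $|V|$, depends on $\omega$. -/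

import Mathlib

/-! ### Graphs, matchings, blocking sets -/

/-- The matching number `ν(V)`: the largest number of edges of a matching of the finite graph `G`
(the set of these numbers contains `0` and is bounded by the number of edges of `G`). -/
noncomputable def matchingNumber {V : Type*} [Finite V] (G : SimpleGraph V) : ℕ :=
  sSup {k : ℕ | ∃ M : G.Subgraph, M.IsMatching ∧ M.edgeSet.ncard = k}

/-- `B` is a blocking set of `G`: it consists of edges of `G`, and some nonnegative `x` of total
value at most `ν(V)` covers every edge of `G` outside `B`. -/
def IsBlockingSet {V : Type*} [Fintype V] (G : SimpleGraph V) (B : Finset (Sym2 V)) : Prop :=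
  (∀ e ∈ B, e ∈ G.edgeSet) ∧
    ∃ x : V → ℝ, (∀ i, 0 ≤ x i) ∧ ∑ i, x i ≤ (matchingNumber G : ℝ) ∧
      ∀ i j, G.Adj i j → s(i, j) ∉ B → 1 ≤ x i + x j

/-- `G` is `ω`-sparse: every vertex set `S` induces at most `ω |S|` edges. -/
def IsSparse {V : Type*} [Finite V] (ω : ℝ) (G : SimpleGraph V) : Prop :=
  ∀ S : Finset V, ((G.induce (S : Set V)).edgeSet.ncard : ℝ) ≤ ω * (S.card : ℝ)

/-! ### A random access machine with a step count

The memory consists of named two-dimensional arrays of natural numbers, addressed indirectly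
(a scalar variable is the entry `(0, 0)` of an array). A program is a fixed finite structured
command. The arithmetic operations are addition and truncated subtraction, with unit cost. There is
no multiplication, so in `t` steps the numbers grow by at most `O(t)` bits, and polynomial time on
this machine is polynomial time on a Turing machine. -/

namespace RAM

/-- Memory: `m a i j` is the entry `(i, j)` of the array named `a`. -/
abbrev Mem : Type := ℕ → ℕ → ℕ → ℕ

/-- Overwrite the entry `(i, j)` of the array `a` with `v`. -/
def Mem.set (m : Mem) (a i j v : ℕ) : Mem :=
  fun a' i' j' => if a' = a ∧ i' = i ∧ j' = j then v else m a' i' j'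

/-- Expressions: literals, memory reads, addition and truncated subtraction. -/
inductive Expr : Type
  | const (k : ℕ) : Expr
  | read (a : ℕ) (i j : Expr) : Expr
  | add (e f : Expr) : Expr
  | sub (e f : Expr) : Expr

/-- The value of an expression. -/
def Expr.eval (m : Mem) : Expr → ℕ
  | .const k => k
  | .read a i j => m a (i.eval m) (j.eval m)
  | .add e f => e.eval m + f.eval m
  | .sub e f => e.eval m - f.eval m

/-- The number of steps spent on evaluating an expression: one for each of its nodes. -/
def Expr.cost : Expr → ℕ
  | .const _ => 1
  | .read _ i j => i.cost + j.cost + 1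
  | .add e f => e.cost + f.cost + 1
  | .sub e f => e.cost + f.cost + 1

/-- Programs. `write a i j e` stores the value of `e` in the entry `(i, j)` of the array `a`;
`branch e c d` runs `c` if `e` is nonzero and `d` otherwise; `loop e c` repeats `c` as long as
`e` is nonzero. -/
inductive Cmd : Type
  | skip : Cmd
  | write (a : ℕ) (i j e : Expr) : Cmd
  | seq (c d : Cmd) : Cmd
  | branch (e : Expr) (c d : Cmd) : Cmd
  | loop (e : Expr) (c : Cmd) : Cmd

/-- `Exec c m m' t`: the program `c`, started in memory `m`, halts in memory `m'` after exactly `t`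
steps. -/
inductive Exec : Cmd → Mem → Mem → ℕ → Prop
  | skip (m : Mem) : Exec .skip m m 1
  | write (m : Mem) (a : ℕ) (i j e : Expr) :
      Exec (.write a i j e) m (m.set a (i.eval m) (j.eval m) (e.eval m))
        (i.cost + j.cost + e.cost + 1)
  | seq {c d : Cmd} {m m' m'' : Mem} {s t : ℕ} :
      Exec c m m' s → Exec d m' m'' t → Exec (.seq c d) m m'' (s + t)
  | branch_true {e : Expr} {c d : Cmd} {m m' : Mem} {t : ℕ} :
      e.eval m ≠ 0 → Exec c m m' t → Exec (.branch e c d) m m' (e.cost + 1 + t)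
  | branch_false {e : Expr} {c d : Cmd} {m m' : Mem} {t : ℕ} :
      e.eval m = 0 → Exec d m m' t → Exec (.branch e c d) m m' (e.cost + 1 + t)
  | loop_true {e : Expr} {c : Cmd} {m m' m'' : Mem} {s t : ℕ} :
      e.eval m ≠ 0 → Exec c m m' s → Exec (.loop e c) m' m'' t →
        Exec (.loop e c) m m'' (e.cost + 1 + s + t)
  | loop_false {e : Expr} {c : Cmd} {m : Mem} :
      e.eval m = 0 → Exec (.loop e c) m m (e.cost + 1)

open Classical in
/-- The input memory for a graph on the vertices `0, …, n - 1`: the number `n` in the entry `(0, 0)`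
of array `0`, the adjacency matrix in array `1`, and zeros everywhere else. -/
noncomputable def graphInput {n : ℕ} (G : SimpleGraph (Fin n)) : Mem := fun a i j =>
  if a = 0 ∧ i = 0 ∧ j = 0 then n
  else if a = 1 ∧ ∃ (hi : i < n) (hj : j < n), G.Adj ⟨i, hi⟩ ⟨j, hj⟩ then 1
  else 0

/-- In the memory `m`, the entries of array `2` with indices below `n` are the adjacency matrix of
the edge set `B`. -/
def OutputsEdges {n : ℕ} (m : Mem) (B : Finset (Sym2 (Fin n))) : Prop :=
  ∀ i j : Fin n, m 2 i j = if s(i, j) ∈ B then 1 else 0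

end RAM

/-! ### A data-parallel table language and its compilation to the random access machine -/

namespace Tab

open RAM

/-! Scale vectors by two, so that a cover satisfies x_v + x_w ≥ 2 on every edge and the budget is
2ν. A König cover of the bipartite double cover of `G`, with the values of the two copies of each
vertex added, is such a cover with values 0, 1, 2. Two facts about it carry the theorem
(`halfCover_foldCover`). First, at most ν vertices have value 2, because a maximum matching of the
double cover sends them injectively, along edges of `G`, to vertices of value 0. Second, its sum is
at most 2ν + 2|B'| for every blocking set B': raising one end of each edge of B' by one turns the
vector of B' into a fractional cover of total at most ν + |B'|, and weak duality applies.

As long as the sum exceeds 2ν, the greedy phase lowers a vertex of value 1 to 0 and puts its edges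
to other vertices of value 1 into B; the other edges stay covered. By the first fact there is a
vertex of value 1 (`Greedy.exists_eq_one`), and by sparsity one of them has at most 2ω neighbours of
value 1 (`exists_unitDegree_le`). Taking one with the fewest such neighbours requires no knowledge
of ω. By the second fact there are at most 2|B'| steps, whence |B| ≤ 4ω|B'|, which is within the
required factor (`Greedy.card_le_mul`).

Both ν and the matching of the double cover come from one search for a maximum matching. It is
Edmonds' algorithm without contraction: for every outer vertex w of the alternating forest a whole
matching `F w` is stored, of the current size and missing w. Given an edge uv between outer
vertices, consider the component of u in the union of `F u` and `F v`. If it does not contain v, a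
larger matching results (`augment_spec`). Otherwise it is a path which uv closes to an odd cycle;
the exposed vertex can be moved around this cycle to each of its inner vertices (`around_spec`), and
these become outer (`Valid.merge`). The blobs that contraction would produce occur only in the
invariant `Valid`. They are odd, and counting them shows that a forest which is stuck certifies a
maximum matching (`Valid.card_fixed_le`). In a bipartite graph the blobs are single points
(`Valid.eq_of_blob_eq`), so the final forest also yields the König cover.

Polynomial time holds by construction: all programs are written in a language whose only loops run
exactly as often as the table size, and each of them compiles to the machine with a polynomial step
bound (`exists_implements`). -/

/-- A family of two-dimensional tables of natural numbers, addressed by name. -/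
abbrev Tabs : Type := ℕ → ℕ → ℕ → ℕ

/-- Terms: variables are de Bruijn levels, and `sum t` binds the next level over `0, …, N - 1`. -/
inductive Tm : Type
  | const (k : ℕ) : Tm
  | var (k : ℕ) : Tm
  | size : Tm
  | read (a : ℕ) (i j : Tm) : Tm
  | add (s t : Tm) : Tm
  | sub (s t : Tm) : Tm
  | ite (c s t : Tm) : Tm
  | sum (t : Tm) : Tm

/-- The value of a term over tables of size `N`, for the given values of the variables. -/
def Tm.eval (N : ℕ) (T : Tabs) : List ℕ → Tm → ℕ
  | _, .const k => k
  | ρ, .var k => ρ.getD k 0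
  | _, .size => N
  | ρ, .read a i j => T a (i.eval N T ρ) (j.eval N T ρ)
  | ρ, .add s t => s.eval N T ρ + t.eval N T ρ
  | ρ, .sub s t => s.eval N T ρ - t.eval N T ρ
  | ρ, .ite c s t => if c.eval N T ρ ≠ 0 then s.eval N T ρ else t.eval N T ρ
  | ρ, .sum t => ∑ i ∈ Finset.range N, t.eval N T (ρ ++ [i])

/-- Programs: `assign a t` simultaneously replaces all entries `(i, j)` of the table `a` with
`i, j < N` by the value of `t` at `i, j`; `iter p` runs `p` exactly `N` times. -/
inductive Prog : Type
  | skip : Prog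
  | assign (a : ℕ) (t : Tm) : Prog
  | seq (p q : Prog) : Prog
  | cond (t : Tm) (p q : Prog) : Prog
  | iter (p : Prog) : Prog

/-- The effect of a program on the tables. -/
def Prog.run (N : ℕ) : Prog → Tabs → Tabs
  | .skip, T => T
  | .assign a t, T => fun a' i j =>
      if a' = a ∧ i < N ∧ j < N then t.eval N T [i, j] else T a' i j
  | .seq p q, T => q.run N (p.run N T)
  | .cond t p q, T => if t.eval N T [0, 0] ≠ 0 then p.run N T else q.run N T
  | .iter p, T => (p.run N)^[N] T

/-- The array of the machine which holds a given table. Array `0` holds the size, and the arrays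
`3` to `6` are used for variables, intermediate results, buffering and loop counters. -/
def arr : ℕ → ℕ
  | 0 => 1
  | 1 => 2
  | a + 2 => a + 7

lemma arr_injective : Function.Injective arr := by
  intro a b h
  rcases a with _ | _ | a <;> rcases b with _ | _ | b <;> simp [arr] at h ⊢; omega

lemma arr_ne (a : ℕ) : arr a ≠ 0 ∧ arr a ≠ 3 ∧ arr a ≠ 4 ∧ arr a ≠ 5 ∧ arr a ≠ 6 := by
  rcases a with _ | _ | a <;> simp [arr]

/-- The memory `m` holds the tables `T` of size `N`. -/
def Holds (N : ℕ) (m : Mem) (T : Tabs) : Prop :=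
  m 0 0 0 = N ∧ ∀ a i j, m (arr a) i j = T a i j

lemma Holds.congr {N : ℕ} {m m' : Mem} {T : Tabs} (h : Holds N m T)
    (hm : ∀ a i j, a ≠ 3 → a ≠ 4 → a ≠ 5 → a ≠ 6 → m' a i j = m a i j) : Holds N m' T := by
  refine ⟨(hm 0 0 0 (by decide) (by decide) (by decide) (by decide)).trans h.1, fun a i j => ?_⟩
  obtain ⟨-, h3, h4, h5, h6⟩ := arr_ne a
  rw [hm _ _ _ h3 h4 h5 h6, h.2]

/-- A loop whose guard counts down from `N` and whose body takes at most `b` steps. -/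
lemma exec_loop {c : Cmd} {g : Expr} {N b : ℕ} (I : ℕ → Mem → Prop)
    (hg : ∀ i m, I i m → g.eval m = N - i)
    (hc : ∀ i, i < N → ∀ m, I i m → ∃ m' s, Exec c m m' s ∧ s ≤ b ∧ I (i + 1) m')
    {m : Mem} (h0 : I 0 m) :
    ∃ m' s, Exec (.loop g c) m m' s ∧ s ≤ N * (g.cost + 1 + b) + (g.cost + 1) ∧ I N m' := by
  suffices H : ∀ k i m, i + k = N → I i m → ∃ m' s, Exec (.loop g c) m m' s ∧
      s ≤ k * (g.cost + 1 + b) + (g.cost + 1) ∧ I N m' from H N 0 m (by simp) h0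
  intro k
  induction k with
  | zero =>
    intro i m hi hI
    have hi' : i = N := by simpa using hi
    subst hi'
    exact ⟨m, _, .loop_false (by rw [hg i m hI]; simp), by simp, hI⟩
  | succ k ih =>
    intro i m hi hI
    obtain ⟨m', s, h1, h2, h3⟩ := hc i (by omega) m hI
    obtain ⟨m'', t, h4, h5, h6⟩ := ih (i + 1) m' (by omega) h3
    refine ⟨m'', _, .loop_true (by rw [hg i m hI]; omega) h1 h4, ?_, h6⟩
    rw [Nat.succ_mul]
    omega

/-! ### Compilation of terms. -/

/-- Reading the entry `(k, 0)` of an array. -/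
abbrev cell (a k : ℕ) : Expr := .read a (.const k) (.const 0)

/-- Overwriting the entry `(k, 0)` of an array. -/
abbrev put (a k : ℕ) (e : Expr) : Cmd := .write a (.const k) (.const 0) e

lemma set_apply_ne {m : Mem} {a i j v a' i' j' : ℕ} (h : a' = a → i' ≠ i) :
    m.set a i j v a' i' j' = m a' i' j' :=
  if_neg fun e => h e.1 e.2.1

/-- The command `c` evaluates the term `t` with `d` variables into the stack cell `h` within
`p(N)` steps, and preserves the first `d` variables and the stack below `h`. -/
def Computes (t : Tm) (d h : ℕ) (c : Cmd) (p : Polynomial ℕ) : Prop :=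
  ∀ (N : ℕ) (T : Tabs) (m : Mem) (ρ : List ℕ), ρ.length = d → Holds N m T →
    (∀ k < d, m 3 k 0 = ρ.getD k 0) →
    ∃ m' s, Exec c m m' s ∧ s ≤ p.eval N ∧ m' 4 h 0 = t.eval N T ρ ∧
      ∀ a i j, (a = 3 → i < d) → (a = 4 → i < h) → m' a i j = m a i j

lemma computes_of_put {t : Tm} {d h : ℕ} {e : Expr}
    (he : ∀ (N : ℕ) (T : Tabs) (m : Mem) (ρ : List ℕ), ρ.length = d → Holds N m T →
      (∀ k < d, m 3 k 0 = ρ.getD k 0) → e.eval m = t.eval N T ρ) :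
    ∃ c p, Computes t d h c p := by
  refine ⟨put 4 h e, Polynomial.C (e.cost + 3), fun N T m ρ hρ hm hv =>
    ⟨_, _, .write m 4 _ _ e, ?_, ?_, ?_⟩⟩
  · simp [Expr.cost]; omega
  · simp [Mem.set, Expr.eval, he N T m ρ hρ hm hv]
  · exact fun a i j _ h4 => set_apply_ne fun e => (h4 e).ne

/-- The value of `s` waits in stack cell `h`; compiling `t` at height `h + 1` protects it until `e`
combines the two. -/
lemma Computes.binary {s t u : Tm} {d h : ℕ} {cs ct : Cmd} {ps pt : Polynomial ℕ} (e : Expr)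
    (hs : Computes s d h cs ps) (ht : Computes t d (h + 1) ct pt)
    (he : ∀ (N : ℕ) (T : Tabs) (m : Mem) (ρ : List ℕ), Holds N m T →
      m 4 h 0 = s.eval N T ρ → m 4 (h + 1) 0 = t.eval N T ρ → e.eval m = u.eval N T ρ) :
    ∃ c p, Computes u d h c p := by
  refine ⟨.seq cs (.seq ct (put 4 h e)), ps + pt + Polynomial.C (e.cost + 3), ?_⟩
  intro N T m ρ hρ hm hv
  obtain ⟨m₁, s₁, h1, h2, h3, h4⟩ := hs N T m ρ hρ hm hv
  have hm₁ : Holds N m₁ T := hm.congr fun a i j a3 a4 _ _ =>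
    h4 a i j (fun h => absurd h a3) (fun h => absurd h a4)
  obtain ⟨m₂, s₂, h5, h6, h7, h8⟩ := ht N T m₁ ρ hρ hm₁ fun k hk => by
    rw [h4 3 k 0 (fun _ => hk) (by simp), hv k hk]
  have hm₂ : Holds N m₂ T := hm₁.congr fun a i j a3 a4 _ _ =>
    h8 a i j (fun h => absurd h a3) (fun h => absurd h a4)
  refine ⟨_, _, .seq h1 (.seq h5 (.write m₂ 4 _ _ e)), ?_, ?_, ?_⟩
  · simp [Expr.cost]; omega
  · simp only [Mem.set, Expr.eval]
    simp only [and_self, if_true]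
    exact he N T m₂ ρ hm₂ (by rw [h8 4 h 0 (by simp) (by simp), h3]) h7
  · intro a i j a3 a4
    rw [← h4 a i j a3 a4, ← h8 a i j a3 (fun h => (a4 h).trans (Nat.lt_succ_self _))]
    exact set_apply_ne fun e => (a4 e).ne

/-- The running sum stays in stack cell `h` and the bound variable in cell `d` of array 3. The
summand is compiled for `d + 1` variables at height `h + 1`, so evaluating it preserves both. -/
lemma Computes.sum {t : Tm} {d h : ℕ} {ct : Cmd} {pt : Polynomial ℕ}
    (ht : Computes t (d + 1) (h + 1) ct pt) : ∃ c p, Computes t.sum d h c p := by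
  let g : Expr := .sub (cell 0 0) (cell 3 d)
  let body : Cmd := .seq ct (.seq (put 4 h (.add (cell 4 h) (cell 4 (h + 1))))
    (put 3 d (.add (cell 3 d) (.const 1))))
  refine ⟨.seq (put 4 h (.const 0)) (.seq (put 3 d (.const 0)) (.loop g body)),
    Polynomial.X * (Polynomial.C (g.cost + 1) + (pt + 30)) + Polynomial.C (g.cost + 1) + 30, ?_⟩
  intro N T m ρ hρ hm hv
  let I : ℕ → Mem → Prop := fun n m' => m' 3 d 0 = n ∧
    m' 4 h 0 = ∑ i ∈ Finset.range n, t.eval N T (ρ ++ [i]) ∧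
    ∀ a i j, (a = 3 → i < d) → (a = 4 → i < h) → m' a i j = m a i j
  have hold : ∀ n m', I n m' → Holds N m' T := fun n m' hI => hm.congr fun a i j a3 a4 _ _ =>
    hI.2.2 a i j (fun h => absurd h a3) (fun h => absurd h a4)
  obtain ⟨m', s, h1, h2, h3⟩ := exec_loop (c := body) (g := g) (N := N) (b := pt.eval N + 30) I
    (fun n m' hI => by
      have := (hold n m' hI).1
      simp [g, Expr.eval, hI.1, this])
    (fun n hn m' hI => by
      obtain ⟨m₁, s₁, h1, h2, h3, h4⟩ := ht N T m' (ρ ++ [n]) (by simp [hρ]) (hold n m' hI) (by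
        intro k hk
        rcases Nat.lt_succ_iff_lt_or_eq.1 hk with hk | rfl
        · rw [hI.2.2 3 k 0 (fun _ => hk) (by simp), hv k hk,
            List.getD_append _ _ _ _ (by omega)]
        · rw [hI.1, ← hρ]; simp)
      refine ⟨_, _, .seq h1 (.seq (.write m₁ 4 _ _ _) (.write _ 3 _ _ _)), ?_, ?_, ?_, ?_⟩
      · simp [Expr.cost]; omega
      · simp [Mem.set, Expr.eval, h4 3 d 0, hI.1]
      · simp [Mem.set, Expr.eval, h4 4 h 0, h3, hI.2.1, Finset.sum_range_succ]
      · intro a i j a3 a4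
        rw [← hI.2.2 a i j a3 a4, ← h4 a i j (fun h => (a3 h).trans (Nat.lt_succ_self _))
          (fun h => (a4 h).trans (Nat.lt_succ_self _))]
        exact (set_apply_ne fun e => (a3 e).ne).trans (set_apply_ne fun e => (a4 e).ne))
    (m := (m.set 4 h 0 0).set 3 d 0 0) (by
      refine ⟨by simp [Mem.set], by simp [Mem.set], fun a i j a3 a4 => ?_⟩
      exact (set_apply_ne fun e => (a3 e).ne).trans (set_apply_ne fun e => (a4 e).ne))
  refine ⟨m', _, .seq (.write m 4 _ _ _) (.seq (.write _ 3 _ _ _) h1), ?_, h3.2.1, h3.2.2⟩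
  simp [Expr.cost] at h2 ⊢
  nlinarith

lemma exists_computes (t : Tm) : ∀ d h, ∃ c p, Computes t d h c p := by
  induction t with
  | const k => exact fun d h => computes_of_put (e := .const k) fun _ _ _ _ _ _ _ => rfl
  | var k =>
    intro d h
    by_cases hk : k < d
    · exact computes_of_put (e := cell 3 k) fun N T m ρ hρ hm hv => by
        simp [Expr.eval, Tm.eval, hv k hk]
    -- An unbound variable has the default value 0 of `List.getD`.
    · exact computes_of_put (e := .const 0) fun N T m ρ hρ hm hv => by
        simp only [Expr.eval, Tm.eval]
        rw [List.getD_eq_default _ _ (by omega)]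
  | size =>
    exact fun d h => computes_of_put (e := cell 0 0) fun N T m ρ hρ hm hv => by
      simp [Expr.eval, Tm.eval, hm.1]
  | read a i j hi hj =>
    intro d h
    obtain ⟨ci, pi, hci⟩ := hi d h
    obtain ⟨cj, pj, hcj⟩ := hj d (h + 1)
    exact hci.binary (.read (arr a) (cell 4 h) (cell 4 (h + 1))) hcj fun N T m ρ hm h1 h2 => by
      simp [Expr.eval, Tm.eval, hm.2, h1, h2]
  | add i j hi hj =>
    intro d h
    obtain ⟨ci, pi, hci⟩ := hi d h
    obtain ⟨cj, pj, hcj⟩ := hj d (h + 1)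
    exact hci.binary (.add (cell 4 h) (cell 4 (h + 1))) hcj fun N T m ρ hm h1 h2 => by
      simp [Expr.eval, Tm.eval, h1, h2]
  | sub i j hi hj =>
    intro d h
    obtain ⟨ci, pi, hci⟩ := hi d h
    obtain ⟨cj, pj, hcj⟩ := hj d (h + 1)
    exact hci.binary (.sub (cell 4 h) (cell 4 (h + 1))) hcj fun N T m ρ hm h1 h2 => by
      simp [Expr.eval, Tm.eval, h1, h2]
  | ite b s t hb hs ht =>
    intro d h
    obtain ⟨cb, pb, hcb⟩ := hb d h
    obtain ⟨cs, ps, hcs⟩ := hs d h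
    obtain ⟨ct, pt, hct⟩ := ht d h
    refine ⟨.seq cb (.branch (cell 4 h) cs ct), pb + ps + pt + 10, ?_⟩
    intro N T m ρ hρ hm hv
    obtain ⟨m₁, s₁, h1, h2, h3, h4⟩ := hcb N T m ρ hρ hm hv
    have hm₁ : Holds N m₁ T := hm.congr fun a i j a3 a4 _ _ =>
      h4 a i j (fun h => absurd h a3) (fun h => absurd h a4)
    have hv₁ : ∀ k < d, m₁ 3 k 0 = ρ.getD k 0 := fun k hk => by
      rw [h4 3 k 0 (fun _ => hk) (by simp), hv k hk]
    by_cases hz : b.eval N T ρ = 0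
    · obtain ⟨m₂, s₂, h5, h6, h7, h8⟩ := hct N T m₁ ρ hρ hm₁ hv₁
      refine ⟨m₂, _, .seq h1 (.branch_false (by simp [Expr.eval, h3, hz]) h5), ?_, ?_, ?_⟩
      · simp [Expr.cost]; omega
      · simp [Tm.eval, hz, h7]
      · intro a i j a3 a4
        rw [h8 a i j a3 a4, h4 a i j a3 a4]
    · obtain ⟨m₂, s₂, h5, h6, h7, h8⟩ := hcs N T m₁ ρ hρ hm₁ hv₁
      refine ⟨m₂, _, .seq h1 (.branch_true (by simp [Expr.eval, h3, hz]) h5), ?_, ?_, ?_⟩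
      · simp [Expr.cost]; omega
      · simp [Tm.eval, hz, h7]
      · intro a i j a3 a4
        rw [h8 a i j a3 a4, h4 a i j a3 a4]
  | sum t ht =>
    intro d h
    obtain ⟨c, p, hc⟩ := ht (d + 1) (h + 1)
    exact hc.sum

/-! ### Compilation of programs. -/

/-- Two nested loops over `i, j < N`, with the counters in the variables `0` and `1`. -/
lemma exec_loop₂ {c : Cmd} {q : Polynomial ℕ} :
    ∃ (c' : Cmd) (q' : Polynomial ℕ), ∀ (N : ℕ) (I : ℕ → ℕ → Mem → Prop),
      (∀ i j m, I i j m → m 0 0 0 = N) →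
      (∀ i j m m', (∀ a k l, a ≠ 3 → m' a k l = m a k l) → I i j m → I i j m') →
      (∀ i m, I i N m → I (i + 1) 0 m) →
      (∀ i j m, i < N → j < N → m 3 0 0 = i → m 3 1 0 = j → I i j m →
        ∃ m' s, Exec c m m' s ∧ s ≤ q.eval N ∧ m' 3 0 0 = i ∧ m' 3 1 0 = j ∧ I i (j + 1) m') →
      ∀ m, I 0 0 m → ∃ m' s, Exec c' m m' s ∧ s ≤ q'.eval N ∧ I N 0 m' := by
  let g : ℕ → Expr := fun k => .sub (cell 0 0) (cell 3 k)
  let inc : ℕ → Cmd := fun k => put 3 k (.add (cell 3 k) (.const 1))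
  let inner : Cmd := .loop (g 1) (.seq c (inc 1))
  let q₁ : Polynomial ℕ := Polynomial.X * (q + 30) + 30
  refine ⟨.seq (put 3 0 (.const 0)) (.loop (g 0)
    (.seq (put 3 1 (.const 0)) (.seq inner (inc 0)))), Polynomial.X * (q₁ + 40) + 30, ?_⟩
  intro N I hN hcongr hrow hstep m hI
  have hset : ∀ i j k v (m : Mem), I i j m → I i j (m.set 3 k 0 v) := fun i j k v m h =>
    hcongr i j m _ (fun a k l ha => by simp [Mem.set, ha]) h
  obtain ⟨m', s, h1, h2, h3⟩ := exec_loop (c := .seq (put 3 1 (.const 0)) (.seq inner (inc 0)))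
    (g := g 0) (N := N) (b := q₁.eval N + 30) (fun i m => m 3 0 0 = i ∧ I i 0 m)
    (fun i m h => by simp [g, Expr.eval, h.1, hN _ _ _ h.2])
    (fun i hi m h => by
      obtain ⟨m', s, h1, h2, h3⟩ := exec_loop (c := .seq c (inc 1))
        (g := g 1) (N := N) (b := q.eval N + 20)
        (fun j m => m 3 0 0 = i ∧ m 3 1 0 = j ∧ I i j m)
        (fun j m h => by simp [g, Expr.eval, h.2.1, hN _ _ _ h.2.2])
        (fun j hj m h => by
          obtain ⟨m₁, s₁, h1, h2, h3, h4, h5⟩ := hstep i j m hi hj h.1 h.2.1 h.2.2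
          refine ⟨_, _, .seq h1 (.write m₁ 3 _ _ _), ?_, ?_, ?_, ?_⟩
          · simp [Expr.cost]; omega
          · simp [Mem.set, Expr.eval, h3]
          · simp [Mem.set, Expr.eval, h4]
          · exact hset _ _ _ _ _ h5)
        (m := m.set 3 1 0 0) ⟨by simp [Mem.set, h.1], by simp [Mem.set], hset _ _ _ _ _ h.2⟩
      refine ⟨_, _, .seq (.write m 3 _ _ _) (.seq h1 (.write m' 3 _ _ _)), ?_, ?_, ?_⟩
      · simp [q₁, g, Expr.cost] at h2 ⊢
        nlinarith
      · simp [Mem.set, Expr.eval, h3.1]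
      · exact hset _ _ _ _ _ (hrow _ _ h3.2.2))
    (m := m.set 3 0 0 0) ⟨by simp [Mem.set], hset _ _ _ _ _ hI⟩
  refine ⟨m', _, .seq (.write m 3 _ _ _) h1, ?_, h3.2⟩
  simp [q₁, g, Expr.cost] at h2 ⊢
  nlinarith

/-- The command `c` implements the program `p` within `q(N)` steps, preserving the first `l` loop
counters. -/
def Implements (p : Prog) (l : ℕ) (c : Cmd) (q : Polynomial ℕ) : Prop :=
  ∀ (N : ℕ) (T : Tabs) (m : Mem), Holds N m T →
    ∃ m' s, Exec c m m' s ∧ s ≤ q.eval N ∧ Holds N m' (p.run N T) ∧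
      ∀ k < l, m' 6 k 0 = m 6 k 0

/-- The term may read the very table that is assigned, so a first pass collects all values in the
buffer array 5 and a second pass copies them to `arr a`. -/
lemma exists_implements_assign (a : ℕ) (t : Tm) (l : ℕ) :
    ∃ c q, Implements (.assign a t) l c q := by
  obtain ⟨ct, pt, ht⟩ := exists_computes t 2 0
  obtain ⟨c₁, q₁, h₁⟩ := exec_loop₂ (c := .seq ct (.write 5 (cell 3 0) (cell 3 1) (cell 4 0)))
    (q := pt + 20)
  obtain ⟨c₂, q₂, h₂⟩ := exec_loop₂ (c := .write (arr a) (cell 3 0) (cell 3 1)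
    (.read 5 (cell 3 0) (cell 3 1))) (q := 30)
  obtain ⟨a0, a3, a4, a5, a6⟩ := arr_ne a
  refine ⟨.seq c₁ c₂, q₁ + q₂, ?_⟩
  intro N T m hm
  obtain ⟨m₁, s₁, e₁, b₁, H₁⟩ := h₁ N (fun i j m' =>
      (∀ a k l, a ≠ 3 → a ≠ 4 → a ≠ 5 → m' a k l = m a k l) ∧
      ∀ k l, k < N → l < N → (k < i ∨ k = i ∧ l < j) → m' 5 k l = t.eval N T [k, l])
    (fun i j m' h => by rw [h.1 0 0 0 (by decide) (by decide) (by decide), hm.1])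
    (fun i j m' m'' h hI => ⟨fun a k l a3 a4 a5 => by rw [h a k l a3, hI.1 a k l a3 a4 a5],
      fun k l hk hl hkl => by rw [h 5 k l (by decide), hI.2 k l hk hl hkl]⟩)
    (fun i m' h => ⟨h.1, fun k l hk hl hkl => h.2 k l hk hl (by omega)⟩)
    (fun i j m' hi hj h0 h1 hI => by
      have hm' : Holds N m' T := hm.congr fun a k l a3 a4 a5 _ => hI.1 a k l a3 a4 a5
      obtain ⟨m₁, s, e, b, r, f⟩ := ht N T m' [i, j] rfl hm' (fun k hk => by
        interval_cases k <;> simp [h0, h1])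
      have g0 : m₁ 3 0 0 = i := by rw [f 3 0 0 (by simp) (by simp), h0]
      have g1 : m₁ 3 1 0 = j := by rw [f 3 1 0 (by simp) (by simp), h1]
      refine ⟨_, _, .seq e (.write m₁ 5 _ _ _), ?_, ?_, ?_, ?_, ?_⟩
      · simp [Expr.cost]; omega
      · simp [Mem.set, g0]
      · simp [Mem.set, g1]
      · intro a k l a3 a4 a5
        simp only [Mem.set, a5, false_and, if_false]
        rw [f a k l (fun h => absurd h a3) (fun h => absurd h a4), hI.1 a k l a3 a4 a5]
      · intro k l hk hl hkl
        simp only [Mem.set, Expr.eval, g0, g1, r, true_and]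
        split_ifs with h
        · rw [h.1, h.2]
        · rw [f 5 k l (by simp) (by simp), hI.2 k l hk hl (by omega)])
    m ⟨fun _ _ _ _ _ _ => rfl, fun k l _ _ h => by omega⟩
  obtain ⟨m₂, s₂, e₂, b₂, H₂⟩ := h₂ N (fun i j m' =>
      (∀ b k l, b ≠ 3 → b ≠ arr a → m' b k l = m₁ b k l) ∧
      (∀ k l, m' (arr a) k l = if k < N ∧ l < N ∧ (k < i ∨ k = i ∧ l < j)
        then t.eval N T [k, l] else m (arr a) k l))
    (fun i j m' h => by
      rw [h.1 0 0 0 (by decide) (Ne.symm a0), H₁.1 0 0 0 (by decide) (by decide) (by decide), hm.1])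
    (fun i j m' m'' h hI => ⟨fun b k l b3 ba => by rw [h b k l b3, hI.1 b k l b3 ba],
      fun k l => by rw [h _ k l a3, hI.2 k l]⟩)
    (fun i m' h => ⟨h.1, fun k l => by
      rw [h.2 k l]
      exact if_congr (by omega) rfl rfl⟩)
    (fun i j m' hi hj h0 h1 hI => by
      refine ⟨_, _, .write m' _ _ _ _, ?_, ?_, ?_, ?_, ?_⟩
      · simp [Expr.cost]
      · simp [Mem.set, Ne.symm a3, h0]
      · simp [Mem.set, Ne.symm a3, h1]
      · intro b k l b3 ba
        simp only [Mem.set, ba, false_and, if_false]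
        rw [hI.1 b k l b3 ba]
      · intro k l
        simp only [Mem.set, Expr.eval, h0, h1, true_and]
        rw [hI.1 5 i j (by decide) (Ne.symm a5), H₁.2 i j hi hj (by omega), hI.2 k l]
        split_ifs with h h' h' <;> first | rfl | omega | skip
        rw [h.1, h.2])
    m₁ ⟨fun _ _ _ _ _ => rfl, fun k l => by
      rw [if_neg (by omega), H₁.1 _ k l a3 a4 a5]⟩
  have key : ∀ b k l, b ≠ 3 → b ≠ 4 → b ≠ 5 → b ≠ arr a → m₂ b k l = m b k l :=
    fun b k l b3 b4 b5 ba => by rw [H₂.1 b k l b3 ba, H₁.1 b k l b3 b4 b5]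
  refine ⟨m₂, _, .seq e₁ e₂, ?_, ⟨?_, ?_⟩, ?_⟩
  · simp; omega
  · rw [key 0 0 0 (by decide) (by decide) (by decide) (Ne.symm a0), hm.1]
  · intro b k l
    simp only [Prog.run]
    by_cases hb : b = a
    · subst hb
      rw [H₂.2 k l, hm.2]
      exact if_congr (by omega) rfl rfl
    · obtain ⟨-, b3, b4, b5, -⟩ := arr_ne b
      rw [key _ k l b3 b4 b5 (fun h => hb (arr_injective h)), hm.2, if_neg (by tauto)]
  · exact fun k _ => key 6 k 0 (by decide) (by decide) (by decide) (Ne.symm a6)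

/-- Every program of the table language runs in polynomial time on the machine. -/
theorem exists_implements (p : Prog) : ∀ l, ∃ c q, Implements p l c q := by
  induction p with
  | skip =>
    exact fun l => ⟨.skip, 1, fun N T m hm => ⟨m, 1, .skip m, by simp, hm, fun _ _ => rfl⟩⟩
  | assign a t => exact exists_implements_assign a t
  | seq p p' ih ih' =>
    intro l
    obtain ⟨c, q, h⟩ := ih l
    obtain ⟨c', q', h'⟩ := ih' l
    refine ⟨.seq c c', q + q', fun N T m hm => ?_⟩
    obtain ⟨m₁, s₁, e₁, b₁, H₁, k₁⟩ := h N T m hm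
    obtain ⟨m₂, s₂, e₂, b₂, H₂, k₂⟩ := h' N _ m₁ H₁
    exact ⟨m₂, _, .seq e₁ e₂, by simp; omega, H₂, fun k hk => by rw [k₂ k hk, k₁ k hk]⟩
  | cond t p p' ih ih' =>
    intro l
    obtain ⟨ct, pt, ht⟩ := exists_computes t 2 0
    obtain ⟨c, q, h⟩ := ih l
    obtain ⟨c', q', h'⟩ := ih' l
    refine ⟨.seq (put 3 0 (.const 0)) (.seq (put 3 1 (.const 0))
      (.seq ct (.branch (cell 4 0) c c'))), pt + q + q' + 30, fun N T m hm => ?_⟩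
    have hm₀ : Holds N ((m.set 3 0 0 0).set 3 1 0 0) T := hm.congr fun a i j a3 _ _ _ => by
      simp [Mem.set, a3]
    obtain ⟨m₁, s₁, e₁, b₁, r₁, f₁⟩ := ht N T _ [0, 0] rfl hm₀ (fun k hk => by
      interval_cases k <;> simp [Mem.set])
    have hm₁ : Holds N m₁ T := hm₀.congr fun a i j a3 a4 _ _ =>
      f₁ a i j (fun h => absurd h a3) (fun h => absurd h a4)
    have hk₁ : ∀ k, m₁ 6 k 0 = m 6 k 0 := fun k => by
      rw [f₁ 6 k 0 (by simp) (by simp)]; simp [Mem.set]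
    by_cases hz : t.eval N T [0, 0] = 0
    · obtain ⟨m₂, s₂, e₂, b₂, H₂, k₂⟩ := h' N T m₁ hm₁
      refine ⟨m₂, _, .seq (.write m 3 _ _ _) (.seq (.write _ 3 _ _ _)
        (.seq e₁ (.branch_false (by simp [Expr.eval, r₁, hz]) e₂))), ?_, ?_, ?_⟩
      · simp [Expr.cost]; omega
      · simpa [Prog.run, hz] using H₂
      · exact fun k hk => by rw [k₂ k hk, hk₁]
    · obtain ⟨m₂, s₂, e₂, b₂, H₂, k₂⟩ := h N T m₁ hm₁
      refine ⟨m₂, _, .seq (.write m 3 _ _ _) (.seq (.write _ 3 _ _ _)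
        (.seq e₁ (.branch_true (by simp [Expr.eval, r₁, hz]) e₂))), ?_, ?_, ?_⟩
      · simp [Expr.cost]; omega
      · simpa [Prog.run, hz] using H₂
      · exact fun k hk => by rw [k₂ k hk, hk₁]
  | iter p ih =>
    intro l
    -- The counter of this loop is entry `l` of array 6. The body is compiled to preserve `l + 1`
    -- counters, so this one survives it, and nested loops use higher entries.
    obtain ⟨c, q, h⟩ := ih (l + 1)
    let g : Expr := .sub (cell 0 0) (cell 6 l)
    refine ⟨.seq (put 6 l (.const 0)) (.loop g (.seq c (put 6 l (.add (cell 6 l) (.const 1))))),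
      Polynomial.X * (q + 40) + 30, fun N T m hm => ?_⟩
    obtain ⟨m', s, h1, h2, h3⟩ := exec_loop (c := .seq c (put 6 l (.add (cell 6 l) (.const 1))))
      (g := g) (N := N) (b := q.eval N + 20) (fun i m' => m' 6 l 0 = i ∧
        Holds N m' ((p.run N)^[i] T) ∧ ∀ k < l, m' 6 k 0 = m 6 k 0)
      (fun i m' hI => by simp [g, Expr.eval, hI.1, hI.2.1.1])
      (fun i hi m' hI => by
        obtain ⟨m₁, s₁, e₁, b₁, H₁, k₁⟩ := h N _ m' hI.2.1
        refine ⟨_, _, .seq e₁ (.write m₁ 6 _ _ _), ?_, ?_, ?_, ?_⟩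
        · simp [Expr.cost]; omega
        · simp [Mem.set, Expr.eval, k₁ l (Nat.lt_succ_self l), hI.1]
        · rw [Function.iterate_succ_apply']
          exact H₁.congr fun a i j _ _ _ a6 => by simp [Mem.set, a6]
        · intro k hk
          rw [← hI.2.2 k hk, ← k₁ k (by omega)]
          exact set_apply_ne fun _ => hk.ne)
      (m := m.set 6 l 0 0) ⟨by simp [Mem.set], hm.congr fun a i j _ _ _ a6 => by
        simp [Mem.set, a6], fun k hk => set_apply_ne fun _ => hk.ne⟩
    refine ⟨m', _, .seq (.write m 6 _ _ _) h1, ?_, h3.2.1, h3.2.2⟩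
    simp [g, Expr.cost] at h2 ⊢
    nlinarith

end Tab


/-! ### Matchings as involutions -/

namespace Matching

open Finset

variable {V : Type*}

/-- A matching of the relation `E`, given as an involution which moves the matched points. -/
structure IsMatch (E : V → V → Prop) (f : V → V) : Prop where
  invol : ∀ x, f (f x) = x
  adj : ∀ x, f x ≠ x → E x (f x)

/-- Modulo 2, the ones summed over `Z` cancel in pairs. -/
lemma even_card_of_involution {f : V → V} {Z : Finset V} (hf : ∀ x, f (f x) = x)
    (hZ : ∀ x ∈ Z, f x ∈ Z) (hne : ∀ x ∈ Z, f x ≠ x) : Even #Z := by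
  have h : ∑ _x ∈ Z, (1 : ZMod 2) = 0 :=
    sum_involution (fun x _ => f x) (fun _ _ => by decide) (fun x hx _ => hne x hx)
      (fun x hx => hZ x hx) fun x _ => hf x
  rw [sum_const, nsmul_one, ZMod.natCast_eq_zero_iff] at h
  exact even_iff_two_dvd.2 h

variable [DecidableEq V]

/-- The involution `f` with the pair of `y` removed. -/
def cut (f : V → V) (y x : V) : V := if x = y ∨ f x = y then x else f x

lemma cut_cut {f : V → V} (hf : ∀ x, f (f x) = x) (y x : V) : cut f y (cut f y x) = x := by
  unfold cut
  by_cases h : x = y ∨ f x = y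
  · simp [h]
  · push Not at h
    simp [h.1, h.2, hf]

variable [Fintype V]

/-- The fixed points of a map: the unmatched points of a matching. -/
def fixed (f : V → V) : Finset V := {x | f x = x}

@[simp] lemma mem_fixed {f : V → V} {x : V} : x ∈ fixed f ↔ f x = x := by simp [fixed]

open Classical in
/-- The smallest set which contains `u` and is closed under `f` and `g`. -/
noncomputable def comp (f g : V → V) (u : V) : Finset V :=
  {x | ∀ Z : Finset V, u ∈ Z → (∀ z ∈ Z, f z ∈ Z ∧ g z ∈ Z) → x ∈ Z}

/-! ### Components of the union of two matchings. -/

section comp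

variable {f g : V → V} {u : V}

lemma mem_comp {x : V} :
    x ∈ comp f g u ↔ ∀ Z : Finset V, u ∈ Z → (∀ z ∈ Z, f z ∈ Z ∧ g z ∈ Z) → x ∈ Z := by
  simp [comp]

lemma self_mem_comp : u ∈ comp f g u := mem_comp.2 fun _ h _ => h

lemma left_mem_comp {x : V} (hx : x ∈ comp f g u) : f x ∈ comp f g u :=
  mem_comp.2 fun Z h h' => (h' x (mem_comp.1 hx Z h h')).1

lemma right_mem_comp {x : V} (hx : x ∈ comp f g u) : g x ∈ comp f g u :=
  mem_comp.2 fun Z h h' => (h' x (mem_comp.1 hx Z h h')).2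

lemma comp_subset {Z : Finset V} (h : u ∈ Z) (h' : ∀ z ∈ Z, f z ∈ Z ∧ g z ∈ Z) :
    comp f g u ⊆ Z := fun _ hx => mem_comp.1 hx Z h h'

lemma comp_subset_of_forall {p : V → Prop} (h : p u)
    (h' : ∀ z ∈ comp f g u, p z → p (f z) ∧ p (g z)) : ∀ x ∈ comp f g u, p x := by
  classical
  intro x hx
  have := comp_subset (f := f) (g := g) (u := u) (Z := (comp f g u).filter p)
    (mem_filter.2 ⟨self_mem_comp, h⟩) (fun z hz => by
      obtain ⟨h1, h2⟩ := mem_filter.1 hz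
      exact ⟨mem_filter.2 ⟨left_mem_comp h1, (h' z h1 h2).1⟩,
        mem_filter.2 ⟨right_mem_comp h1, (h' z h1 h2).2⟩⟩) hx
  exact (mem_filter.1 this).2

variable (f g u) in
/-- The graph on the component of `u` whose edges are the pairs of `f` and of `g`. -/
def compGraph (hf : ∀ x, f (f x) = x) (hg : ∀ x, g (g x) = x) :
    SimpleGraph (comp f g u) where
  Adj a b := a ≠ b ∧ (f a = b ∨ g a = b)
  symm := ⟨by
    rintro a b ⟨h1, h2 | h2⟩
    · exact ⟨h1.symm, .inl (by rw [← h2, hf])⟩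
    · exact ⟨h1.symm, .inr (by rw [← h2, hg])⟩⟩
  loopless := ⟨fun a h => h.1 rfl⟩

/-- A component of two involutions is a path or a cycle: it has at most two ends. -/
lemma card_fixed_comp_le (hf : ∀ x, f (f x) = x) (hg : ∀ x, g (g x) = x) :
    #{x ∈ comp f g u | f x = x} + #{x ∈ comp f g u | g x = x} ≤ 2 := by
  classical
  let Γ := compGraph f g u hf hg
  have hreach : ∀ x (hx : x ∈ comp f g u), Γ.Reachable ⟨u, self_mem_comp⟩ ⟨x, hx⟩ := by
    have := comp_subset_of_forall (f := f) (g := g) (u := u)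
      (p := fun x => ∃ hx : x ∈ comp f g u, Γ.Reachable ⟨u, self_mem_comp⟩ ⟨x, hx⟩)
      ⟨self_mem_comp, .refl _⟩ (by
        rintro z hz ⟨_, h⟩
        refine ⟨⟨left_mem_comp hz, ?_⟩, ⟨right_mem_comp hz, ?_⟩⟩
        · by_cases e : z = f z
          · exact (Subtype.ext e : (⟨z, hz⟩ : comp f g u) = ⟨_, _⟩) ▸ h
          · exact h.trans (SimpleGraph.Adj.reachable ⟨fun h => e (congrArg Subtype.val h), .inl rfl⟩)
        · by_cases e : z = g z
          · exact (Subtype.ext e : (⟨z, hz⟩ : comp f g u) = ⟨_, _⟩) ▸ h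
          · exact h.trans (SimpleGraph.Adj.reachable ⟨fun h => e (congrArg Subtype.val h), .inr rfl⟩))
    exact fun x hx => (this x hx).2
  have hconn : Γ.Connected :=
    { preconnected := fun a b => (hreach a a.2).symm.trans (hreach b b.2)
      nonempty := ⟨⟨u, self_mem_comp⟩⟩ }
  have h1 := hconn.card_vert_le_card_edgeSet_add_one
  have h2 := Γ.sum_degrees_eq_twice_card_edges
  -- Being fixed by `f` or by `g` costs a point one possible neighbour. Summed over a connected
  -- graph on k points, which has at least k - 1 edges, this leaves at most 2k - 2(k - 1) = 2 fixed
  -- points.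
  have h3 : ∀ a : comp f g u, Γ.degree a + (if f a = a then 1 else 0) + (if g a = a then 1 else 0) ≤ 2 := by
    intro a
    have hsub : (Γ.neighborFinset a).image Subtype.val ⊆
        ((({f a.1} : Finset V)).erase a.1) ∪ (({g a.1} : Finset V).erase a.1) := by
      intro b hb
      obtain ⟨b, hb, rfl⟩ := mem_image.1 hb
      have hab : Γ.Adj a b := by simpa using hb
      have hne : b.1 ≠ a.1 := fun h => hab.1 (Subtype.ext h.symm)
      rcases hab.2 with h | h <;> simp [h, hne]
    have hcard := card_le_card hsub
    rw [card_image_of_injective _ Subtype.val_injective, SimpleGraph.card_neighborFinset_eq_degree]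
      at hcard
    have hf1 : #(({f a.1} : Finset V).erase a.1) + (if f a = a then 1 else 0) ≤ 1 := by
      split_ifs with h
      · simp [h]
      · simpa using card_erase_le (s := ({f a.1} : Finset V)) (a := a.1)
    have hg1 : #(({g a.1} : Finset V).erase a.1) + (if g a = a then 1 else 0) ≤ 1 := by
      split_ifs with h
      · simp [h]
      · simpa using card_erase_le (s := ({g a.1} : Finset V)) (a := a.1)
    have := card_union_le (({f a.1} : Finset V).erase a.1) (({g a.1} : Finset V).erase a.1)
    omega
  have h4 := sum_le_sum fun a (_ : a ∈ (univ : Finset (comp f g u))) => h3 a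
  rw [sum_add_distrib, sum_add_distrib, h2] at h4
  have e1 : ∀ k : V → V, ∑ a : comp f g u, (if k a = a then 1 else 0) = #{x ∈ comp f g u | k x = x} := by
    intro k
    rw [card_filter]
    exact sum_coe_sort (comp f g u) fun x => if k x = x then 1 else 0
  rw [e1 f, e1 g] at h4
  simp only [sum_const, card_univ, Fintype.card_coe, smul_eq_mul] at h4
  rw [Nat.card_eq_fintype_card, Nat.card_eq_fintype_card, Fintype.card_coe,
    ← SimpleGraph.edgeFinset_card] at h1
  omega

end comp

/-! ### Alternating paths, and odd cycles closed by one more edge. -/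

/-- The alternating path from `u` to `v` formed by two matchings `f` and `g`. -/
structure IsPath (E : V → V → Prop) (f g : V → V) (u v : V) : Prop where
  left : IsMatch E f
  right : IsMatch E g
  left_end : f u = u
  right_end : g v = v
  mem : v ∈ comp f g u

namespace IsPath

variable {E : V → V → Prop} {f g : V → V} {u v : V}

/-- The component has at most two ends in all. One of them is taken by `v` as a fixed point of `g`,
so `u` is the only fixed point of `f`. -/
lemma eq_left_end (h : IsPath E f g u v) {x : V} (hx : x ∈ comp f g u) (hfx : f x = x) :
    x = u := by
  have h1 := card_fixed_comp_le (u := u) h.left.invol h.right.invol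
  have h2 : 0 < #{x ∈ comp f g u | g x = x} :=
    card_pos.2 ⟨v, mem_filter.2 ⟨h.mem, h.right_end⟩⟩
  exact card_le_one.1 (show #{x ∈ comp f g u | f x = x} ≤ 1 by omega) x
    (mem_filter.2 ⟨hx, hfx⟩) u (mem_filter.2 ⟨self_mem_comp, h.left_end⟩)

lemma eq_right_end (h : IsPath E f g u v) {x : V} (hx : x ∈ comp f g u) (hgx : g x = x) :
    x = v := by
  have h1 := card_fixed_comp_le (u := u) h.left.invol h.right.invol
  have h2 : 0 < #{x ∈ comp f g u | f x = x} :=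
    card_pos.2 ⟨u, mem_filter.2 ⟨self_mem_comp, h.left_end⟩⟩
  exact card_le_one.1 (show #{x ∈ comp f g u | g x = x} ≤ 1 by omega) x
    (mem_filter.2 ⟨hx, hgx⟩) v (mem_filter.2 ⟨h.mem, h.right_end⟩)

end IsPath

/-- The part of the path from `u` to `v` before the point `y`. -/
noncomputable def before (f g : V → V) (u y : V) : Finset V := comp (cut f y) (cut g y) u

/-- The matching which covers the odd cycle formed by the path from `u` to `v` and the pair `uv`
except for `y`, and which agrees with `f` off the cycle. -/
noncomputable def around (f g : V → V) (u v y x : V) : V :=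
  if x = y then y
  else if x ∈ before f g u y then
    if g y ∈ before f g u y then (if x = u then v else f x) else g x
  else if x ∈ comp f g u then
    if g y ∈ before f g u y then (if x = v then u else g x) else f x
  else f x

section around

variable {E : V → V → Prop} {f g : V → V} {u v y : V}

lemma before_subset (hyu : y ≠ u) :
    before f g u y ⊆ (comp f g u).erase y := by
  refine comp_subset (mem_erase.2 ⟨hyu.symm, self_mem_comp⟩) fun z hz => ?_
  obtain ⟨h1, h2⟩ := mem_erase.1 hz
  unfold cut
  constructor <;> split_ifs with h
  · exact hz
  · push Not at h
    exact mem_erase.2 ⟨h.2, left_mem_comp h2⟩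
  · exact hz
  · push Not at h
    exact mem_erase.2 ⟨h.2, right_mem_comp h2⟩

lemma left_mem_before (hyu : y ≠ u) {x : V} (hx : x ∈ before f g u y)
    (hxy : f x ≠ y) : f x ∈ before f g u y := by
  have h1 := (mem_erase.1 (before_subset hyu hx)).1
  have := left_mem_comp hx
  rwa [cut, if_neg (by tauto)] at this

lemma right_mem_before (hyu : y ≠ u) {x : V} (hx : x ∈ before f g u y)
    (hxy : g x ≠ y) : g x ∈ before f g u y := by
  have h1 := (mem_erase.1 (before_subset hyu hx)).1
  have := right_mem_comp hx
  rwa [cut, if_neg (by tauto)] at this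

/-- A point `y` of the path other than its ends cuts it into two parts: `v` is not in the first
one, and exactly one of the neighbours of `y` is. -/
lemma before_spec (h : IsPath E f g u v) (hy : y ∈ comp f g u) (hyu : y ≠ u) (hyv : y ≠ v) :
    v ∉ before f g u y ∧ ((g y ∈ before f g u y ∧ f y ∉ before f g u y) ∨
      (f y ∈ before f g u y ∧ g y ∉ before f g u y)) := by
  have hle := card_fixed_comp_le (u := u) (cut_cut h.left.invol y) (cut_cut h.right.invol y)
  change #{x ∈ before f g u y | _} + #{x ∈ before f g u y | _} ≤ 2 at hle
  have hu : u ∈ ({x ∈ before f g u y | cut f y x = x} : Finset V) :=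
    mem_filter.2 ⟨self_mem_comp, by simp [cut, h.left_end]⟩
  have hv : v ∈ before f g u y → v ∈ ({x ∈ before f g u y | cut g y x = x} : Finset V) :=
    fun hv => mem_filter.2 ⟨hv, by simp [cut, h.right_end]⟩
  have hfy : f y ∈ before f g u y → f y ∈ ({x ∈ before f g u y | cut f y x = x} : Finset V) :=
    fun hv => mem_filter.2 ⟨hv, by simp [cut, h.left.invol]⟩
  have hgy : g y ∈ before f g u y → g y ∈ ({x ∈ before f g u y | cut g y x = x} : Finset V) :=
    fun hv => mem_filter.2 ⟨hv, by simp [cut, h.right.invol]⟩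
  have hfu : f y ≠ u := fun e => hyu (by rw [← h.left.invol y, e, h.left_end])
  have hgv : g y ≠ v := fun e => hyv (by rw [← h.right.invol y, e, h.right_end])
  have two : ∀ {A : Finset V} {a b : V}, a ∈ A → b ∈ A → a ≠ b → 2 ≤ #A := fun ha hb hab =>
    one_lt_card.2 ⟨_, ha, _, hb, hab⟩
  -- If neither neighbour of `y` were in the first part, that part would be closed under `f` and
  -- `g`, hence be the whole component and contain `y`.
  have hone : f y ∈ before f g u y ∨ g y ∈ before f g u y := by
    by_contra hcon
    push Not at hcon
    have hsub : comp f g u ⊆ before f g u y := comp_subset self_mem_comp fun z hz =>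
      ⟨left_mem_before hyu hz fun e => hcon.1 (by subst e; rwa [h.left.invol]),
        right_mem_before hyu hz fun e => hcon.2 (by subst e; rwa [h.right.invol])⟩
    exact (mem_erase.1 (before_subset hyu (hsub hy))).1 rfl
  -- Once `y` is cut off, `u` and any neighbour of `y` in the first part are ends of that part.
  -- There is room for two ends only, which excludes `v` here and a second neighbour of `y` below.
  have hv' : v ∉ before f g u y := fun hv' => by
    rcases hone with h1 | h1
    · have := two (hfy h1) hu hfu
      have := card_pos.2 ⟨_, hv hv'⟩
      omega
    · have := two (hgy h1) (hv hv') hgv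
      have := card_pos.2 ⟨_, hu⟩
      omega
  refine ⟨hv', ?_⟩
  by_cases h1 : f y ∈ before f g u y
  · refine .inr ⟨h1, fun h2 => ?_⟩
    have := two (hfy h1) hu hfu
    have := card_pos.2 ⟨_, hgy h2⟩
    omega
  · exact .inl ⟨hone.resolve_left h1, h1⟩

/-- The matching `around` misses `y` and no other point of the cycle. -/
lemma around_spec (hE : ∀ a b, E a b → E b a) (h : IsPath E f g u v) (huv : E u v) (hne : u ≠ v)
    (hy : y ∈ comp f g u) (hyu : y ≠ u) (hyv : y ≠ v) :
    IsMatch E (around f g u v y) ∧ around f g u v y y = y ∧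
      (∀ x ∈ comp f g u, around f g u v y x ∈ comp f g u) ∧
      (∀ x ∈ comp f g u, around f g u v y x = x → x = y) ∧
      ∀ x ∉ comp f g u, around f g u v y x = f x := by
  obtain ⟨hvY, hcase⟩ := before_spec h hy hyu hyv
  have hYS : ∀ x ∈ before f g u y, x ≠ y ∧ x ∈ comp f g u := fun x hx =>
    mem_erase.1 (before_subset hyu hx)
  have huY : u ∈ before f g u y := self_mem_comp
  have hfi := h.left.invol
  have hgi := h.right.invol
  have hfS : ∀ x, f x ∈ comp f g u ↔ x ∈ comp f g u := fun x =>
    ⟨fun hx => hfi x ▸ left_mem_comp hx, left_mem_comp⟩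
  have hgS : ∀ x, g x ∈ comp f g u ↔ x ∈ comp f g u := fun x =>
    ⟨fun hx => hgi x ▸ right_mem_comp hx, right_mem_comp⟩
  have hfY : ∀ x, x ≠ y → f x ≠ y → (f x ∈ before f g u y ↔ x ∈ before f g u y) := fun x h1 h2 =>
    ⟨fun hx => by
      have := left_mem_before hyu hx (by rwa [hfi])
      rwa [hfi] at this, fun hx => left_mem_before hyu hx h2⟩
  have hgY : ∀ x, x ≠ y → g x ≠ y → (g x ∈ before f g u y ↔ x ∈ before f g u y) := fun x h1 h2 =>
    ⟨fun hx => by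
      have := right_mem_before hyu hx (by rwa [hgi])
      rwa [hgi] at this, fun hx => right_mem_before hyu hx h2⟩
  have hfy : ∀ x, f x = y ↔ x = f y := fun x => ⟨fun e => by rw [← e, hfi], fun e => by rw [e, hfi]⟩
  have hgy : ∀ x, g x = y ↔ x = g y := fun x => ⟨fun e => by rw [← e, hgi], fun e => by rw [e, hgi]⟩
  have hfu : ∀ x, f x = u ↔ x = u := fun x => ⟨fun e => by rw [← hfi x, e, h.left_end],
    fun e => by rw [e, h.left_end]⟩
  have hgv : ∀ x, g x = v ↔ x = v := fun x => ⟨fun e => by rw [← hgi x, e, h.right_end],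
    fun e => by rw [e, h.right_end]⟩
  have hself : around f g u v y y = y := by simp [around]
  have hout : ∀ x ∉ comp f g u, around f g u v y x = f x := fun x hx => by
    have h1 : x ∉ before f g u y := fun h => hx (hYS x h).2
    have h2 : x ≠ y := fun e => hx (e ▸ hy)
    simp [around, h1, h2, hx]
  have hS : ∀ x ∈ comp f g u, x ≠ y → around f g u v y x ∈ comp f g u ∧
      around f g u v y x ≠ x ∧ E x (around f g u v y x) ∧
      around f g u v y (around f g u v y x) = x := by
    intro x hx hxy
    -- If `g y` comes before `y`, then `f` matches the part before `y` up to `u`, `g` matches the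
    -- part after `y` up to `v`, and `uv` completes the matching. If `f y` comes before `y`, then
    -- `g` matches the part before and `f` the part after, without `uv`.
    rcases hcase with ⟨hg1, hf1⟩ | ⟨hf1, hg1⟩
    · by_cases hxY : x ∈ before f g u y
      · by_cases hxu : x = u
        · subst hxu
          have e : around f g x v y x = v := by simp [around, hxy, hxY, hg1]
          have e' : around f g x v y v = x := by simp [around, hyv.symm, hvY, hg1, h.mem]
          rw [e]
          exact ⟨h.mem, hne.symm, huv, e'⟩
        · have hfxy : f x ≠ y := fun e => hf1 (((hfy x).1 e) ▸ hxY)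
          have e : around f g u v y x = f x := by simp [around, hxy, hxY, hg1, hxu]
          have e' : around f g u v y (f x) = x := by
            simp [around, hfxy, (hfY x hxy hfxy).2 hxY, hg1, hfu, hxu, hfi]
          have hfx : f x ≠ x := fun e => hxu (h.eq_left_end hx e)
          rw [e]
          exact ⟨left_mem_comp hx, hfx, h.left.adj x hfx, e'⟩
      · by_cases hxv : x = v
        · subst hxv
          have e : around f g u x y x = u := by simp [around, hxy, hxY, hg1, hx]
          have e' : around f g u x y u = x := by simp [around, hyu.symm, huY, hg1]
          rw [e]
          exact ⟨self_mem_comp, hne, hE _ _ huv, e'⟩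
        · have hgxy : g x ≠ y := fun e => hxY (((hgy x).1 e) ▸ hg1)
          have e : around f g u v y x = g x := by simp [around, hxy, hxY, hg1, hxv, hx]
          have e' : around f g u v y (g x) = x := by
            simp [around, hgxy, hgY x hxy hgxy, hxY, hg1, hgv, hxv, hgi, hgS, hx]
          have hgx : g x ≠ x := fun e => hxv (h.eq_right_end hx e)
          rw [e]
          exact ⟨right_mem_comp hx, hgx, h.right.adj x hgx, e'⟩
    · by_cases hxY : x ∈ before f g u y
      · have hgxy : g x ≠ y := fun e => hg1 (((hgy x).1 e) ▸ hxY)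
        have e : around f g u v y x = g x := by simp [around, hxy, hxY, hg1]
        have e' : around f g u v y (g x) = x := by
          simp [around, hgxy, hgY x hxy hgxy, hxY, hg1, hgi]
        have hgx : g x ≠ x := fun e => hvY (h.eq_right_end hx e ▸ hxY)
        rw [e]
        exact ⟨right_mem_comp hx, hgx, h.right.adj x hgx, e'⟩
      · have hfxy : f x ≠ y := fun e => hxY (((hfy x).1 e) ▸ hf1)
        have e : around f g u v y x = f x := by simp [around, hxy, hxY, hg1]
        have e' : around f g u v y (f x) = x := by
          simp [around, hfxy, hfY x hxy hfxy, hxY, hg1, hfi]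
        have hfx : f x ≠ x := fun e => hxY (h.eq_left_end hx e ▸ huY)
        rw [e]
        exact ⟨left_mem_comp hx, hfx, h.left.adj x hfx, e'⟩
  refine ⟨⟨fun x => ?_, fun x hx' => ?_⟩, hself, fun x hx => ?_, fun x hx e => ?_, hout⟩
  · by_cases hx : x ∈ comp f g u
    · by_cases hxy : x = y
      · rw [hxy, hself, hself]
      · exact (hS x hx hxy).2.2.2
    · rw [hout x hx, hout _ (by rwa [hfS]), hfi]
  · by_cases hx : x ∈ comp f g u
    · exact (hS x hx fun e => hx' (by rw [e, hself])).2.2.1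
    · rw [hout x hx] at hx' ⊢
      exact h.left.adj x hx'
  · by_cases hxy : x = y
    · rwa [hxy, hself]
    · exact (hS x hx hxy).1
  · by_contra hxy
    exact (hS x hx hxy).2.1 e

end around

end Matching


/-! ### Alternating forests with stored matchings -/

namespace Matching

open Finset

variable {V : Type*} [DecidableEq V]

/-- The matching `f` with the edge at `v` exchanged for `uv`, where `f` misses `u`. -/
def swap (f : V → V) (u v x : V) : V :=
  if x = u then v else if x = v then u else if x = f v then x else f x

lemma isMatch_swap {E : V → V → Prop} (hE : ∀ a b, E a b → E b a) {f : V → V} (hf : IsMatch E f) {u v : V}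
    (hu : f u = u) (huv : E u v) (hne : u ≠ v) : IsMatch E (swap f u v) := by
  have hi := hf.invol
  constructor
  · intro x
    unfold swap
    by_cases h1 : x = u
    · simp [h1, hne.symm]
    by_cases h2 : x = v
    · simp [h2, hne.symm]
    by_cases h3 : x = f v
    · simp [h3 ▸ h1, h3 ▸ h2, h3]
    have h4 : f x ≠ u := fun e => h1 (by rw [← hi x, e, hu])
    have h5 : f x ≠ v := fun e => h3 (by rw [← e, hi])
    have h6 : f x ≠ f v := fun e => h2 (by rw [← hi x, e, hi])
    simp [h1, h2, h3, h4, h5, h6, hi]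
  · intro x hx
    unfold swap at hx ⊢
    split_ifs at hx ⊢ with h1 h2 h3
    · rwa [h1]
    · rw [h2]; exact hE _ _ huv
    · exact absurd rfl hx
    · exact hf.adj x hx

variable [Fintype V]

/-- The state of the search: a matching `M`, the sets `O` and `I` of outer and of inner points of
the forest, and for every outer point `w` a matching `F w` of the size of `M` which misses `w`. -/
structure State (V : Type*) where
  M : V → V
  O : Finset V
  I : Finset V
  F : V → V → V

/-- The outer points fall into blobs (the classes of `β`), and every `F w` matches each inner point
into a blob and each blob up to exactly one point within itself. -/
structure Valid (E : V → V → Prop) (s : State V) (β pa : V → V) : Prop where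
  disjoint : ∀ x ∈ s.O, x ∉ s.I
  isMatch : IsMatch E s.M
  exposed : ∀ x, s.M x = x → x ∈ s.O
  touched : ∀ x, x ∈ s.O ∨ x ∈ s.I → s.M x ∈ s.O ∨ s.M x ∈ s.I
  isMatch_F : ∀ w ∈ s.O, IsMatch E (s.F w)
  missed : ∀ w ∈ s.O, s.F w w = w
  card_fixed : ∀ w ∈ s.O, #(fixed (s.F w)) = #(fixed s.M)
  outside : ∀ w ∈ s.O, ∀ x, x ∉ s.O → x ∉ s.I → s.F w x = s.M x
  inner : ∀ w ∈ s.O, ∀ i ∈ s.I, s.F w i = pa i ∨ s.F w i = s.M i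
  inner_mem : ∀ i ∈ s.I, pa i ∈ s.O ∧ s.M i ∈ s.O
  blob : ∀ w ∈ s.O, ∀ x ∈ s.O, s.F w x ∈ s.I ∨ (s.F w x ∈ s.O ∧ β (s.F w x) = β x)
  leaving : ∀ w ∈ s.O, ∀ x ∈ s.O,
    #{y ∈ s.O | β y = β x ∧ (s.F w y = y ∨ s.F w y ∈ s.I)} = 1
  blob_mem : ∀ x ∈ s.O, β x ∈ s.O

/-- The forest which consists of the points missed by `M`. -/
def start (M : V → V) : State V := ⟨M, fixed M, ∅, fun _ => M⟩

variable {E : V → V → Prop} {s : State V} {β pa : V → V}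

/-- Each exposed point is a blob by itself. -/
lemma valid_start {M : V → V} (hM : IsMatch E M) : Valid E (start M) id id where
  disjoint := by simp [start]
  isMatch := hM
  exposed := by simp [start]
  touched := by simp [start, hM.invol, eq_comm]
  isMatch_F := fun _ _ => hM
  missed := by simp [start]
  card_fixed := fun _ _ => rfl
  outside := fun _ _ _ _ _ => rfl
  inner := by simp [start]
  inner_mem := by simp [start]
  blob := fun w _ x hx => by
    have hx' : M x = x := by simpa [start] using hx
    simp [start, hx']
  leaving := fun w _ x hx => by
    have hx' : M x = x := by simpa [start] using hx
    rw [card_eq_one]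
    refine ⟨x, ?_⟩
    ext y
    simp only [start, id, mem_filter, mem_fixed, mem_singleton, notMem_empty, or_false]
    exact ⟨fun h => h.2.1, fun h => by subst h; exact ⟨hx', rfl, hx'⟩⟩
  blob_mem := fun _ h => h

/-- The effect of an edge from an outer point `u` to a point `v` outside the forest, which `M`
matches with `b`. -/
def grow (s : State V) (u v b : V) : State V where
  M := s.M
  O := insert b s.O
  I := insert v s.I
  F w := if w = b then swap (s.F u) u v else s.F w

/-- The new outer point `b` is a blob by itself, and `v` gets the parent `u`. Every old `F w` agrees
with `M` outside the forest, so it pairs `b` with the inner point `v`; the new `F b` is `F u` with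
the pair `vb` exchanged for `uv`, which exposes `b` in place of `u`. -/
lemma Valid.grow (h : Valid E s β pa) (hE : ∀ a b, E a b → E b a) {u v b : V} (hu : u ∈ s.O)
    (huv : E u v) (hvO : v ∉ s.O) (hvI : v ∉ s.I) (hb : s.M v = b) :
    Valid E (grow s u v b) (Function.update β b b) (Function.update pa v u) := by
  have hi := h.isMatch.invol
  have hins : ∀ {x y : V} {A : Finset V}, x ∈ insert y A → y = x ∨ x ∈ A := fun hx =>
    (mem_insert.1 hx).imp_left Eq.symm
  have hMb : s.M b = v := by rw [← hb, hi]
  have hbv : b ≠ v := fun e => hvO (h.exposed v (hb.trans e))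
  have hbO : b ∉ s.O := fun e => by
    have := h.touched b (.inl e); rw [hMb] at this; tauto
  have hbI : b ∉ s.I := fun e => by
    have := h.touched b (.inr e); rw [hMb] at this; tauto
  have huv' : u ≠ v := fun e => hvO (e ▸ hu)
  have hub : u ≠ b := fun e => hbO (e ▸ hu)
  have hOb : ∀ x ∈ s.O, x ≠ b := fun x hx e => hbO (e ▸ hx)
  have hOv : ∀ x ∈ s.O, x ≠ v := fun x hx e => hvO (e ▸ hx)
  have hIb : ∀ x ∈ s.I, x ≠ b := fun x hx e => hbI (e ▸ hx)
  have hIv : ∀ x ∈ s.I, x ≠ v := fun x hx e => hvI (e ▸ hx)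
  have hFv : ∀ w ∈ s.O, s.F w v = b := fun w hw => (h.outside w hw v hvO hvI).trans hb
  have hFb : ∀ w ∈ s.O, s.F w b = v := fun w hw => by rw [h.outside w hw b hbO hbI, hMb]
  have hFO : ∀ w ∈ s.O, ∀ x ∈ s.O, s.F w x ≠ v ∧ s.F w x ≠ b := fun w hw x hx =>
    ⟨fun e => hOb x hx (by rw [← (h.isMatch_F w hw).invol x, e, hFv w hw]),
      fun e => hOv x hx (by rw [← (h.isMatch_F w hw).invol x, e, hFb w hw])⟩
  have hsw : ∀ x, x ≠ u → x ≠ v → x ≠ b → swap (s.F u) u v x = s.F u x := fun x h1 h2 h3 => by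
    simp [swap, h1, h2, hFv u hu, h3]
  have hswu : swap (s.F u) u v u = v := by simp [swap]
  have hswv : swap (s.F u) u v v = u := by simp [swap, huv'.symm]
  have hswb : swap (s.F u) u v b = b := by simp [swap, hub.symm, hbv, hFv u hu]
  have hFold : ∀ w ∈ s.O, (Matching.grow s u v b).F w = s.F w := fun w hw => if_neg (hOb w hw)
  have hFnew : (Matching.grow s u v b).F b = swap (s.F u) u v := if_pos rfl
  have hβb : Function.update β b b b = b := by simp
  have hβ : ∀ x, x ≠ b → Function.update β b b x = β x := fun x hx => by simp [hx]
  -- Blob labels are outer points, so `b` is not yet in use as a label.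
  have hβne : ∀ x ∈ s.O, β x ≠ b := fun x hx => hOb _ (h.blob_mem x hx)
  refine ⟨?_, h.isMatch, ?_, ?_, ?_, ?_, ?_, ?_, ?_, ?_, ?_, ?_, ?_⟩
  · intro x hx hx'
    rcases hins hx with rfl | hx <;> rcases mem_insert.1 hx' with hx' | hx'
    · exact hbv hx'
    · exact hbI hx'
    · exact hOv x hx hx'
    · exact h.disjoint x hx hx'
  · exact fun x hx => mem_insert_of_mem (h.exposed x hx)
  · intro x hx
    change s.M x ∈ insert b s.O ∨ s.M x ∈ insert v s.I
    have hx' : x = b ∨ x = v ∨ x ∈ s.O ∨ x ∈ s.I := by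
      simp only [Matching.grow, mem_insert] at hx; tauto
    rcases hx' with rfl | rfl | hx'
    · rw [hMb]; simp
    · simp [hb]
    · have := h.touched x hx'
      simp only [mem_insert]; tauto
  · intro w hw
    rcases hins hw with rfl | hw
    · rw [hFnew]
      exact isMatch_swap hE (h.isMatch_F u hu) (h.missed u hu) huv huv'
    · rw [hFold w hw]; exact h.isMatch_F w hw
  · intro w hw
    rcases hins hw with rfl | hw
    · rw [hFnew, hswb]
    · rw [hFold w hw]; exact h.missed w hw
  · intro w hw
    rcases hins hw with rfl | hw
    · rw [hFnew]
      have e : fixed (swap (s.F u) u v) = insert b ((fixed (s.F u)).erase u) := by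
        ext x
        simp only [mem_insert, mem_erase, mem_fixed]
        by_cases h1 : x = u
        · simp [h1, hswu, huv'.symm, hub]
        by_cases h2 : x = v
        · simp [h2, hswv, huv', hbv.symm, hFv u hu, hbv]
        by_cases h3 : x = b
        · simp [h3, hswb]
        · simp [hsw x h1 h2 h3, h1, h3]
      rw [e, card_insert_of_notMem (by simp [hFb u hu, hbv.symm]),
        card_erase_add_one (by simp [h.missed u hu])]
      exact h.card_fixed u hu
    · rw [hFold w hw]; exact h.card_fixed w hw
  · intro w hw x hx hx'
    simp only [Matching.grow, mem_insert, not_or] at hx hx'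
    rcases hins hw with rfl | hw
    · rw [hFnew, hsw x (fun e => hx.2 (e ▸ hu)) hx'.1 hx.1]
      exact h.outside u hu x hx.2 hx'.2
    · rw [hFold w hw]; exact h.outside w hw x hx.2 hx'.2
  · intro w hw i hi'
    change _ ∨ _ = s.M i
    rcases hins hw with rfl | hw <;> rcases hins hi' with rfl | hi'
    · rw [hFnew, hswv]; simp
    · rw [hFnew, hsw i (fun e => h.disjoint u hu (e ▸ hi')) (hIv i hi') (hIb i hi')]
      simpa [hIv i hi'] using h.inner u hu i hi'
    · rw [hFold w hw, hFv w hw]; simp [hb]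
    · rw [hFold w hw]
      simpa [hIv i hi'] using h.inner w hw i hi'
  · intro i hi'
    change _ ∈ insert b s.O ∧ s.M i ∈ insert b s.O
    rcases hins hi' with rfl | hi'
    · simp [hu, hb]
    · simp [hIv i hi', h.inner_mem i hi']
  · intro w hw x hx
    change _ ∈ insert v s.I ∨ _ ∈ insert b s.O ∧ _
    rcases hins hw with rfl | hw <;> rcases hins hx with rfl | hx
    · rw [hFnew, hswb]; simp
    · rw [hFnew]
      by_cases hxu : x = u
      · subst hxu; simp [hswu]
      · rw [hsw x hxu (hOv x hx) (hOb x hx), hβ _ (hFO u hu x hx).2, hβ x (hOb x hx)]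
        have := h.blob u hu x hx
        simp only [mem_insert]; tauto
    · rw [hFold w hw, hFb w hw]; simp
    · rw [hFold w hw, hβ _ (hFO w hw x hx).2, hβ x (hOb x hx)]
      have := h.blob w hw x hx
      simp only [mem_insert]; tauto
  · intro w hw x hx
    change #{y ∈ insert b s.O | _ ∧ (_ ∨ _ ∈ insert v s.I)} = 1
    rcases hins hx with rfl | hx
    · rw [card_eq_one]
      refine ⟨b, ?_⟩
      ext y
      rw [mem_singleton]
      refine mem_filter.trans ?_
      constructor
      · rintro ⟨hy, hy', -⟩
        rcases mem_insert.1 hy with hy | hy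
        · exact hy
        · rw [hβb, hβ y (hOb y hy)] at hy'
          exact absurd hy' (hβne y hy)
      · rintro rfl
        refine ⟨mem_insert_self _ _, rfl, ?_⟩
        rcases hins hw with rfl | hw
        · exact .inl (by rw [hFnew, hswb])
        · exact .inr (by rw [hFold w hw, hFb w hw]; simp)
    · have key : ∀ w' ∈ s.O, (∀ y ∈ s.O, ((Matching.grow s u v b).F w y = y ∨
          (Matching.grow s u v b).F w y ∈ insert v s.I) ↔ (s.F w' y = y ∨ s.F w' y ∈ s.I)) →
          #{y ∈ insert b s.O | Function.update β b b y = Function.update β b b x ∧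
            ((Matching.grow s u v b).F w y = y ∨ (Matching.grow s u v b).F w y ∈ insert v s.I)} = 1 := by
        intro w' hw' hiff
        rw [← h.leaving w' hw' x hx]
        congr 1
        ext y
        simp only [mem_filter, mem_insert, hβ x (hOb x hx)]
        by_cases hyb : y = b
        · simp [hyb, hbO, Ne.symm (hβne x hx)]
        · rw [hβ y hyb]
          constructor
          · rintro ⟨hy, h1, h2⟩
            have hy := hy.resolve_left hyb
            exact ⟨hy, h1, (hiff y hy).1 (by simpa using h2)⟩
          · rintro ⟨hy, h1, h2⟩
            exact ⟨.inr hy, h1, by simpa using (hiff y hy).2 h2⟩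
      rcases hins hw with rfl | hw
      · refine key u hu fun y hy => ?_
        rw [hFnew]
        by_cases hyu : y = u
        · subst hyu; simp [hswu, h.missed y hu]
        · rw [hsw y hyu (hOv y hy) (hOb y hy), mem_insert]
          have := (hFO u hu y hy).1
          tauto
      · refine key w hw fun y hy => ?_
        rw [hFold w hw, mem_insert]
        have := (hFO w hw y hy).1
        tauto
  · intro x hx
    change _ ∈ insert b s.O
    rcases hins hx with rfl | hx
    · simp
    · rw [hβ x (hOb x hx)]; exact mem_insert_of_mem (h.blob_mem x hx)

/-! ### Augmentation. -/

/-- The matching obtained from the matchings `f` and `g`, which miss adjacent points `u` and `v`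
in different components. -/
noncomputable def augment (f g : V → V) (u v : V) : V → V :=
  if ∃ x ∈ comp f g u, x ≠ u ∧ f x = x then fun x => if x ∈ comp f g u then g x else f x
  else fun x => if x = u then v else if x = v then u else if x ∈ comp f g u then f x else g x

lemma left_mem_comp_iff {f g : V → V} {u : V} (hf : ∀ x, f (f x) = x) (x : V) :
    f x ∈ comp f g u ↔ x ∈ comp f g u :=
  ⟨fun hx => hf x ▸ left_mem_comp hx, left_mem_comp⟩

lemma right_mem_comp_iff {f g : V → V} {u : V} (hg : ∀ x, g (g x) = x) (x : V) :
    g x ∈ comp f g u ↔ x ∈ comp f g u :=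
  ⟨fun hx => hg x ▸ right_mem_comp hx, right_mem_comp⟩

/-- If `f` misses a second point of the component of `u`, both ends of this path are missed by `f`,
and passing from `f` to `g` on it covers both. Otherwise `f` on the component misses only `u`;
combined with `g` off the component, which misses `v`, it leaves room for the edge `uv`, and at
least one point fewer than for `g` is missed. -/
lemma augment_spec (hE : ∀ a b, E a b → E b a) {f g : V → V} {u v : V} (hf : IsMatch E f)
    (hg : IsMatch E g) (hu : f u = u) (hv : g v = v) (huv : E u v) (hvS : v ∉ comp f g u)
    (hcard : #(fixed f) = #(fixed g)) :
    IsMatch E (augment f g u v) ∧ #(fixed (augment f g u v)) < #(fixed f) := by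
  have hfS := left_mem_comp_iff (g := g) (u := u) hf.invol
  have hgS := right_mem_comp_iff (f := f) (u := u) hg.invol
  have huS : u ∈ comp f g u := self_mem_comp
  have hle := card_fixed_comp_le (u := u) hf.invol hg.invol
  unfold augment
  split_ifs with hx
  · obtain ⟨x, hxS, hxu, hfx⟩ := hx
    refine ⟨⟨fun y => ?_, fun y hy => ?_⟩, card_lt_card ?_⟩
    · by_cases hy : y ∈ comp f g u
      · simp [hy, hgS, hg.invol]
      · simp [hy, hfS, hf.invol]
    · by_cases hyS : y ∈ comp f g u <;> simp only [hyS, if_true, if_false] at hy ⊢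
      · exact hg.adj y hy
      · exact hf.adj y hy
    · have h2 : 1 < #{x ∈ comp f g u | f x = x} :=
        one_lt_card.2 ⟨x, by simp [hxS, hfx], u, by simp [huS, hu], hxu⟩
      have h0 : ∀ y ∈ comp f g u, g y ≠ y := fun y hy e => by
        have : 0 < #{x ∈ comp f g u | g x = x} := card_pos.2 ⟨y, by simp [hy, e]⟩
        omega
      refine (ssubset_iff_of_subset fun y hy => ?_).2 ⟨u, by simp [hu], ?_⟩
      · rw [mem_fixed] at hy ⊢
        by_cases hyS : y ∈ comp f g u <;> simp only [hyS, if_true, if_false] at hy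
        · exact absurd hy (h0 y hyS)
        · exact hy
      · simp [huS, h0]
  · push Not at hx
    have hne : u ≠ v := fun e => hvS (e ▸ huS)
    have hfu : ∀ y, f y = u ↔ y = u := fun y =>
      ⟨fun e => by rw [← hf.invol y, e, hu], fun e => by rw [e, hu]⟩
    have hgv : ∀ y, g y = v ↔ y = v := fun y =>
      ⟨fun e => by rw [← hg.invol y, e, hv], fun e => by rw [e, hv]⟩
    refine ⟨⟨fun y => ?_, fun y hy => ?_⟩, ?_⟩
    · by_cases h1 : y = u
      · simp [h1, hne.symm]
      by_cases h2 : y = v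
      · simp [h2, hne.symm]
      by_cases hyS : y ∈ comp f g u
      · have h3 : f y ≠ v := fun e => hvS (e ▸ left_mem_comp hyS)
        simp [h1, h2, hyS, hfu, h3, hfS, hf.invol]
      · have h3 : g y ≠ u := fun e => hyS ((hgS y).1 (e ▸ huS))
        simp [h1, h2, hyS, hgv, h3, hgS, hg.invol]
    · by_cases h1 : y = u
      · simp only [h1, if_true]; exact huv
      by_cases h2 : y = v
      · simp only [h2, hne.symm, if_true, if_false]; exact hE _ _ huv
      by_cases hyS : y ∈ comp f g u <;> simp only [h1, h2, hyS, if_true, if_false] at hy ⊢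
      · exact hf.adj y hy
      · exact hg.adj y hy
    · refine (card_le_card (t := (fixed g).erase v) fun y hy => ?_).trans_lt ?_
      · rw [mem_fixed] at hy
        rw [mem_erase, mem_fixed]
        by_cases h1 : y = u
        · simp [h1, hne.symm] at hy
        by_cases h2 : y = v
        · simp [h2, hne.symm, hne] at hy
        by_cases hyS : y ∈ comp f g u <;> simp only [h1, h2, hyS, if_true, if_false] at hy
        · exact absurd hy (hx y hyS h1)
        · exact ⟨h2, hy⟩
      · rw [hcard]
        exact card_erase_lt_of_mem (by simp [hv])

end Matching


/-! ### Merging blobs, and optimality of a stuck forest. -/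

namespace Matching

open Finset

variable {V : Type*} [DecidableEq V] [Fintype V]

variable {E : V → V → Prop} {s : State V} {β pa : V → V}

/-- The effect of an edge between two outer points: the inner points of `S` become outer ones. -/
def merge (s : State V) (S : Finset V) (H : V → V → V) : State V where
  M := s.M
  O := s.O ∪ S ∩ s.I
  I := s.I \ S
  F w := if w ∈ S ∩ s.I then H w else s.F w

namespace Valid

lemma mem_touched (h : Valid E s β pa) {w x : V} (hw : w ∈ s.O) (hx : x ∈ s.O ∨ x ∈ s.I) :
    s.F w x ∈ s.O ∨ s.F w x ∈ s.I := by
  rcases hx with hx | hx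
  · rcases h.blob w hw x hx with h' | h'
    · exact .inr h'
    · exact .inl h'.1
  · obtain ⟨h1, h2⟩ := h.inner_mem x hx
    rcases h.inner w hw x hx with h' | h' <;> rw [h'] <;> exact .inl ‹_›

lemma F_inner_mem (h : Valid E s β pa) {w i : V} (hw : w ∈ s.O) (hi : i ∈ s.I) :
    s.F w i ∈ s.O := by
  obtain ⟨h1, h2⟩ := h.inner_mem i hi
  rcases h.inner w hw i hi with h' | h' <;> rwa [h']

lemma eq_of_leaving (h : Valid E s β pa) {w x y : V} (hw : w ∈ s.O) (hx : x ∈ s.O) (hy : y ∈ s.O)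
    (hxy : β x = β y) (hx' : s.F w x = x ∨ s.F w x ∈ s.I) (hy' : s.F w y = y ∨ s.F w y ∈ s.I) :
    x = y :=
  card_le_one.1 (h.leaving w hw y hy).le x (by simp [hx, hxy, hx']) y (by simp [hy, hy'])

lemma exists_leaving (h : Valid E s β pa) {w x : V} (hw : w ∈ s.O) (hx : x ∈ s.O) :
    ∃ l ∈ s.O, β l = β x ∧ (s.F w l = l ∨ s.F w l ∈ s.I) := by
  obtain ⟨l, hl⟩ := card_eq_one.1 (h.leaving w hw x hx)
  have := mem_singleton_self l
  rw [← hl, mem_filter] at this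
  exact ⟨l, this⟩

variable {u v : V}

lemma isPath (h : Valid E s β pa) (hu : u ∈ s.O) (hv : v ∈ s.O)
    (hvS : v ∈ comp (s.F u) (s.F v) u) : IsPath E (s.F u) (s.F v) u v :=
  ⟨h.isMatch_F u hu, h.isMatch_F v hv, h.missed u hu, h.missed v hv, hvS⟩

lemma comp_touched (h : Valid E s β pa) (hu : u ∈ s.O) (hv : v ∈ s.O) :
    ∀ x ∈ comp (s.F u) (s.F v) u, x ∈ s.O ∨ x ∈ s.I :=
  comp_subset_of_forall (.inl hu) fun _ _ hz => ⟨h.mem_touched hu hz, h.mem_touched hv hz⟩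

/-- The path between two outer points contains both possible partners of its inner points. -/
lemma inner_partner_mem (h : Valid E s β pa) (hu : u ∈ s.O) (hv : v ∈ s.O) {i : V}
    (hiS : i ∈ comp (s.F u) (s.F v) u) (hi : i ∈ s.I) :
    pa i ∈ comp (s.F u) (s.F v) u ∧ s.M i ∈ comp (s.F u) (s.F v) u := by
  -- If both matchings gave `i` the same partner, these two points would be closed under both maps,
  -- and the component of `u` could not reach `i`. As each matching offers only two choices for the
  -- partner of `i`, both choices occur.
  have hne : s.F u i ≠ s.F v i := fun e => by
    have hiu : i ≠ u := fun e => h.disjoint u hu (e ▸ hi)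
    have hfi := (h.isMatch_F u hu).invol
    have hgi := (h.isMatch_F v hv).invol
    have := comp_subset_of_forall (f := s.F u) (g := s.F v) (u := u)
      (p := fun x => x ≠ i ∧ x ≠ s.F u i)
      ⟨hiu.symm, fun e' => hiu (by rw [← hfi i, ← e', h.missed u hu])⟩
      (fun z _ hz => by
        refine ⟨⟨fun e' => hz.2 (by rw [← e', hfi]), fun e' => hz.1 ?_⟩,
          ⟨fun e' => hz.2 (by rw [e, ← e', hgi]), fun e' => hz.1 ?_⟩⟩
        · rw [← hfi z, e', hfi]
        · rw [← hgi z, e', e, hgi]) i hiS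
    exact this.1 rfl
  have h1 : s.F u i ∈ comp (s.F u) (s.F v) u := left_mem_comp hiS
  have h2 : s.F v i ∈ comp (s.F u) (s.F v) u := right_mem_comp hiS
  rcases h.inner u hu i hi with e1 | e1 <;> rcases h.inner v hv i hi with e2 | e2 <;>
    rw [e1] at h1 hne <;> rw [e2] at h2 hne <;> first | exact absurd rfl hne | skip
  · exact ⟨h1, h2⟩
  · exact ⟨h2, h1⟩

/-- The path between two outer points contains the leaving point of each blob which it meets. -/
lemma leaving_mem (h : Valid E s β pa) (hu : u ∈ s.O) (hv : v ∈ s.O) {x l : V} (hxS : x ∈ comp (s.F u) (s.F v) u)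
    (hx : x ∈ s.O) (hl : l ∈ s.O) (hlx : β l = β x) (hl' : s.F u l = l ∨ s.F u l ∈ s.I) :
    l ∈ comp (s.F u) (s.F v) u := by
  by_contra hlS
  have hfi := (h.isMatch_F u hu).invol
  have hgi := (h.isMatch_F v hv).invol
  set Z : Finset V := {z ∈ s.O | z ∈ comp (s.F u) (s.F v) u ∧ β z = β x} with hZ
  have hmem : ∀ z, z ∈ Z ↔ z ∈ s.O ∧ z ∈ comp (s.F u) (s.F v) u ∧ β z = β x := fun z => by
    simp [hZ]
  have hfl : ∀ z ∈ Z, ¬ (s.F u z = z ∨ s.F u z ∈ s.I) := fun z hz hz' => by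
    obtain ⟨h1, h2, h3⟩ := (hmem z).1 hz
    exact hlS (h.eq_of_leaving hu h1 hl (h3.trans hlx.symm) hz' hl' ▸ h2)
  have hfZ : ∀ z ∈ Z, s.F u z ∈ Z := fun z hz => by
    obtain ⟨h1, h2, h3⟩ := (hmem z).1 hz
    rcases h.blob u hu z h1 with h' | h'
    · exact absurd (.inr h') (hfl z hz)
    · exact (hmem _).2 ⟨h'.1, left_mem_comp h2, h'.2.trans h3⟩
  -- `Z` is the part of the blob on the path. Since the only point that `F u` does not pair within
  -- the blob is off the path, `F u` pairs up all of `Z`.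
  have heven := even_card_of_involution hfi hfZ fun z hz e => hfl z hz (.inl e)
  obtain ⟨l', hl'O, hl'x, hl'g⟩ := h.exists_leaving hv hx
  have hgZ : ∀ z ∈ Z, z ≠ l' → s.F v z ≠ z ∧ s.F v z ∈ Z := fun z hz hne => by
    obtain ⟨h1, h2, h3⟩ := (hmem z).1 hz
    have hz' : ¬ (s.F v z = z ∨ s.F v z ∈ s.I) := fun hz' =>
      hne (h.eq_of_leaving hv h1 hl'O (h3.trans hl'x.symm) hz' hl'g)
    refine ⟨fun e => hz' (.inl e), ?_⟩
    rcases h.blob v hv z h1 with h' | h'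
    · exact absurd (.inr h') hz'
    · exact (hmem _).2 ⟨h'.1, right_mem_comp h2, h'.2.trans h3⟩
  by_cases hl'S : l' ∈ comp (s.F u) (s.F v) u
  · have hl'Z : l' ∈ Z := (hmem _).2 ⟨hl'O, hl'S, hl'x⟩
    have hgl' : s.F v l' ∉ Z.erase l' := fun hm => by
      obtain ⟨h1, h2⟩ := mem_erase.1 hm
      rcases hl'g with e | e
      · exact h1 e
      · exact h.disjoint _ ((hmem _).1 h2).1 e
    -- If the leaving point `l'` of `F v` is on the path, `F v` pairs up the rest of `Z`, against
    -- the parity just found.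
    have := even_card_of_involution (Z := Z.erase l') hgi (fun z hz => by
      obtain ⟨h1, h2⟩ := mem_erase.1 hz
      refine mem_erase.2 ⟨fun e => hgl' ?_, (hgZ z h2 h1).2⟩
      have hz' : s.F v l' = z := by rw [← e, hgi]
      rwa [hz']) fun z hz => (hgZ z (mem_erase.1 hz).2 (mem_erase.1 hz).1).1
    rw [card_erase_of_mem hl'Z] at this
    have hpos := card_pos.2 ⟨_, hl'Z⟩
    rw [Nat.even_sub hpos] at this
    simp [heven] at this
  · have hgZ' : ∀ z ∈ Z, s.F v z ∈ Z := fun z hz =>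
      (hgZ z hz fun e => hl'S (e ▸ ((hmem z).1 hz).2.1)).2
    -- If `l'` is off the path, `Z` is closed under both matchings and avoids `u`, so the path never
    -- enters it.
    have huZ : u ∉ Z := fun hm => hfl u hm (.inl (h.missed u hu))
    have := comp_subset_of_forall (f := s.F u) (g := s.F v) (u := u) (p := fun z => z ∉ Z) huZ
      (fun z _ hz => ⟨fun e => hz (by rw [← hfi z]; exact hfZ _ e),
        fun e => hz (by rw [← hgi z]; exact hgZ' _ e)⟩) x hxS
    exact this ((hmem x).2 ⟨hx, hxS, rfl⟩)

/-- In the union of the blobs which meet the path and of its inner points, every stored matching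
leaves exactly one point. -/
lemma card_leaving_union (h : Valid E s β pa) (hu : u ∈ s.O) (hv : v ∈ s.O)
    (hvS : v ∈ comp (s.F u) (s.F v) u) {w : V} (hw : w ∈ s.O) {S : Finset V}
    (hS : S = comp (s.F u) (s.F v) u) :
    #{y ∈ s.O | β y ∈ (S ∩ s.O).image β ∧ (s.F w y = y ∨ s.F w y ∈ s.I \ S)} = 1 := by
  set B := (S ∩ s.O).image β with hB
  have huS : u ∈ S := hS ▸ self_mem_comp
  have hcount : ∀ w ∈ s.O, #{y ∈ s.O | β y ∈ B ∧ (s.F w y = y ∨ s.F w y ∈ s.I)} = #B := by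
    intro w hw
    rw [card_eq_sum_card_fiberwise (f := β) (t := B) fun y hy => (mem_filter.1 hy).2.1,
      card_eq_sum_ones]
    refine sum_congr rfl fun b hb => ?_
    obtain ⟨x, hx, rfl⟩ := mem_image.1 hb
    rw [← h.leaving w hw x (mem_inter.1 hx).2]
    congr 1
    ext y
    simp only [mem_filter]
    constructor
    · tauto
    · rintro ⟨h1, h2, h3⟩
      exact ⟨⟨h1, h2 ▸ hb, h3⟩, h2⟩
  have hback : ∀ w ∈ s.O, #{y ∈ s.O | β y ∈ B ∧ s.F w y ∈ S ∩ s.I} = #(S ∩ s.I) := by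
    intro w hw
    have hwi := (h.isMatch_F w hw).invol
    refine card_bij' (fun y _ => s.F w y) (fun i _ => s.F w i) ?_ ?_ ?_ ?_
    · exact fun y hy => (mem_filter.1 hy).2.2
    · intro i hi
      obtain ⟨h1, h2⟩ := mem_inter.1 hi
      have hO := h.F_inner_mem hw h2
      have hmem : s.F w i ∈ S := by
        rw [hS] at h1 ⊢
        have := h.inner_partner_mem hu hv h1 h2
        rcases h.inner w hw i h2 with e | e <;> rw [e]
        · exact this.1
        · exact this.2
      exact mem_filter.2 ⟨hO, mem_image_of_mem _ (mem_inter.2 ⟨hmem, hO⟩), by rwa [hwi]⟩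
    · exact fun y _ => hwi y
    · exact fun y _ => hwi y
  -- Computed with `F u`: its leaving points in these blobs all lie on the path, where one is `u`
  -- itself and the others are the partners of the inner points of the path. For a general `w`, the
  -- leaving points again number `#B`, and `#(S ∩ s.I)` of them go to inner points of the path; one
  -- remains.
  have hBcard : #B = #(S ∩ s.I) + 1 := by
    rw [← hcount u hu, ← hback u hu]
    have : ({y ∈ s.O | β y ∈ B ∧ (s.F u y = y ∨ s.F u y ∈ s.I)} : Finset V) =
        insert u {y ∈ s.O | β y ∈ B ∧ s.F u y ∈ S ∩ s.I} := by
      ext y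
      simp only [mem_filter, mem_insert, mem_inter]
      constructor
      · rintro ⟨h1, h2, h3⟩
        obtain ⟨x, hx, hxy⟩ := mem_image.1 h2
        obtain ⟨hxS, hxO⟩ := mem_inter.1 hx
        have hyS : y ∈ S := by
          rw [hS] at hxS ⊢
          exact h.leaving_mem hu hv hxS hxO h1 hxy.symm h3
        rcases h3 with h3 | h3
        · exact .inl ((h.isPath hu hv hvS).eq_left_end (hS ▸ hyS) h3)
        · refine .inr ⟨h1, h2, ?_, h3⟩
          rw [hS] at hyS ⊢
          exact left_mem_comp hyS
      · rintro (rfl | ⟨h1, h2, h3, h4⟩)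
        · exact ⟨hu, mem_image_of_mem _ (mem_inter.2 ⟨huS, hu⟩), .inl (h.missed y hu)⟩
        · exact ⟨h1, h2, .inr h4⟩
    rw [this, card_insert_of_notMem]
    simp only [mem_filter, mem_inter, h.missed u hu]
    exact fun hc => h.disjoint u hu hc.2.2.2
  have hsum : #{y ∈ s.O | β y ∈ B ∧ (s.F w y = y ∨ s.F w y ∈ s.I \ S)} +
      #{y ∈ s.O | β y ∈ B ∧ s.F w y ∈ S ∩ s.I} = #B := by
    rw [← hcount w hw, ← card_union_of_disjoint]
    · congr 1
      ext y
      simp only [mem_union, mem_filter, mem_sdiff, mem_inter]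
      tauto
    · rw [disjoint_left]
      intro y hy hy'
      simp only [mem_filter, mem_sdiff, mem_inter] at hy hy'
      rcases hy.2.2 with e | e
      · exact h.disjoint y hy.1 (e ▸ hy'.2.2.2)
      · exact e.2 hy'.2.2.1
  have := hback w hw
  omega

-- All blobs that meet the path fuse with its inner points into one blob. For an old `w`, the single
-- leaving point of the new blob is provided by `card_leaving_union`. For a new `w`, `H w` pairs up
-- all of the path except `w`, and off the path it is `F u`, which by `leaving_mem` has no leaving
-- point of the merged blobs there.
open Classical in
protected lemma merge (h : Valid E s β pa) (hu : u ∈ s.O) (hv : v ∈ s.O)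
    (hvS : v ∈ comp (s.F u) (s.F v) u) {S : Finset V} (hS : S = comp (s.F u) (s.F v) u)
    {H : V → V → V} (hH : ∀ y ∈ S ∩ s.I, IsMatch E (H y) ∧ H y y = y ∧ (∀ x ∈ S, H y x ∈ S) ∧
      (∀ x ∈ S, H y x = x → x = y) ∧ ∀ x ∉ S, H y x = s.F u x) :
    ∃ β', Valid E (Matching.merge s S H) β' pa := by
  set B := (S ∩ s.O).image β with hB
  have huS : u ∈ S := hS ▸ self_mem_comp
  have hST : ∀ x ∈ S, x ∈ s.O ∨ x ∈ s.I := by rw [hS]; exact h.comp_touched hu hv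
  have hfi := (h.isMatch_F u hu).invol
  have hfS : ∀ x, s.F u x ∈ S ↔ x ∈ S := by rw [hS]; exact left_mem_comp_iff hfi
  have hBmem : ∀ x ∈ S, x ∈ s.O → β x ∈ B := fun x h1 h2 =>
    mem_image_of_mem _ (mem_inter.2 ⟨h1, h2⟩)
  have hpart : ∀ w ∈ s.O, ∀ i ∈ S, i ∈ s.I → s.F w i ∈ S ∧ s.F w i ∈ s.O := fun w hw i h1 h2 => by
    refine ⟨?_, h.F_inner_mem hw h2⟩
    rw [hS] at h1 ⊢
    have := h.inner_partner_mem hu hv h1 h2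
    rcases h.inner w hw i h2 with e | e <;> rw [e]
    · exact this.1
    · exact this.2
  have hFI : ∀ w ∈ s.O, ∀ y ∈ s.O, s.F w y ∈ s.I → s.F w y ∈ S → y ∈ S := fun w hw y hy h1 h2 => by
    have := (hpart w hw _ h2 h1).1
    rwa [(h.isMatch_F w hw).invol] at this
  have hleave : ∀ y ∈ s.O, β y ∈ B → (s.F u y = y ∨ s.F u y ∈ s.I) → y ∈ S := by
    intro y hy h2 h3
    obtain ⟨x, hx, hxy⟩ := mem_image.1 h2
    obtain ⟨hxS, hxO⟩ := mem_inter.1 hx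
    rw [hS] at hxS ⊢
    exact h.leaving_mem hu hv hxS hxO hy hxy.symm h3
  -- The members of the new blob. Its label `β u` lies in `B`, so no outer point of another blob
  -- carries it.
  let special : V → Prop := fun x => (x ∈ S ∧ x ∈ s.I) ∨ β x ∈ B
  let β' : V → V := fun x => if special x then β u else β x
  have hSspecial : ∀ x ∈ S, special x := fun x hx =>
    (hST x hx).elim (fun h => .inr (hBmem x hx h)) fun h => .inl ⟨hx, h⟩
  have hβs : ∀ {x}, special x → β' x = β u := fun hx => if_pos hx
  have hβn : ∀ {x}, ¬ special x → β' x = β x := fun hx => if_neg hx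
  have huB : β u ∈ B := hBmem u huS hu
  have hβeq : ∀ {x}, special x → ∀ {y}, β' y = β' x ↔ special y := by
    intro x hx y
    rw [hβs hx]
    by_cases hy : special y
    · simp [hβs hy, hy]
    · rw [hβn hy]
      exact ⟨fun e => .inr (e ▸ huB), fun e => absurd e hy⟩
  have hβO : ∀ x ∈ s.O, ∀ y ∈ s.O, β y = β x → β' y = β' x := by
    intro x hx y hy e
    have hxI := h.disjoint x hx
    have hyI := h.disjoint y hy
    simp only [β', special, e, hxI, hyI, and_false, false_or]
  have hold : ∀ w ∈ s.O, (Matching.merge s S H).F w = s.F w := fun w hw =>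
    if_neg fun hm => h.disjoint w hw (mem_inter.1 hm).2
  have hnew : ∀ w ∈ S ∩ s.I, (Matching.merge s S H).F w = H w := fun w hw => if_pos hw
  have hO : ∀ {x}, x ∈ (Matching.merge s S H).O ↔ x ∈ s.O ∨ x ∈ S ∩ s.I := mem_union
  have hI : ∀ {x}, x ∈ (Matching.merge s S H).I ↔ x ∈ s.I ∧ x ∉ S := mem_sdiff
  have hT : ∀ {x}, x ∈ (Matching.merge s S H).O ∨ x ∈ (Matching.merge s S H).I ↔
      x ∈ s.O ∨ x ∈ s.I := by
    intro x
    rw [hO, hI, mem_inter]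
    tauto
  have hSO : ∀ x ∈ S, x ∈ (Matching.merge s S H).O := fun x hx =>
    hO.2 ((hST x hx).imp id fun h => mem_inter.2 ⟨hx, h⟩)
  have hOS : ∀ {x}, x ∈ (Matching.merge s S H).O → x ∉ S → x ∈ s.O := fun hx hxS =>
    (hO.1 hx).resolve_right fun hm => hxS (mem_inter.1 hm).1
  refine ⟨β', ?_, h.isMatch, ?_, ?_, ?_, ?_, ?_, ?_, ?_, ?_, ?_, ?_, ?_⟩
  · intro x hx hx'
    rw [hI] at hx'
    exact h.disjoint x (hOS hx hx'.2) hx'.1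
  · exact fun x hx => hO.2 (.inl (h.exposed x hx))
  · exact fun x hx => hT.2 (h.touched x (hT.1 hx))
  · intro w hw
    rcases hO.1 hw with hw | hw
    · rw [hold w hw]; exact h.isMatch_F w hw
    · rw [hnew w hw]; exact (hH w hw).1
  · intro w hw
    rcases hO.1 hw with hw | hw
    · rw [hold w hw]; exact h.missed w hw
    · rw [hnew w hw]; exact (hH w hw).2.1
  · intro w hw
    change _ = #(fixed s.M)
    rcases hO.1 hw with hw | hw
    · rw [hold w hw]; exact h.card_fixed w hw
    · rw [hnew w hw, ← h.card_fixed u hu]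
      obtain ⟨-, hww, hHS, hfix, hout⟩ := hH w hw
      obtain ⟨hwS, hwI⟩ := mem_inter.1 hw
      have : fixed (H w) = insert w ((fixed (s.F u)).erase u) := by
        ext x
        simp only [mem_fixed, mem_insert, mem_erase]
        by_cases hx : x ∈ S
        · constructor
          · exact fun e => .inl (hfix x hx e)
          · rintro (rfl | ⟨h1, h2⟩)
            · exact hww
            · exact absurd ((h.isPath hu hv hvS).eq_left_end (hS ▸ hx) h2) h1
        · rw [hout x hx]
          constructor
          · exact fun e => .inr ⟨fun e' => hx (e' ▸ huS), e⟩
          · rintro (rfl | ⟨h1, h2⟩)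
            · exact absurd hwS hx
            · exact h2
      rw [this, card_insert_of_notMem, card_erase_add_one]
      · simp [h.missed u hu]
      · simp only [mem_erase, mem_fixed]
        exact fun hc => h.disjoint _ (hc.2 ▸ h.F_inner_mem hu hwI) hwI
  · intro w hw x hx hx'
    change _ = s.M x
    have hxT : ¬ (x ∈ s.O ∨ x ∈ s.I) := fun hc => (hT.2 hc).elim hx hx'
    push Not at hxT
    have hxS : x ∉ S := fun hc => hx (hSO x hc)
    rcases hO.1 hw with hw | hw
    · rw [hold w hw]; exact h.outside w hw x hxT.1 hxT.2
    · rw [hnew w hw, (hH w hw).2.2.2.2 x hxS]; exact h.outside u hu x hxT.1 hxT.2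
  · intro w hw i hi
    change _ ∨ _ = s.M i
    rw [hI] at hi
    rcases hO.1 hw with hw | hw
    · rw [hold w hw]; exact h.inner w hw i hi.1
    · rw [hnew w hw, (hH w hw).2.2.2.2 i hi.2]; exact h.inner u hu i hi.1
  · intro i hi
    have := h.inner_mem i (hI.1 hi).1
    exact ⟨hO.2 (.inl this.1), hO.2 (.inl this.2)⟩
  · have key : ∀ w ∈ s.O, ∀ x ∈ s.O, s.F w x ∈ (Matching.merge s S H).I ∨
        (s.F w x ∈ (Matching.merge s S H).O ∧ β' (s.F w x) = β' x) := by
      intro w hw x hx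
      rcases h.blob w hw x hx with h' | h'
      · by_cases hS' : s.F w x ∈ S
        · exact .inr ⟨hSO _ hS', (hβeq (hSspecial x (hFI w hw x hx h' hS'))).2 (hSspecial _ hS')⟩
        · exact .inl (hI.2 ⟨h', hS'⟩)
      · exact .inr ⟨hO.2 (.inl h'.1), hβO x hx _ h'.1 h'.2⟩
    intro w hw x hx
    rcases hO.1 hw with hw | hw
    · rw [hold w hw]
      rcases hO.1 hx with hx | hx
      · exact key w hw x hx
      · obtain ⟨hxS, hxI⟩ := mem_inter.1 hx
        obtain ⟨h1, h2⟩ := hpart w hw x hxS hxI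
        exact .inr ⟨hO.2 (.inl h2), (hβeq (hSspecial x hxS)).2 (hSspecial _ h1)⟩
    · rw [hnew w hw]
      obtain ⟨-, -, hHS, -, hout⟩ := hH w hw
      by_cases hxS : x ∈ S
      · exact .inr ⟨hSO _ (hHS x hxS), (hβeq (hSspecial x hxS)).2 (hSspecial _ (hHS x hxS))⟩
      · rw [hout x hxS]
        exact key u hu x (hOS hx hxS)
  · have ordinary : ∀ w ∈ s.O, ∀ x, ¬ special x → x ∈ s.O →
        #{y ∈ (Matching.merge s S H).O | β' y = β' x ∧
          (s.F w y = y ∨ s.F w y ∈ (Matching.merge s S H).I)} = 1 := by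
      intro w hw x hx hxO
      rw [← h.leaving w hw x hxO]
      congr 1
      ext y
      simp only [mem_filter]
      have hys : β' y = β' x → ¬ special y := fun e hy => hx ((hβeq hy).1 e.symm)
      constructor
      · rintro ⟨h1, h2, h3⟩
        have hy := hys h2
        refine ⟨hOS h1 fun hc => hy (hSspecial y hc), ?_, h3.imp id fun h3 => (hI.1 h3).1⟩
        rwa [hβn hy, hβn hx] at h2
      · rintro ⟨h1, h2, h3⟩
        have h2' := hβO x hxO y h1 h2
        refine ⟨hO.2 (.inl h1), h2', h3.imp id fun h3 => hI.2 ⟨h3, fun hc => hys h2' ?_⟩⟩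
        exact hSspecial y (hFI w hw y h1 h3 hc)
    intro w hw x hx
    rcases hO.1 hw with hw | hw
    · rw [hold w hw]
      by_cases hsp : special x
      · rw [← h.card_leaving_union hu hv hvS hw hS]
        congr 1
        ext y
        simp only [mem_filter, hβeq hsp]
        constructor
        · rintro ⟨h1, h2, h3⟩
          have hyI : ¬ (y ∈ S ∧ y ∈ s.I) := fun ⟨hyS, hyI⟩ => by
            have := (hpart w hw y hyS hyI).2
            rcases h3 with h3 | h3
            · exact h.disjoint _ this (h3.symm ▸ hyI)
            · exact h.disjoint _ this (hI.1 h3).1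
          exact ⟨(hO.1 h1).resolve_right fun hc => hyI (mem_inter.1 hc),
            h2.resolve_left hyI, h3⟩
        · rintro ⟨h1, h2, h3⟩
          exact ⟨hO.2 (.inl h1), .inr h2, h3⟩
      · exact ordinary w hw x hsp (hOS hx fun hc => hsp (hSspecial x hc))
    · rw [hnew w hw]
      obtain ⟨-, hww, hHS, hfix, hout⟩ := hH w hw
      by_cases hsp : special x
      · rw [card_eq_one]
        refine ⟨w, ?_⟩
        ext y
        simp only [mem_filter, hβeq hsp, mem_singleton]
        constructor
        · rintro ⟨h1, h2, h3⟩
          by_cases hyS : y ∈ S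
          · rcases h3 with h3 | h3
            · exact hfix y hyS h3
            · exact absurd (hHS y hyS) (hI.1 h3).2
          · rw [hout y hyS] at h3
            refine absurd (hleave y (hOS h1 hyS) (h2.resolve_left fun hc => hyS hc.1) ?_) hyS
            exact h3.imp id fun h3 => (hI.1 h3).1
        · rintro rfl
          exact ⟨hO.2 (.inr hw), hSspecial y (mem_inter.1 hw).1, .inl hww⟩
      · rw [← ordinary u hu x hsp (hOS hx fun hc => hsp (hSspecial x hc))]
        congr 1
        ext y
        simp only [mem_filter]
        refine and_congr_right fun _ => and_congr_right fun e => ?_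
        rw [hout y fun hc => hsp ((hβeq (hSspecial y hc)).1 e.symm)]
  · intro x hx
    by_cases hsp : special x
    · rw [hβs hsp]; exact hO.2 (.inl (h.blob_mem u hu))
    · rw [hβn hsp]
      exact hO.2 (.inl (h.blob_mem x (hOS hx fun hc => hsp (hSspecial x hc))))

/-- If no edge leads on, adjacent outer points lie in the same blob. -/
lemma blob_eq (h : Valid E s β pa) (hu : u ∈ s.O) (hv : v ∈ s.O)
    (hvS : v ∈ comp (s.F u) (s.F v) u) (hI : ∀ x ∈ comp (s.F u) (s.F v) u, x ∉ s.I) :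
    β v = β u := by
  have hO := comp_subset_of_forall (f := s.F u) (g := s.F v) (u := u)
    (p := fun x => x ∈ s.O ∧ β x = β u) ⟨hu, rfl⟩ (fun z hz h' =>
      ⟨(h.blob u hu z h'.1).elim (fun hc => absurd hc (hI _ (left_mem_comp hz)))
        fun hc => ⟨hc.1, hc.2.trans h'.2⟩,
      (h.blob v hv z h'.1).elim (fun hc => absurd hc (hI _ (right_mem_comp hz)))
        fun hc => ⟨hc.1, hc.2.trans h'.2⟩⟩)
  exact (hO v hvS).2

/-- A forest which cannot be extended certifies that its matching is a largest one. -/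
theorem card_fixed_le (h : Valid E s β pa)
    (hstuck : ∀ u ∈ s.O, ∀ v, E u v → v ∈ s.I ∨ (v ∈ s.O ∧ β v = β u)) {N : V → V}
    (hN : IsMatch E N) : #(fixed s.M) ≤ #(fixed N) := by
  rcases s.O.eq_empty_or_nonempty with hO | ⟨w, hw⟩
  · have : fixed s.M = ∅ := eq_empty_of_forall_notMem fun x hx => by
      have := h.exposed x (mem_fixed.1 hx)
      simp [hO] at this
    simp [this]
  have hwi := (h.isMatch_F w hw).invol
  -- Counting leaving points of one stored matching: there is one in each blob, and each is exposed
  -- or the partner of an inner point. Hence the number of blobs is the number of exposed points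
  -- plus the number of inner points.
  have hcount : #(s.O.image β) = #{y ∈ s.O | s.F w y = y ∨ s.F w y ∈ s.I} := by
    rw [card_eq_sum_card_fiberwise (f := β) (t := s.O.image β) (s := {y ∈ s.O | _})
      fun y hy => mem_image_of_mem _ (mem_filter.1 hy).1, card_eq_sum_ones]
    refine sum_congr rfl fun b hb => ?_
    obtain ⟨x, hx, rfl⟩ := mem_image.1 hb
    rw [← h.leaving w hw x hx]
    congr 1
    ext y
    simp only [mem_filter]
    tauto
  have hsplit : #{y ∈ s.O | s.F w y = y ∨ s.F w y ∈ s.I} = #(fixed (s.F w)) + #s.I := by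
    have h1 : ({y ∈ s.O | s.F w y = y ∨ s.F w y ∈ s.I} : Finset V) =
        fixed (s.F w) ∪ s.I.image (s.F w) := by
      ext y
      simp only [mem_filter, mem_union, mem_fixed, mem_image]
      constructor
      · rintro ⟨h1, h2 | h2⟩
        · exact .inl h2
        · exact .inr ⟨_, h2, hwi y⟩
      · rintro (h1 | ⟨i, hi, rfl⟩)
        · refine ⟨?_, .inl h1⟩
          by_contra hc
          by_cases hyI : y ∈ s.I
          · exact hc (h1 ▸ h.F_inner_mem hw hyI)
          · exact hc (h.exposed y (by rw [← h.outside w hw y hc hyI, h1]))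
        · exact ⟨h.F_inner_mem hw hi, .inr (by rwa [hwi])⟩
    rw [h1, card_union_of_disjoint, card_image_of_injective]
    · exact fun a b e => by rw [← hwi a, e, hwi]
    · rw [disjoint_left]
      intro y hy hy'
      obtain ⟨i, hi, rfl⟩ := mem_image.1 hy'
      rw [mem_fixed, hwi] at hy
      exact h.disjoint _ (h.F_inner_mem hw hi) (hy ▸ hi)
  -- Every blob is odd, since `F w` pairs up all but one of its points. So no matching can pair it
  -- up internally, and all edges leaving it end in inner points.
  have hmiss : ∀ b ∈ s.O.image β, ∃ y ∈ s.O, β y = b ∧ (N y = y ∨ N y ∈ s.I) := by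
    intro b hb
    obtain ⟨x, hx, rfl⟩ := mem_image.1 hb
    by_contra hcon
    push Not at hcon
    have h1 : Even #{y ∈ s.O | β y = β x} := even_card_of_involution hN.invol (fun y hy => by
      obtain ⟨h1, h2⟩ := mem_filter.1 hy
      obtain ⟨h3, h4⟩ := hcon y h1 h2
      rcases hstuck y h1 _ (hN.adj y h3) with h5 | h5
      · exact absurd h5 h4
      · exact mem_filter.2 ⟨h5.1, h5.2.trans h2⟩)
      fun y hy => (hcon y (mem_filter.1 hy).1 (mem_filter.1 hy).2).1
    obtain ⟨l, hl, hlx, hl'⟩ := h.exists_leaving hw hx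
    have hnl : ∀ y ∈ s.O, β y = β x → y ≠ l → s.F w y ≠ y ∧ s.F w y ∈ s.O ∧
        β (s.F w y) = β x := by
      intro y hy hyx hne
      have : ¬ (s.F w y = y ∨ s.F w y ∈ s.I) := fun hc =>
        hne (h.eq_of_leaving hw hy hl (hyx.trans hlx.symm) hc hl')
      have h' := (h.blob w hw y hy).resolve_left fun hc => this (.inr hc)
      exact ⟨fun e => this (.inl e), h'.1, h'.2.trans hyx⟩
    have hlmem : l ∈ ({y ∈ s.O | β y = β x} : Finset V) := mem_filter.2 ⟨hl, hlx⟩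
    have h2 : Even #(({y ∈ s.O | β y = β x} : Finset V).erase l) :=
      even_card_of_involution hwi (fun y hy => by
        obtain ⟨h1, h2⟩ := mem_erase.1 hy
        obtain ⟨h3, h4⟩ := mem_filter.1 h2
        obtain ⟨h5, h6, h7⟩ := hnl y h3 h4 h1
        refine mem_erase.2 ⟨fun e => ?_, mem_filter.2 ⟨h6, h7⟩⟩
        rcases hl' with e' | e'
        · exact h1 (by rw [← hwi y, e, e'])
        · rw [← e, hwi] at e'
          exact h.disjoint y h3 e')
      fun y hy => by
        obtain ⟨h1, h2⟩ := mem_erase.1 hy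
        obtain ⟨h3, h4⟩ := mem_filter.1 h2
        exact (hnl y h3 h4 h1).1
    rw [card_erase_of_mem hlmem, Nat.even_sub (card_pos.2 ⟨_, hlmem⟩)] at h2
    simp [h1] at h2
  have hle : #(s.O.image β) ≤ #(fixed N ∪ s.I.image N) := by
    refine (card_le_card (t := (fixed N ∪ s.I.image N).image β) fun b hb => ?_).trans
      card_image_le
    obtain ⟨y, hy, rfl, hy' | hy'⟩ := hmiss b hb
    · exact mem_image_of_mem _ (mem_union_left _ (mem_fixed.2 hy'))
    · exact mem_image_of_mem _ (mem_union_right _ (mem_image.2 ⟨_, hy', hN.invol y⟩))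
  have := card_union_le (fixed N) (s.I.image N)
  have := card_image_le (s := s.I) (f := N)
  have := h.card_fixed w hw
  omega

/-- In a bipartite graph all blobs are singletons. -/
lemma eq_of_blob_eq (h : Valid E s β pa) {c : V → Bool} (hc : ∀ x y, E x y → c x ≠ c y)
    {x y : V} (hx : x ∈ s.O) (hy : y ∈ s.O) (hxy : β x = β y) : x = y := by
  have hpair : ∀ w ∈ s.O, ∀ z ∈ s.O, β z = β w → z ≠ w → s.F w z ∈ s.O ∧ β (s.F w z) = β w ∧
      s.F w z ≠ w ∧ c (s.F w z) ≠ c z := by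
    intro w hw z hz hzw hne
    have hnl : ¬ (s.F w z = z ∨ s.F w z ∈ s.I) := fun hl =>
      hne (h.eq_of_leaving hw hz hw hzw hl (.inl (h.missed w hw)))
    have h' := (h.blob w hw z hz).resolve_left fun hc => hnl (.inr hc)
    refine ⟨h'.1, h'.2.trans hzw, fun e => hne ?_, ?_⟩
    · rw [← (h.isMatch_F w hw).invol z, e, h.missed w hw]
    · exact (hc _ _ ((h.isMatch_F w hw).adj z fun e => hnl (.inl e))).symm
  let A : V → Bool → Finset V := fun w b => {z ∈ s.O | (β z = β w ∧ z ≠ w) ∧ c z = b}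
  have hcard : ∀ w ∈ s.O, #(A w true) = #(A w false) := by
    intro w hw
    have hwi := (h.isMatch_F w hw).invol
    have hmap : ∀ b, ∀ z ∈ A w b, s.F w z ∈ A w (!b) := fun b z hz => by
      obtain ⟨h1, h2, h3⟩ := mem_filter.1 hz
      obtain ⟨h4, h5, h6, h7⟩ := hpair w hw z h1 h2.1 h2.2
      refine mem_filter.2 ⟨h4, ⟨h5, h6⟩, ?_⟩
      rw [h3] at h7
      cases b <;> simpa using h7
    exact card_bij' (fun z _ => s.F w z) (fun z _ => s.F w z) (hmap true) (hmap false)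
      (fun z _ => hwi z) fun z _ => hwi z
  let K : Bool → Finset V := fun b => {z ∈ s.O | β z = β x ∧ c z = b}
  have hK : ∀ w ∈ s.O, β w = β x → ∀ b, A w b = (K b).erase w := fun w hw hwx b => by
    ext z
    simp only [A, K, mem_filter, mem_erase, hwx]
    tauto
  -- `F w` pairs the rest of the blob of `w` across the two colours, so the colour of `w` has a
  -- majority of one. This holds for every point of the blob, so they all share one colour, and no
  -- two of them can be matched.
  have hval : ∀ w ∈ s.O, β w = β x → #(K (c w)) = #(K (!c w)) + 1 := by
    intro w hw hwx
    have h1 : #((K (c w)).erase w) + 1 = #(K (c w)) :=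
      card_erase_add_one (mem_filter.2 ⟨hw, hwx, rfl⟩)
    have h2 : (K (!c w)).erase w = K (!c w) := erase_eq_of_notMem fun hm => by
      simpa using (mem_filter.1 hm).2.2
    rw [← h1, ← hK w hw hwx, ← h2, ← hK w hw hwx]
    have := hcard w hw
    cases c w <;> simp [this]
  have hcol : ∀ w ∈ s.O, β w = β x → c w = c x := by
    intro w hw hwx
    by_contra hne
    have hne' : c w = !c x := by cases hcw : c w <;> cases hcx : c x <;> simp_all
    have h1 := hval w hw hwx
    have h2 := hval x hx rfl
    rw [hne', Bool.not_not] at h1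
    omega
  by_contra hne
  obtain ⟨h1, h2, -, h4⟩ := hpair x hx y hy hxy.symm (Ne.symm hne)
  exact h4 ((hcol _ h1 h2).trans (hcol y hy hxy.symm).symm)

end Valid

end Matching


/-! ### The search step, its invariant and its progress. -/

namespace Matching

open Finset

variable {V : Type*} [DecidableEq V] [Fintype V]

/-- The points from which `u` is reached in at most `k` steps along `f` and `g`. -/
def reach (f g : V → V) (u : V) : ℕ → Finset V
  | 0 => {u}
  | k + 1 => {x | x ∈ reach f g u k ∨ f x ∈ reach f g u k ∨ g x ∈ reach f g u k}

lemma mem_reach_succ {f g : V → V} {u : V} {k : ℕ} {x : V} :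
    x ∈ reach f g u (k + 1) ↔
      x ∈ reach f g u k ∨ f x ∈ reach f g u k ∨ g x ∈ reach f g u k := by
  simp [reach]

/-- The sets `reach f g u k` grow by a point in each step until they become stationary, so they are
stationary after as many steps as there are points. -/
lemma reach_card {f g : V → V} (hf : ∀ x, f (f x) = x) (hg : ∀ x, g (g x) = x) (u : V) :
    reach f g u (Fintype.card V) = comp f g u := by
  have hmono : ∀ k, reach f g u k ⊆ reach f g u (k + 1) := fun k x hx => mem_reach_succ.2 (.inl hx)
  have hsub : ∀ k, reach f g u k ⊆ comp f g u := by
    intro k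
    induction k with
    | zero => simpa [reach] using self_mem_comp
    | succ k ih =>
      intro x hx
      rcases mem_reach_succ.1 hx with h | h | h
      · exact ih h
      · exact (left_mem_comp_iff hf x).1 (ih h)
      · exact (right_mem_comp_iff hg x).1 (ih h)
  have hgrow : ∀ k, k + 1 ≤ #(reach f g u k) ∨ reach f g u (k + 1) = reach f g u k := by
    intro k
    induction k with
    | zero => simp [reach]
    | succ k ih =>
      rcases ih with ih | ih
      · by_cases e : reach f g u (k + 1) = reach f g u k
        · right
          ext x
          rw [mem_reach_succ, e, ← mem_reach_succ, e]
        · left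
          have := card_lt_card ((hmono k).ssubset_of_ne (Ne.symm e))
          omega
      · right
        ext x
        rw [mem_reach_succ, ih, ← mem_reach_succ, ih]
  have hfix := (hgrow (Fintype.card V)).resolve_left fun h => by
    have := card_le_univ (reach f g u (Fintype.card V))
    omega
  have hu : ∀ k, u ∈ reach f g u k := fun k => by
    induction k with
    | zero => simp [reach]
    | succ k ih => exact hmono k ih
  refine (hsub _).antisymm (comp_subset (hu _) fun z hz => ?_)
  rw [← hfix]
  exact ⟨mem_reach_succ.2 (.inr (.inl (by rwa [hf]))), mem_reach_succ.2 (.inr (.inr (by rwa [hg])))⟩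

/-- The point `y` is never reached, so the maps themselves can replace the cut ones as long as `y`
is left out. This is the form in which the program computes. -/
lemma mem_reach_cut_succ {f g : V → V} {u y : V} (hyu : y ≠ u) {k : ℕ} {x : V} :
    x ∈ reach (cut f y) (cut g y) u (k + 1) ↔ x ≠ y ∧ (x ∈ reach (cut f y) (cut g y) u k ∨
      f x ∈ reach (cut f y) (cut g y) u k ∨ g x ∈ reach (cut f y) (cut g y) u k) := by
  have hcut : ∀ h : V → V, cut h y y = y := fun h => by simp [cut]
  have hy : ∀ k, y ∉ reach (cut f y) (cut g y) u k := fun k => by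
    induction k with
    | zero => simpa [reach] using hyu
    | succ k ih => simp [mem_reach_succ, hcut, ih]
  rw [mem_reach_succ]
  by_cases hxy : x = y
  · simp [hxy, hcut, hy]
  have h : ∀ h : V → V, (x ∈ reach (cut f y) (cut g y) u k ∨
      cut h y x ∈ reach (cut f y) (cut g y) u k) ↔ (x ∈ reach (cut f y) (cut g y) u k ∨
        h x ∈ reach (cut f y) (cut g y) u k) := fun h => by
    by_cases e : h x = y
    · simp [cut, e, hy]
    · simp [cut, hxy, e]
  have h1 := h f
  have h2 := h g
  tauto

variable (E : V → V → Prop)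

open Classical in
/-- The step of the search along the pair `u`, `v`. -/
noncomputable def act (s : State V) (u v : V) : State V :=
  if u ∈ s.O ∧ E u v then
    if v ∈ s.O then
      if v ∈ comp (s.F u) (s.F v) u then
        if ∃ x ∈ comp (s.F u) (s.F v) u, x ∈ s.I then
          merge s (comp (s.F u) (s.F v) u) (around (s.F u) (s.F v) u v)
        else s
      else start (augment (s.F u) (s.F v) u v)
    else if v ∈ s.I then s else grow s u v (s.M v)
  else s

/-- The search cannot continue along the pair `u`, `v`. -/
def Stuck (s : State V) (u v : V) : Prop :=
  u ∈ s.O → E u v → v ∈ s.I ∨ (v ∈ s.O ∧ v ∈ comp (s.F u) (s.F v) u ∧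
    ∀ x ∈ comp (s.F u) (s.F v) u, x ∉ s.I)

-- The search runs for a fixed number of rounds, so a finished state has to survive the remaining
-- ones.
variable {E} in
open Classical in
lemma Stuck.act_eq {s : State V} {u v : V} (h : Stuck E s u v) (hs : ∀ x ∈ s.O, x ∉ s.I) :
    act E s u v = s := by
  unfold act
  split_ifs with h1 h2 h3 h4 h5
  · rcases h h1.1 h1.2 with h' | ⟨-, -, h'⟩
    · exact absurd h' (hs v h2)
    · obtain ⟨x, hx, hx'⟩ := h4
      exact absurd hx' (h' x hx)
  · rfl
  · rcases h h1.1 h1.2 with h' | ⟨-, h', -⟩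
    · exact absurd h' (hs v h2)
    · exact absurd h' h3
  · rfl
  · rcases h h1.1 h1.2 with h' | ⟨h', -⟩
    · exact absurd h' h5
    · exact absurd h' h2
  · rfl

/-- The progress of the search. -/
def progress (s : State V) : ℕ :=
  (Fintype.card V - #(fixed s.M)) * (2 * Fintype.card V + 1) + (2 * #s.O + #s.I)

/-- The invariant of the search. -/
def Good (s : State V) : Prop := ∃ β pa, Valid E s β pa

variable {E}

/-- This bounds the forest term of `progress` below the weight `2 * Fintype.card V + 1` of a newly
covered point, so an augmentation is progress although it discards the forest. Outer points weigh 2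
and inner ones 1, so turning inner points into outer ones is progress too. -/
lemma Good.card_le {s : State V} (h : Good E s) : 2 * #s.O + #s.I ≤ 2 * Fintype.card V := by
  obtain ⟨β, pa, h⟩ := h
  have h1 := card_le_univ (s.O ∪ s.I)
  rw [card_union_of_disjoint (disjoint_left.2 h.disjoint)] at h1
  omega

lemma Good.progress_le {s : State V} (h : Good E s) :
    progress s ≤ 4 * (Fintype.card V * Fintype.card V) + Fintype.card V := by
  have h1 := h.card_le
  have h2 : (Fintype.card V - #(fixed s.M)) * (2 * Fintype.card V + 1) ≤
    Fintype.card V * (2 * Fintype.card V + 1) := Nat.mul_le_mul_right _ (Nat.sub_le _ _)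
  unfold progress
  rcases Nat.eq_zero_or_pos (Fintype.card V) with h0 | h0
  · simp [h0] at *
    omega
  · nlinarith

lemma good_start {M : V → V} (hM : IsMatch E M) : Good E (start M) := ⟨_, _, valid_start hM⟩

lemma Good.act {s : State V} (h : Good E s) (hE : ∀ a b, E a b → E b a) (hirr : ∀ a, ¬ E a a)
    (u v : V) : Good E (act E s u v) ∧
      ((act E s u v = s ∧ Stuck E s u v) ∨ progress s < progress (act E s u v)) := by
  have hle := h.card_le
  obtain ⟨β, pa, hv⟩ := h
  unfold Matching.act
  split_ifs with h1 h2 h3 h4 h5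
  · obtain ⟨hu, huv⟩ := h1
    have hne : u ≠ v := fun e => hirr u (e ▸ huv)
    obtain ⟨β', h'⟩ := hv.merge hu h2 h3 rfl (H := around (s.F u) (s.F v) u v) fun y hy => by
      obtain ⟨hyS, hyI⟩ := mem_inter.1 hy
      exact around_spec hE (hv.isPath hu h2 h3) huv hne hyS
        (fun e => hv.disjoint u hu (e ▸ hyI)) fun e => hv.disjoint v h2 (e ▸ hyI)
    refine ⟨⟨_, _, h'⟩, .inr ?_⟩
    obtain ⟨x, hxS, hxI⟩ := h4
    have hpos : 0 < #(comp (s.F u) (s.F v) u ∩ s.I) := card_pos.2 ⟨x, mem_inter.2 ⟨hxS, hxI⟩⟩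
    have hdis : Disjoint s.O (comp (s.F u) (s.F v) u ∩ s.I) :=
      disjoint_left.2 fun y hy hy' => hv.disjoint y hy (mem_inter.1 hy').2
    have := card_sdiff_add_card_inter s.I (comp (s.F u) (s.F v) u)
    rw [inter_comm] at this
    simp only [progress, merge, card_union_of_disjoint hdis]
    omega
  · push Not at h4
    exact ⟨⟨_, _, hv⟩, .inl ⟨rfl, fun _ _ => .inr ⟨h2, h3, h4⟩⟩⟩
  · obtain ⟨hu, huv⟩ := h1
    obtain ⟨h5, h6⟩ := augment_spec hE (hv.isMatch_F u hu) (hv.isMatch_F v h2) (hv.missed u hu)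
      (hv.missed v h2) huv h3 (by rw [hv.card_fixed u hu, hv.card_fixed v h2])
    refine ⟨good_start h5, .inr ?_⟩
    rw [hv.card_fixed u hu] at h6
    have hle' := card_le_univ (fixed s.M)
    simp only [progress, start]
    set a := #(fixed s.M)
    set b := #(fixed (augment (s.F u) (s.F v) u v))
    have h7 : Fintype.card V - a + 1 ≤ Fintype.card V - b := by omega
    have := Nat.mul_le_mul_right (2 * Fintype.card V + 1) h7
    rw [Nat.add_mul] at this
    omega
  · exact ⟨⟨_, _, hv⟩, .inl ⟨rfl, fun _ _ => .inl h5⟩⟩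
  · refine ⟨⟨_, _, hv.grow hE h1.1 h1.2 h2 h5 rfl⟩, .inr ?_⟩
    have := card_insert_of_notMem h5
    have := card_le_card (subset_insert (s.M v) s.O)
    simp only [progress, grow]
    omega
  · exact ⟨⟨_, _, hv⟩, .inl ⟨rfl, fun h h' => absurd ⟨h, h'⟩ h1⟩⟩

lemma Valid.stuck {s : State V} {β pa : V → V} (h : Valid E s β pa)
    (hs : ∀ u v, Stuck E s u v) : ∀ u ∈ s.O, ∀ v, E u v → v ∈ s.I ∨ (v ∈ s.O ∧ β v = β u) :=
  fun u hu v huv => (hs u v hu huv).imp id fun h' => ⟨h'.1, h.blob_eq hu h'.1 h'.2.1 h'.2.2⟩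

/-- The result of the search: a largest matching. -/
lemma Good.card_fixed_le {s : State V} (h : Good E s) (hs : ∀ u v, Stuck E s u v) {N : V → V}
    (hN : IsMatch E N) : #(fixed s.M) ≤ #(fixed N) := by
  obtain ⟨β, pa, h⟩ := h
  exact h.card_fixed_le (h.stuck hs) hN

lemma Good.isMatch {s : State V} (h : Good E s) : IsMatch E s.M := by
  obtain ⟨β, pa, h⟩ := h
  exact h.isMatch

/-- In a bipartite graph, the edges of the final forest and the inner points form a cover which
takes one point of each edge of `M`. -/
lemma Good.bipartite {s : State V} (h : Good E s) (hs : ∀ u v, Stuck E s u v) {c : V → Bool}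
    (hc : ∀ x y, E x y → c x ≠ c y) :
    (∀ u ∈ s.O, ∀ v, E u v → v ∈ s.I) ∧ (∀ x, s.M x = x → x ∈ s.O) ∧ (∀ x ∈ s.O, x ∉ s.I) ∧
      (∀ x ∈ s.I, s.M x ∈ s.O) ∧ ∀ x, x ∉ s.O → x ∉ s.I → s.M x ∉ s.O ∧ s.M x ∉ s.I := by
  obtain ⟨β, pa, h⟩ := h
  refine ⟨fun u hu v huv => ?_, h.exposed, h.disjoint, fun x hx => (h.inner_mem x hx).2,
    fun x hx hx' => ?_⟩
  · rcases h.stuck hs u hu v huv with h' | ⟨h1, h2⟩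
    · exact h'
    · have := h.eq_of_blob_eq hc h1 hu h2
      exact absurd rfl (this ▸ hc u v huv)
  · have := h.touched (s.M x)
    rw [h.isMatch.invol] at this
    tauto

end Matching


/-! ### Programs for the matching search -/

namespace Tab

open Finset Matching

/-- The term `t` is true, that is, nonzero. -/
def Tm.Tr (N : ℕ) (T : Tabs) (ρ : List ℕ) (t : Tm) : Prop := t.eval N T ρ ≠ 0

instance (N : ℕ) (T : Tabs) (ρ : List ℕ) (t : Tm) : Decidable (t.Tr N T ρ) :=
  inferInstanceAs (Decidable (_ ≠ _))

/-! ### Derived terms and their values. -/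

namespace Tm

/-- Negation. -/
def not (s : Tm) : Tm := .ite s (.const 0) (.const 1)
/-- Conjunction. -/
def and (s t : Tm) : Tm := .ite s (.ite t (.const 1) (.const 0)) (.const 0)
/-- Disjunction. -/
def or (s t : Tm) : Tm := .ite s (.const 1) (.ite t (.const 1) (.const 0))
/-- Equality. -/
def eq (s t : Tm) : Tm := .sub (.const 1) (.add (.sub s t) (.sub t s))
/-- Comparison. -/
def lt (s t : Tm) : Tm := .sub t s
/-- Existence of an index below `N`. -/
def ex (t : Tm) : Tm := .sum (.ite t (.const 1) (.const 0))
/-- A scalar, which is stored in all entries of a table. -/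
def scalar (a : ℕ) : Tm := .read a (.const 0) (.const 0)
/-- An entry of a vector, which is stored in all columns of a table. -/
def entry (a : ℕ) (i : Tm) : Tm := .read a i (.const 0)

variable {N : ℕ} {T : Tabs} {ρ : List ℕ} {s t u : Tm}

lemma eval_const {k : ℕ} : (const k).eval N T ρ = k := rfl
lemma eval_var {k : ℕ} : (var k).eval N T ρ = ρ.getD k 0 := rfl
lemma eval_size : size.eval N T ρ = N := rfl
lemma eval_read {a : ℕ} : (read a s t).eval N T ρ = T a (s.eval N T ρ) (t.eval N T ρ) := rfl
lemma eval_scalar {a : ℕ} : (scalar a).eval N T ρ = T a 0 0 := rfl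
lemma eval_entry {a : ℕ} : (entry a s).eval N T ρ = T a (s.eval N T ρ) 0 := rfl
lemma eval_add : (add s t).eval N T ρ = s.eval N T ρ + t.eval N T ρ := rfl
lemma eval_sub : (sub s t).eval N T ρ = s.eval N T ρ - t.eval N T ρ := rfl
lemma eval_ite : (ite u s t).eval N T ρ = if u.Tr N T ρ then s.eval N T ρ else t.eval N T ρ := rfl
lemma eval_sum : (sum t).eval N T ρ = ∑ i ∈ range N, t.eval N T (ρ ++ [i]) := rfl
lemma tr_read {a : ℕ} : (read a s t).Tr N T ρ ↔ T a (s.eval N T ρ) (t.eval N T ρ) ≠ 0 := Iff.rfl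
lemma tr_entry {a : ℕ} : (entry a s).Tr N T ρ ↔ T a (s.eval N T ρ) 0 ≠ 0 := Iff.rfl

lemma eval_eq : (eq s t).eval N T ρ = if s.eval N T ρ = t.eval N T ρ then 1 else 0 := by
  simp only [eq, eval]
  split_ifs <;> omega

lemma tr_eq : (eq s t).Tr N T ρ ↔ s.eval N T ρ = t.eval N T ρ := by
  rw [Tr, eval_eq]; simp

lemma tr_lt : (lt s t).Tr N T ρ ↔ s.eval N T ρ < t.eval N T ρ := by
  simp only [Tr, lt, eval]; omega

lemma tr_not : (not s).Tr N T ρ ↔ ¬ s.Tr N T ρ := by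
  rw [Tr, not, eval_ite]; split_ifs <;> simp [eval, *]

lemma tr_and : (and s t).Tr N T ρ ↔ s.Tr N T ρ ∧ t.Tr N T ρ := by
  rw [Tr, and, eval_ite, eval_ite]; split_ifs <;> simp [eval, *]

lemma tr_or : (or s t).Tr N T ρ ↔ s.Tr N T ρ ∨ t.Tr N T ρ := by
  rw [Tr, or, eval_ite, eval_ite]; split_ifs <;> simp [eval, *]

lemma tr_ex : (ex t).Tr N T ρ ↔ ∃ i < N, t.Tr N T (ρ ++ [i]) := by
  simp only [Tr, ex, eval_sum, ne_eq, Finset.sum_eq_zero_iff, eval_ite, mem_range, not_forall,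
    eval_const, exists_prop]
  refine exists_congr fun i => and_congr_right fun _ => ?_
  split_ifs <;> simp_all

lemma eval_and : (and s t).eval N T ρ = if s.Tr N T ρ ∧ t.Tr N T ρ then 1 else 0 := by
  rw [and, eval_ite, eval_ite]; split_ifs <;> simp_all [eval]

lemma eval_or : (or s t).eval N T ρ = if s.Tr N T ρ ∨ t.Tr N T ρ then 1 else 0 := by
  rw [or, eval_ite, eval_ite]; split_ifs <;> simp_all [eval]

end Tm

/-! ### Rules for running programs. -/

namespace Prog

/-- The tables which a program changes. -/
def writes : Prog → List ℕ
  | .skip => []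
  | .assign a _ => [a]
  | .seq p q => p.writes ++ q.writes
  | .cond _ p q => p.writes ++ q.writes
  | .iter p => p.writes

variable {N : ℕ}

lemma run_of_notMem {a : ℕ} (p : Prog) : ∀ (T : Tabs), a ∉ p.writes → p.run N T a = T a := by
  induction p with
  | skip => exact fun _ _ => rfl
  | assign b t =>
    intro T h
    simp only [writes, List.mem_singleton] at h
    funext i j
    simp [run, h]
  | seq p q hp hq =>
    intro T h
    simp only [writes, List.mem_append, not_or] at h
    rw [run, hq _ h.2, hp _ h.1]
  | cond t p q hp hq =>
    intro T h
    simp only [writes, List.mem_append, not_or] at h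
    rw [run]
    split_ifs
    · exact hp _ h.1
    · exact hq _ h.2
  | iter p hp =>
    intro T h
    rw [run]
    suffices H : ∀ k, (p.run N)^[k] T a = T a from H N
    intro k
    induction k with
    | zero => rfl
    | succ k ih => rw [Function.iterate_succ_apply', hp _ h, ih]

lemma run_seq {p q : Prog} {T : Tabs} : (p.seq q).run N T = q.run N (p.run N T) := rfl

lemma run_cond {t : Tm} {p q : Prog} {T : Tabs} :
    (cond t p q).run N T = if t.Tr N T [0, 0] then p.run N T else q.run N T := rfl

lemma run_assign_self {a i j : ℕ} {t : Tm} {T : Tabs} (hi : i < N) (hj : j < N) :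
    (assign a t).run N T a i j = t.eval N T [i, j] := by simp [run, hi, hj]

lemma run_assign_ne {a b : ℕ} {t : Tm} {T : Tabs} (h : b ≠ a) :
    (assign a t).run N T b = T b := run_of_notMem _ _ (by simpa [writes] using h)

lemma run_iter {p : Prog} {T : Tabs} (P : ℕ → Tabs → Prop) (h0 : P 0 T)
    (hs : ∀ k < N, ∀ T, P k T → P (k + 1) (p.run N T)) : P N ((iter p).run N T) := by
  suffices H : ∀ k ≤ N, P k ((p.run N)^[k] T) from H N le_rfl
  intro k
  induction k with
  | zero => exact fun _ => h0
  | succ k ih =>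
    intro hk
    rw [Function.iterate_succ_apply']
    exact hs k hk _ (ih (by omega))

/-- Running `p` with the scalar `c` set to `0, …, N - 1`. -/
def forLoop (c : ℕ) (p : Prog) : Prog :=
  .seq (.assign c (.const 0)) (.iter (.seq p (.assign c (.add (.scalar c) (.const 1)))))

/-- The invariant must ignore the counter table, which changes between the runs of `p`. The size has
to be positive because a scalar is read from the entry `(0, 0)`, which is written only then. -/
lemma run_forLoop {c : ℕ} {p : Prog} {T : Tabs} (hN : 0 < N) (P : ℕ → Tabs → Prop) (h0 : P 0 T)
    (hc : c ∉ p.writes) (hP : ∀ k T T', (∀ a, a ≠ c → T' a = T a) → P k T → P k T')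
    (hs : ∀ k < N, ∀ T, T c 0 0 = k → P k T → P (k + 1) (p.run N T)) :
    P N ((forLoop c p).run N T) := by
  rw [forLoop, run_seq]
  refine (run_iter (P := fun k T => T c 0 0 = k ∧ P k T) ⟨?_, ?_⟩ ?_).2
  · rw [run_assign_self hN hN]; rfl
  · exact hP 0 T _ (fun a ha => run_assign_ne ha) h0
  · rintro k hk T ⟨h1, h2⟩
    rw [run_seq]
    refine ⟨?_, hP _ _ _ (fun a ha => run_assign_ne ha) (hs k hk T h1 h2)⟩
    rw [run_assign_self hN hN, Tm.eval_add, Tm.eval_scalar, run_of_notMem p T hc, h1,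
      Tm.eval_const]

end Prog

/-! The tables of the matching search: `3` holds `M`, `4` holds the status of the points (`2` for
outer and `1` for inner ones), `5` holds `F`, `6` and `7` hold the current pair, `8` holds the
component and `9` holds its parts. -/

open Tm Prog

/-- Restart the forest from the matching in table `3`. -/
def startP : Prog :=
  .seq (.assign 4 (.ite (.eq (.entry 3 (.var 0)) (.var 0)) (.const 2) (.const 0)))
    (.assign 5 (.entry 3 (.var 1)))

/-- Extend the forest by a point and its partner. -/
def growP : Prog :=
  .seq (.assign 5 (.ite (.eq (.var 0) (.entry 3 (.scalar 7)))
      (.ite (.eq (.var 1) (.scalar 6)) (.scalar 7) (.ite (.eq (.var 1) (.scalar 7)) (.scalar 6)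
        (.ite (.eq (.var 1) (.read 5 (.scalar 6) (.scalar 7))) (.var 1)
          (.read 5 (.scalar 6) (.var 1)))))
      (.read 5 (.var 0) (.var 1))))
    (.assign 4 (.ite (.eq (.var 0) (.entry 3 (.scalar 7))) (.const 2)
      (.ite (.eq (.var 0) (.scalar 7)) (.const 1) (.entry 4 (.var 0)))))

/-- Compute the component of the first point of the current pair. -/
def compP : Prog :=
  .seq (.assign 8 (.eq (.var 0) (.scalar 6)))
    (.iter (.assign 8 (.or (.entry 8 (.var 0)) (.or (.entry 8 (.read 5 (.scalar 6) (.var 0)))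
      (.entry 8 (.read 5 (.scalar 7) (.var 0)))))))

/-- Compute the parts of the component before each of its points. -/
def beforeP : Prog :=
  .seq (.assign 9 (.eq (.var 1) (.scalar 6)))
    (.iter (.assign 9 (.and (.not (.eq (.var 1) (.var 0)))
      (.or (.read 9 (.var 0) (.var 1))
        (.or (.read 9 (.var 0) (.read 5 (.scalar 6) (.var 1)))
          (.read 9 (.var 0) (.read 5 (.scalar 7) (.var 1))))))))

/-- The condition that a point is an inner point of the component. -/
def innerT (i : Tm) : Tm := .and (.entry 8 i) (.eq (.entry 4 i) (.const 1))

/-- Turn the inner points of the component into outer ones. -/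
def mergeP : Prog :=
  .seq beforeP (.seq
    (.assign 5 (.ite (innerT (.var 0))
      (.ite (.eq (.var 1) (.var 0)) (.var 0)
        (.ite (.read 9 (.var 0) (.var 1))
          (.ite (.read 9 (.var 0) (.read 5 (.scalar 7) (.var 0)))
            (.ite (.eq (.var 1) (.scalar 6)) (.scalar 7) (.read 5 (.scalar 6) (.var 1)))
            (.read 5 (.scalar 7) (.var 1)))
          (.ite (.entry 8 (.var 1))
            (.ite (.read 9 (.var 0) (.read 5 (.scalar 7) (.var 0)))
              (.ite (.eq (.var 1) (.scalar 7)) (.scalar 6) (.read 5 (.scalar 7) (.var 1)))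
              (.read 5 (.scalar 6) (.var 1)))
            (.read 5 (.scalar 6) (.var 1)))))
      (.read 5 (.var 0) (.var 1))))
    (.assign 4 (.ite (innerT (.var 0)) (.const 2) (.entry 4 (.var 0)))))

/-- Enlarge the matching. -/
def augmentP : Prog :=
  .seq (.assign 3 (.ite (.ex (.and (.entry 8 (.var 2)) (.and (.not (.eq (.var 2) (.scalar 6)))
        (.eq (.read 5 (.scalar 6) (.var 2)) (.var 2)))))
      (.ite (.entry 8 (.var 0)) (.read 5 (.scalar 7) (.var 0)) (.read 5 (.scalar 6) (.var 0)))
      (.ite (.eq (.var 0) (.scalar 6)) (.scalar 7) (.ite (.eq (.var 0) (.scalar 7)) (.scalar 6)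
        (.ite (.entry 8 (.var 0)) (.read 5 (.scalar 6) (.var 0)) (.read 5 (.scalar 7) (.var 0)))))))
    startP

/-- The step of the search along the current pair, for the adjacency matrix in table `e`. -/
def actP (e : ℕ) : Prog :=
  .cond (.and (.eq (.entry 4 (.scalar 6)) (.const 2)) (.read e (.scalar 6) (.scalar 7)))
    (.cond (.eq (.entry 4 (.scalar 7)) (.const 2))
      (.seq compP (.cond (.entry 8 (.scalar 7))
        (.cond (.ex (innerT (.var 2))) mergeP .skip) augmentP))
      (.cond (.eq (.entry 4 (.scalar 7)) (.const 1)) .skip growP))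
    .skip

/-- One step for every pair. -/
def sweepP (e : ℕ) : Prog := .forLoop 6 (.forLoop 7 (actP e))

/-- The program `p` twice. -/
def twice (p : Prog) : Prog := .seq p p

/-- The search for a largest matching. -/
def matchP (e : ℕ) : Prog :=
  .seq (.assign 3 (.var 0)) (.seq startP (.iter (.iter (twice (twice (twice (sweepP e)))))))

section

variable {N : ℕ} {E : Fin N → Fin N → Prop} {e : ℕ} {T : Tabs} {s : State (Fin N)}

/-- The tables hold the state `s` of the search in the graph `E`. -/
structure Rep (E : Fin N → Fin N → Prop) (e : ℕ) (T : Tabs) (s : State (Fin N)) : Prop where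
  adj : ∀ x y : Fin N, T e x y ≠ 0 ↔ E x y
  M : ∀ (x : Fin N) (j : ℕ), j < N → T 3 x j = s.M x
  st : ∀ (x : Fin N) (j : ℕ), j < N → T 4 x j = if x ∈ s.O then 2 else if x ∈ s.I then 1 else 0
  F : ∀ w x : Fin N, T 5 w x = s.F w x

/-- Tables from 6 on hold only the current pair and auxiliary data. -/
lemma Rep.congr (h : Rep E e T s) {T' : Tabs} (he : e < 3)
    (hT : ∀ a, a < 6 → T' a = T a) : Rep E e T' s where
  adj x y := by rw [hT e (by omega)]; exact h.adj x y
  M x j hj := by rw [hT 3 (by omega)]; exact h.M x j hj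
  st x j hj := by rw [hT 4 (by omega)]; exact h.st x j hj
  F w x := by rw [hT 5 (by omega)]; exact h.F w x

lemma rep_start {M : Fin N → Fin N} (he : e < 3) (hadj : ∀ x y : Fin N, T e x y ≠ 0 ↔ E x y)
    (hM : ∀ (x : Fin N) (j : ℕ), j < N → T 3 x j = M x) :
    Rep E e (startP.run N T) (start M) where
  adj x y := by
    rw [run_of_notMem _ _ (by simp [startP, writes]; omega)]; exact hadj x y
  M x j hj := by
    rw [run_of_notMem _ _ (by simp [startP, writes])]; exact hM x j hj
  st x j hj := by
    have hN : 0 < N := x.pos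
    rw [startP, run_seq, run_assign_ne (by decide), run_assign_self x.2 hj, eval_ite]
    simp [tr_eq, eval_entry, eval_var, eval_const, hM x 0 hN, start, Fin.val_inj]
  F w x := by
    have hN : 0 < N := x.pos
    rw [startP, run_seq, run_assign_self w.2 x.2]
    simp [eval_entry, eval_var, run_assign_ne, hM x 0 hN, start]

variable {u v : Fin N}

lemma rep_grow (h : Rep E e T s) (he : e < 3) (hu : T 6 0 0 = u) (hv : T 7 0 0 = v)
    (hvO : v ∉ s.O) :
    Rep E e (growP.run N T) (grow s u v (s.M v)) where
  adj x y := by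
    rw [run_of_notMem _ _ (by simp [growP, writes]; omega)]; exact h.adj x y
  M x j hj := by
    rw [run_of_notMem _ _ (by simp [growP, writes])]; exact h.M x j hj
  st x j hj := by
    have hN : 0 < N := x.pos
    rw [growP, run_seq, run_assign_self x.2 hj]
    simp [eval_ite, tr_eq, eval_entry, eval_scalar, eval_var, eval_const, run_assign_ne, hv,
      h.M v 0 hN, h.st x 0 hN, Fin.val_inj, grow]
    split_ifs <;> simp_all
  F w x := by
    have hN : 0 < N := x.pos
    rw [growP, run_seq, run_assign_ne (by decide), run_assign_self w.2 x.2]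
    simp only [eval_ite, tr_eq, eval_entry, eval_read, eval_scalar, eval_var, List.getD_cons_zero,
      List.getD_cons_succ, hu, hv, h.M v 0 hN, h.F, Fin.val_inj, grow, ite_apply, swap]
    split_ifs <;> rfl

/-- The `k`-th round turns stage `k` of `reach` into stage `k + 1`, and `N` rounds suffice by
`reach_card`. -/
lemma run_compP (h : Rep E e T s) (hu : T 6 0 0 = u) (hv : T 7 0 0 = v)
    (hf : ∀ x, s.F u (s.F u x) = x) (hg : ∀ x, s.F v (s.F v x) = x) (x : Fin N) {j : ℕ}
    (hj : j < N) : compP.run N T 8 x j ≠ 0 ↔ x ∈ comp (s.F u) (s.F v) u := by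
  have hN : 0 < N := x.pos
  rw [← reach_card hf hg, Fintype.card_fin, compP, run_seq]
  refine (run_iter (P := fun k T' => (∀ a, a ≠ 8 → T' a = T a) ∧ ∀ (x : Fin N) (j : ℕ), j < N →
    (T' 8 x j ≠ 0 ↔ x ∈ reach (s.F u) (s.F v) u k)) ⟨?_, ?_⟩ ?_).2 x j hj
  · exact fun a ha => run_assign_ne ha
  · intro x j hj
    rw [run_assign_self x.2 hj, eval_eq]
    simp [eval_var, eval_scalar, hu, reach, Fin.val_inj]
  · rintro k - T' ⟨h1, h2⟩
    refine ⟨fun a ha => by rw [run_assign_ne ha, h1 a ha], fun x j hj => ?_⟩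
    rw [run_assign_self x.2 hj, eval_or, mem_reach_succ]
    simp only [tr_or, tr_entry, eval_read, eval_scalar, eval_var, List.getD_cons_zero,
      h1 5 (by decide), h1 6 (by decide), h1 7 (by decide), hu, hv, h.F, ne_eq,
      ite_eq_right_iff, one_ne_zero, imp_false, not_not]
    have h3 := h2 x 0 hN
    have h4 := h2 (s.F u x) 0 hN
    have h5 := h2 (s.F v x) 0 hN
    tauto

/-- The rows of table 9 are independent searches, run in parallel: row `y` explores from `u` while
avoiding `y`. -/
lemma run_beforeP (h : Rep E e T s) (hu : T 6 0 0 = u) (hv : T 7 0 0 = v)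
    (hf : ∀ x, s.F u (s.F u x) = x) (hg : ∀ x, s.F v (s.F v x) = x) {y : Fin N} (hy : y ≠ u)
    (x : Fin N) : beforeP.run N T 9 y x ≠ 0 ↔ x ∈ before (s.F u) (s.F v) u y := by
  rw [before, ← reach_card (cut_cut hf y) (cut_cut hg y), Fintype.card_fin, beforeP, run_seq]
  refine (run_iter (P := fun k T' => (∀ a, a ≠ 9 → T' a = T a) ∧ ∀ x : Fin N,
    (T' 9 y x ≠ 0 ↔ x ∈ reach (cut (s.F u) y) (cut (s.F v) y) u k)) ⟨?_, ?_⟩ ?_).2 x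
  · exact fun a ha => run_assign_ne ha
  · intro x
    rw [run_assign_self y.2 x.2, eval_eq]
    simp [eval_var, eval_scalar, hu, reach, Fin.val_inj]
  · rintro k - T' ⟨h1, h2⟩
    refine ⟨fun a ha => by rw [run_assign_ne ha, h1 a ha], fun x => ?_⟩
    rw [run_assign_self y.2 x.2, eval_and, mem_reach_cut_succ hy]
    simp only [tr_or, tr_not, tr_eq, tr_read, eval_read, eval_scalar, eval_var,
      List.getD_cons_zero, List.getD_cons_succ,
      h1 5 (by decide), h1 6 (by decide), h1 7 (by decide), hu, hv, h.F, ne_eq,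
      ite_eq_right_iff, one_ne_zero, imp_false, not_not, Fin.val_inj]
    have h3 := h2 x
    have h4 := h2 (s.F u x)
    have h5 := h2 (s.F v x)
    tauto

end

end Tab


/-! ### Correctness of the search programs. -/

namespace Tab

open Finset Matching Tm Prog

variable {N : ℕ} {E : Fin N → Fin N → Prop} {e : ℕ} {T : Tabs} {s : State (Fin N)} {u v : Fin N}

lemma eval_ite_of_iff {u s t : Tm} {ρ : List ℕ} {p : Prop} [Decidable p] (h : u.Tr N T ρ ↔ p) :
    (Tm.ite u s t).eval N T ρ = if p then s.eval N T ρ else t.eval N T ρ := by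
  rw [eval_ite]; exact if_congr h rfl rfl

lemma run_cond_of_iff {t : Tm} {q r : Prog} {p : Prop} [Decidable p] (h : t.Tr N T [0, 0] ↔ p) :
    (Prog.cond t q r).run N T = if p then q.run N T else r.run N T := by
  rw [run_cond]; exact if_congr h rfl rfl

lemma tr_innerT (h : Rep E e T s) (hs : ∀ x ∈ s.O, x ∉ s.I) {S : Finset (Fin N)}
    (hS : ∀ x : Fin N, T 8 x 0 ≠ 0 ↔ x ∈ S) {ρ : List ℕ} {t : Tm} {x : Fin N}
    (ht : t.eval N T ρ = x) : (innerT t).Tr N T ρ ↔ x ∈ S ∩ s.I := by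
  have hN : 0 < N := x.pos
  rw [innerT, tr_and, tr_entry, tr_eq, eval_entry, ht, hS, h.st x 0 hN, mem_inter, eval_const]
  by_cases hO : x ∈ s.O
  · simp [hO, hs x hO]
  · simp [hO]

/-- Only the rows of inner points are replaced. Such a point differs from the outer point `u`, so
its row of table 9 is the one described by `run_beforeP`. -/
lemma rep_merge (h : Rep E e T s) (he : e < 3) (hs : ∀ x ∈ s.O, x ∉ s.I)
    (hu : T 6 0 0 = u) (hv : T 7 0 0 = v) (huO : u ∈ s.O)
    (hf : ∀ x, s.F u (s.F u x) = x) (hg : ∀ x, s.F v (s.F v x) = x)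
    (hS : ∀ x : Fin N, T 8 x 0 ≠ 0 ↔ x ∈ comp (s.F u) (s.F v) u) :
    Rep E e (mergeP.run N T) (merge s (comp (s.F u) (s.F v) u) (around (s.F u) (s.F v) u v)) := by
  have hB : ∀ a, a ≠ 9 → beforeP.run N T a = T a := fun a ha =>
    run_of_notMem _ _ (by simpa [beforeP, writes] using ha)
  have hT₁ : Rep E e (beforeP.run N T) s := h.congr he fun a ha => hB a (by omega)
  constructor
  · intro x y
    rw [run_of_notMem _ _ (by simp [mergeP, beforeP, writes]; omega)]; exact h.adj x y
  · intro x j hj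
    rw [run_of_notMem _ _ (by simp [mergeP, beforeP, writes])]; exact h.M x j hj
  · intro x j hj
    have hN : 0 < N := x.pos
    rw [mergeP, run_seq, run_seq, run_assign_self x.2 hj]
    have key : ∀ t, ((innerT (.var 0)).Tr N ((assign 5 t).run N (beforeP.run N T)) [↑x, j] ↔
        x ∈ comp (s.F u) (s.F v) u ∩ s.I) := by
      intro t
      rw [← tr_innerT hT₁ hs (by simpa only [hB 8 (by decide)] using hS) (t := .var 0)
        (ρ := [↑x, j]) rfl]
      simp only [innerT, tr_and, tr_entry, tr_eq, eval_entry, eval_var,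
        run_assign_ne (show 8 ≠ 5 by decide), run_assign_ne (show 4 ≠ 5 by decide), eval_const]
    rw [eval_ite_of_iff (key _), eval_const, eval_entry, eval_var, run_assign_ne (by decide), hB 4 (by decide)]
    simp only [List.getD_cons_zero, h.st x 0 hN, merge, mem_union, mem_sdiff]
    split_ifs <;> simp_all
  · intro w x
    have hN : 0 < N := x.pos
    rw [mergeP, run_seq, run_seq, run_assign_ne (by decide), run_assign_self w.2 x.2,
      eval_ite_of_iff (tr_innerT hT₁ hs (by simpa only [hB 8 (by decide)] using hS) (x := w) rfl)]
    by_cases hw : w ∈ comp (s.F u) (s.F v) u ∩ s.I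
    · have hwu : w ≠ u := fun e => hs u huO (e ▸ (mem_inter.1 hw).2)
      have hbef : ∀ x : Fin N, beforeP.run N T 9 w x = 0 ↔ x ∉ before (s.F u) (s.F v) u w :=
        fun x => by rw [← run_beforeP h hu hv hf hg hwu, not_not]
      have hS' : ∀ x : Fin N, T 8 x 0 = 0 ↔ x ∉ comp (s.F u) (s.F v) u :=
        fun x => by rw [← hS, not_not]
      simp only [hw, if_true, eval_ite, tr_eq, tr_read, tr_entry, eval_read, eval_scalar, eval_var,
        List.getD_cons_zero, List.getD_cons_succ, hB 5 (by decide), hB 6 (by decide),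
        hB 7 (by decide), hB 8 (by decide), hu, hv, h.F, hbef, hS', Fin.val_inj, merge, around,
        ne_eq, not_not]
      split_ifs <;> rfl
    · simp only [hw, if_false, eval_read, eval_var, List.getD_cons_zero, List.getD_cons_succ,
        hB 5 (by decide), h.F, merge]

lemma rep_augment (h : Rep E e T s) (he : e < 3) (hu : T 6 0 0 = u) (hv : T 7 0 0 = v)
    (hS : ∀ x : Fin N, T 8 x 0 ≠ 0 ↔ x ∈ comp (s.F u) (s.F v) u) :
    Rep E e (augmentP.run N T) (start (augment (s.F u) (s.F v) u v)) := by
  rw [augmentP, run_seq]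
  refine rep_start he (fun x y => ?_) fun x j hj => ?_
  · rw [run_assign_ne (by omega)]; exact h.adj x y
  · have hex : ∀ t : Tm, (t.ex.Tr N T [↑x, j] ↔ ∃ y : Fin N, t.Tr N T [↑x, j, ↑y]) := fun t => by
      rw [tr_ex]
      exact ⟨fun ⟨i, hi, h⟩ => ⟨⟨i, hi⟩, h⟩, fun ⟨y, h⟩ => ⟨y, y.2, h⟩⟩
    rw [run_assign_self x.2 hj, eval_ite_of_iff (hex _)]
    simp only [eval_ite, tr_and, tr_not, tr_eq, tr_entry, eval_read, eval_scalar, eval_var,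
      List.getD_cons_zero, List.getD_cons_succ, hu, hv, h.F, hS, Fin.val_inj, augment]
    split_ifs <;> simp [*]
    split_ifs <;> simp_all

/-- The program `actP` implements the step of the search. -/
lemma rep_act (h : Rep E e T s) (hs : Good E s) (he : e < 3) (hu : T 6 0 0 = u)
    (hv : T 7 0 0 = v) : Rep E e ((actP e).run N T) (act E s u v) := by
  classical
  have hN : 0 < N := u.pos
  obtain ⟨β, pa, hval⟩ := hs
  have hO : ∀ x : Fin N, T 4 x 0 = 2 ↔ x ∈ s.O := fun x => by
    rw [h.st x 0 hN]; split_ifs <;> simp_all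
  have hI : ∀ x : Fin N, x ∉ s.O → (T 4 x 0 = 1 ↔ x ∈ s.I) := fun x hx => by
    rw [h.st x 0 hN]; split_ifs <;> simp_all
  rw [actP, run_cond_of_iff (p := u ∈ s.O ∧ E u v) (by rw [tr_and, tr_eq, tr_read, eval_entry,
    eval_scalar, eval_scalar, hu, hv, eval_const, hO, h.adj])]
  unfold act
  by_cases h1 : u ∈ s.O ∧ E u v
  · rw [if_pos h1, if_pos h1, run_cond_of_iff (p := v ∈ s.O) (by
      rw [tr_eq, eval_entry, eval_scalar, hv, eval_const, hO])]
    by_cases h2 : v ∈ s.O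
    · have hf := (hval.isMatch_F u h1.1).invol
      have hg := (hval.isMatch_F v h2).invol
      have hC : ∀ a, a ≠ 8 → compP.run N T a = T a := fun a ha =>
        run_of_notMem _ _ (by simpa [compP, writes] using ha)
      have h' : Rep E e (compP.run N T) s := h.congr he fun a ha => hC a (by omega)
      have hS : ∀ x : Fin N, compP.run N T 8 x 0 ≠ 0 ↔ x ∈ comp (s.F u) (s.F v) u := fun x =>
        run_compP h hu hv hf hg x hN
      have hu' : compP.run N T 6 0 0 = u := by rw [hC 6 (by decide), hu]
      have hv' : compP.run N T 7 0 0 = v := by rw [hC 7 (by decide), hv]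
      rw [if_pos h2, if_pos h2, run_seq, run_cond_of_iff (p := v ∈ comp (s.F u) (s.F v) u) (by
          rw [tr_entry, eval_scalar, hv', hS])]
      by_cases h3 : v ∈ comp (s.F u) (s.F v) u
      · have hex : ((innerT (.var 2)).ex.Tr N (compP.run N T) [0, 0]) ↔
            ∃ x ∈ comp (s.F u) (s.F v) u, x ∈ s.I := by
          rw [tr_ex]
          constructor
          · rintro ⟨i, hi, h⟩
            have := (tr_innerT h' hval.disjoint hS (x := ⟨i, hi⟩) (t := .var 2)
              (ρ := [0, 0] ++ [i]) rfl).1 h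
            exact ⟨_, mem_inter.1 this⟩
          · rintro ⟨x, hx⟩
            exact ⟨x, x.2, (tr_innerT h' hval.disjoint hS (x := x) (t := .var 2)
              (ρ := [0, 0] ++ [x.1]) rfl).2 (mem_inter.2 hx)⟩
        rw [if_pos h3, if_pos h3, run_cond_of_iff hex]
        split_ifs with h4
        · exact rep_merge h' he hval.disjoint hu' hv' h1.1 hf hg hS
        · exact h'
      · rw [if_neg h3, if_neg h3]
        exact rep_augment h' he hu' hv' hS
    · rw [if_neg h2, if_neg h2, run_cond_of_iff (p := v ∈ s.I) (by
        rw [tr_eq, eval_entry, eval_scalar, hv, eval_const, hI v h2])]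
      split_ifs with h3
      · exact h
      · exact rep_grow h he hu hv h2
  · rw [if_neg h1, if_neg h1]
    exact h

/-- As long as the state has not changed, every pair tried so far is stuck in the initial state; so
a sweep without progress proves that all pairs are stuck. The last clause keeps a finished search
fixed. -/
lemma run_sweepP (hN : 0 < N) (he : e < 3) (hE : ∀ a b, E a b → E b a) (hirr : ∀ a, ¬ E a a)
    (h : Rep E e T s) (hs : Good E s) :
    ∃ s', Rep E e ((sweepP e).run N T) s' ∧ Good E s' ∧
      ((s' = s ∧ ∀ u v, Stuck E s u v) ∨ progress s < progress s') ∧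
      ((∀ u v, Stuck E s u v) → s' = s) := by
  have hw : (6 : ℕ) ∉ (Prog.forLoop 7 (actP e)).writes ∧ (7 : ℕ) ∉ (actP e).writes := by
    simp [forLoop, actP, compP, mergeP, beforeP, augmentP, growP, startP, writes]
  let Q : ℕ → ℕ → Tabs → Prop := fun i j T' => ∃ s', Rep E e T' s' ∧ Good E s' ∧
    ((s' = s ∧ ∀ u v : Fin N, ((u : ℕ) < i ∨ (u : ℕ) = i ∧ (v : ℕ) < j) → Stuck E s u v) ∨
      progress s < progress s') ∧ ((∀ u v, Stuck E s u v) → s' = s)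
  have hcongr : ∀ i j T₁ T₂, (∀ a, a < 6 → T₂ a = T₁ a) → Q i j T₁ → Q i j T₂ := by
    rintro i j T₁ T₂ hT ⟨s', h1, h2⟩
    exact ⟨s', h1.congr he hT, h2⟩
  have hend : Q N 0 ((sweepP e).run N T) := by
    refine run_forLoop hN (P := fun i T' => Q i 0 T') ?_ hw.1 ?_ ?_
    · exact ⟨s, h, hs, .inl ⟨rfl, fun u v huv => by omega⟩, fun _ => rfl⟩
    · exact fun i T₁ T₂ hT => hcongr i 0 T₁ T₂ fun a ha => hT a (by omega)
    · intro i hi T₁ hT₁ hQ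
      have := run_forLoop (c := 7) (p := actP e) (T := T₁) hN
        (P := fun j T' => T' 6 0 0 = i ∧ Q i j T') ⟨hT₁, hQ⟩ hw.2
        (fun j T₂ T₃ hT h => ⟨by rw [hT 6 (by decide)]; exact h.1,
          hcongr i j T₂ T₃ (fun a ha => hT a (by omega)) h.2⟩)
        (fun j hj T₂ hT₂ h => by
          obtain ⟨h6, s', hrep, hgood, hprog, heq⟩ := h
          refine ⟨?_, ?_⟩
          · rw [run_of_notMem _ _ ?_, h6]
            have := hw.1
            simp only [forLoop, writes, List.mem_append, not_or] at this
            tauto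
          · have h' := rep_act (u := ⟨i, hi⟩) (v := ⟨j, hj⟩) hrep hgood he h6 hT₂
            obtain ⟨g1, g2⟩ := hgood.act hE hirr ⟨i, hi⟩ ⟨j, hj⟩
            refine ⟨_, h', g1, ?_, ?_⟩
            · rcases hprog with ⟨rfl, hstuck⟩ | hprog
              · rcases g2 with ⟨g2, g3⟩ | g2
                · refine .inl ⟨g2, fun u v huv => ?_⟩
                  by_cases huv' : (u : ℕ) = i ∧ (v : ℕ) = j
                  · have hu : u = ⟨i, hi⟩ := Fin.ext huv'.1
                    have hv : v = ⟨j, hj⟩ := Fin.ext huv'.2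
                    rw [hu, hv]
                    exact g3
                  · exact hstuck u v (by omega)
                · exact .inr g2
              · rcases g2 with ⟨g2, g3⟩ | g2
                · exact .inr (by rwa [g2])
                · exact .inr (hprog.trans g2)
            · intro hst
              have := heq hst
              subst this
              obtain ⟨β, pa, hval⟩ := hgood
              exact (hst _ _).act_eq hval.disjoint)
      obtain ⟨-, s', h1, h2, h3, h4⟩ := this
      refine ⟨s', h1, h2, h3.imp_left fun h3 => ⟨h3.1, fun u v huv => h3.2 u v ?_⟩, h4⟩
      have := v.2
      omega
  obtain ⟨s', h1, h2, h3, h4⟩ := hend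
  exact ⟨s', h1, h2, h3.imp_left fun h3 => ⟨h3.1, fun u v => h3.2 u v (.inl u.2)⟩, h4⟩

/-- The program `matchP` finds a largest matching, and a forest which certifies this. -/
theorem run_matchP (hN : 0 < N) (he : e < 3) (hE : ∀ a b, E a b → E b a) (hirr : ∀ a, ¬ E a a)
    (hadj : ∀ x y : Fin N, T e x y ≠ 0 ↔ E x y) :
    ∃ s, Rep E e ((matchP e).run N T) s ∧ Good E s ∧ ∀ u v, Stuck E s u v := by
  let R : ℕ → Tabs → Prop := fun k T' => ∃ s, Rep E e T' s ∧ Good E s ∧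
    ((∀ u v, Stuck E s u v) ∨ k ≤ progress s)
  have h1 : ∀ k T', R k T' → R (k + 1) ((sweepP e).run N T') := by
    rintro k T' ⟨s, hrep, hgood, hk⟩
    obtain ⟨s', h1, h2, h3, h4⟩ := run_sweepP hN he hE hirr hrep hgood
    refine ⟨s', h1, h2, ?_⟩
    by_cases hst : ∀ u v, Stuck E s u v
    · exact .inl (by rwa [h4 hst])
    · have hk := hk.resolve_left hst
      rcases h3 with h3 | h3
      · exact absurd h3.2 hst
      · exact .inr (by omega)
  have h8 : ∀ k T', R k T' → R (k + 8) ((twice (twice (twice (sweepP e)))).run N T') :=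
    fun k T' h => h1 _ _ (h1 _ _ (h1 _ _ (h1 _ _ (h1 _ _ (h1 _ _ (h1 _ _ (h1 _ _ h)))))))
  have hN8 : ∀ k T', R k T' →
      R (k + N * 8) ((Prog.iter (twice (twice (twice (sweepP e))))).run N T') := fun k T' h =>
    run_iter (P := fun i T' => R (k + i * 8) T') (by simpa using h) fun i _ T' h => by
      rw [Nat.succ_mul, ← add_assoc]; exact h8 _ _ h
  have hstart : R 0 (startP.run N ((Prog.assign 3 (.var 0)).run N T)) :=
    ⟨_, rep_start (M := id) he (fun x y => by rw [run_assign_ne (by omega)]; exact hadj x y)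
      (fun x j hj => by rw [run_assign_self x.2 hj]; rfl),
      good_start ⟨fun _ => rfl, fun _ h => absurd rfl h⟩, .inr (Nat.zero_le _)⟩
  obtain ⟨s, hrep, hgood, hs⟩ : R (N * (N * 8)) ((matchP e).run N T) :=
    run_iter (P := fun i T' => R (i * (N * 8)) T') (by simpa using hstart) fun i _ T' h => by
      rw [Nat.succ_mul]; exact hN8 _ _ h
  -- The two nested loops run `8 * N ^ 2` sweeps, more than the bound `4 * N ^ 2 + N` on the
  -- progress.
  refine ⟨s, hrep, hgood, hs.resolve_right fun hle => ?_⟩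
  have := hgood.progress_le
  rw [Fintype.card_fin] at this
  nlinarith

end Tab


/-! ### Matchings as involutions, and the matching number -/

namespace Matching

open Finset

lemma bddAbove_matching {V : Type*} [Fintype V] (G : SimpleGraph V) :
    BddAbove {k : ℕ | ∃ M : G.Subgraph, M.IsMatching ∧ M.edgeSet.ncard = k} := by
  refine ⟨G.edgeSet.ncard, ?_⟩
  rintro k ⟨M, -, rfl⟩
  exact Set.ncard_le_ncard M.edgeSet_subset

variable {V : Type*} [DecidableEq V]

/-- The edges of a matching. -/
def pairs [Fintype V] (f : V → V) : Finset (Sym2 V) :=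
  (univ.filter fun x => f x ≠ x).image fun x => s(x, f x)

/-- Each pair arises from exactly two moved points, its ends. -/
lemma two_mul_card_pairs [Fintype V] {f : V → V} (hf : ∀ x, f (f x) = x) :
    2 * #(pairs f) = #{x | f x ≠ x} := by
  rw [card_eq_sum_card_fiberwise (f := fun x => s(x, f x)) (t := pairs f)
    fun x hx => mem_image_of_mem _ hx, mul_comm, ← smul_eq_mul]
  refine (sum_const_nat (m := 2) fun e he => ?_).symm
  obtain ⟨x, hx, rfl⟩ := mem_image.1 he
  have hx : f x ≠ x := by simpa using hx
  rw [← card_pair hx.symm]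
  congr 1
  ext y
  simp only [mem_filter, mem_univ, true_and, Sym2.eq_iff, mem_insert, mem_singleton]
  constructor
  · rintro ⟨-, h | h⟩
    · exact .inl h.1
    · exact .inr h.1
  · rintro (rfl | rfl)
    · exact ⟨hx, .inl ⟨rfl, rfl⟩⟩
    · exact ⟨by rw [hf]; exact hx.symm, .inr ⟨rfl, hf x⟩⟩

variable [Fintype V] {G : SimpleGraph V}

lemma IsMatch.card_le_matchingNumber {f : V → V} (hf : IsMatch G.Adj f) :
    #{x | f x ≠ x} ≤ 2 * matchingNumber G := by
  rw [← two_mul_card_pairs hf.invol]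
  refine Nat.mul_le_mul_left 2 (le_csSup (bddAbove_matching G) ?_)
  refine ⟨{ verts := {x | f x ≠ x}
            Adj := fun x y => f x = y ∧ x ≠ y
            adj_sub := ?_
            edge_vert := ?_
            symm := ?_ }, ?_, ?_⟩
  · rintro x _ ⟨rfl, h⟩
    exact hf.adj x h.symm
  · rintro x _ ⟨rfl, h⟩
    exact h.symm
  · constructor
    rintro x _ ⟨rfl, h⟩
    exact ⟨hf.invol x, h.symm⟩
  · intro x hx
    exact ⟨f x, ⟨rfl, fun e => hx e.symm⟩, fun y hy => hy.1.symm⟩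
  · rw [← Set.ncard_coe_finset]
    congr 1
    ext e
    induction e with | _ x y => ?_
    simp only [SimpleGraph.Subgraph.mem_edgeSet, pairs, coe_image, Set.mem_image, coe_filter,
      mem_univ, true_and, Set.mem_ofPred_eq, Sym2.eq_iff]
    constructor
    · rintro ⟨rfl, h⟩
      exact ⟨x, h.symm, .inl ⟨rfl, rfl⟩⟩
    · rintro ⟨z, hz, ⟨rfl, rfl⟩ | ⟨rfl, rfl⟩⟩
      · exact ⟨rfl, hz.symm⟩
      · exact ⟨hf.invol _, hz⟩

lemma exists_isMatch_of_isMatching {M : G.Subgraph} (hM : M.IsMatching) :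
    ∃ f, IsMatch G.Adj f ∧ 2 * M.edgeSet.ncard = #{x | f x ≠ x} := by
  classical
  have hex : ∀ x, ∃ y, (x ∈ M.verts ∧ M.Adj x y) ∨ (x ∉ M.verts ∧ y = x) := fun x => by
    by_cases h : x ∈ M.verts
    · obtain ⟨y, hy, -⟩ := hM h
      exact ⟨y, .inl ⟨h, hy⟩⟩
    · exact ⟨x, .inr ⟨h, rfl⟩⟩
  choose f hf using hex
  have hadj : ∀ x, f x ≠ x → M.Adj x (f x) := fun x hx => by
    rcases hf x with h | h
    · exact h.2
    · exact absurd h.2 hx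
  have huniq : ∀ x y, M.Adj x y → f x = y := fun x y h => by
    rcases hf x with h' | h'
    · exact (hM h'.1).unique h'.2 h
    · exact absurd (M.edge_vert h) h'.1
  have hinv : ∀ x, f (f x) = x := fun x => by
    by_cases h : f x = x
    · rw [h, h]
    · exact huniq _ _ (hadj x h).symm
  refine ⟨f, ⟨hinv, fun x hx => (hadj x hx).adj_sub⟩, ?_⟩
  rw [← two_mul_card_pairs hinv, ← Set.ncard_coe_finset]
  congr 2
  ext e
  induction e with | _ x y => ?_
  simp only [SimpleGraph.Subgraph.mem_edgeSet, pairs, coe_image, Set.mem_image, coe_filter,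
    mem_univ, true_and, Set.mem_ofPred_eq, Sym2.eq_iff]
  constructor
  · intro h
    exact ⟨x, by rw [huniq _ _ h]; exact h.ne.symm, .inl ⟨rfl, huniq _ _ h⟩⟩
  · rintro ⟨z, hz, ⟨rfl, rfl⟩ | ⟨rfl, rfl⟩⟩
    · exact hadj _ hz
    · exact (hadj _ hz).symm

lemma card_fixed_add_card_moved (f : V → V) : #(fixed f) + #{x | f x ≠ x} = Fintype.card V := by
  rw [fixed, card_filter_add_card_filter_not, card_univ]

lemma IsMatch.card_eq_matchingNumber {f : V → V} (hf : IsMatch G.Adj f)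
    (hmax : ∀ g, IsMatch G.Adj g → #(fixed f) ≤ #(fixed g)) :
    #{x | f x ≠ x} = 2 * matchingNumber G := by
  refine hf.card_le_matchingNumber.antisymm ?_
  have hne : {k : ℕ | ∃ M : G.Subgraph, M.IsMatching ∧ M.edgeSet.ncard = k}.Nonempty :=
    ⟨_, ⊥, fun v hv => absurd hv (by simp), rfl⟩
  obtain ⟨M, hM, hk⟩ := Nat.sSup_mem hne (bddAbove_matching G)
  obtain ⟨g, hg, hc⟩ := exists_isMatch_of_isMatching hM
  have h1 := hmax g hg
  have h2 := card_fixed_add_card_moved f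
  have h3 := card_fixed_add_card_moved g
  rw [matchingNumber, ← hk]
  omega

/-- Disjoint edges from the points of `S` to points outside `S`. -/
lemma card_le_matchingNumber_of_injOn {S : Finset V} {g : V → V} (hadj : ∀ x ∈ S, G.Adj x (g x))
    (hg : ∀ x ∈ S, g x ∉ S) (hinj : Set.InjOn g S) : #S ≤ matchingNumber G := by
  have hex : ∀ x, ∃ y, (x ∈ S ∧ y = g x) ∨ (y ∈ S ∧ x = g y) ∨
      (x ∉ S ∧ (∀ z ∈ S, x ≠ g z) ∧ y = x) := fun x => by
    by_cases h : x ∈ S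
    · exact ⟨g x, .inl ⟨h, rfl⟩⟩
    by_cases h' : ∃ y ∈ S, x = g y
    · obtain ⟨y, h1, h2⟩ := h'
      exact ⟨y, .inr (.inl ⟨h1, h2⟩)⟩
    · push Not at h'
      exact ⟨x, .inr (.inr ⟨h, h', rfl⟩)⟩
  choose f hf using hex
  have h1 : ∀ x ∈ S, f x = g x := fun x hx => by
    rcases hf x with h | ⟨h, h'⟩ | h
    · exact h.2
    · exact absurd hx (h' ▸ hg _ h)
    · exact absurd hx h.1
  have h2 : ∀ x ∈ S, f (g x) = x := fun x hx => by
    rcases hf (g x) with h | ⟨h, h'⟩ | h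
    · exact absurd h.1 (hg x hx)
    · exact (hinj hx h h').symm
    · exact absurd rfl (h.2.1 x hx)
  have hm : IsMatch G.Adj f := by
    refine ⟨fun x => ?_, fun x hx => ?_⟩
    · rcases hf x with ⟨h, h'⟩ | ⟨h, h'⟩ | ⟨-, -, h'⟩
      · rw [h', h2 x h]
      · rw [h1 _ h, ← h']
      · rw [h', h']
    · rcases hf x with ⟨h, h'⟩ | ⟨h, h'⟩ | ⟨-, -, h'⟩
      · rw [h']; exact hadj x h
      · have := hadj _ h
        rw [← h'] at this
        exact this.symm
      · exact absurd h' hx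
  have hdisj : Disjoint S (S.image g) := by
    rw [disjoint_left]
    rintro x hx hx'
    obtain ⟨y, hy, rfl⟩ := mem_image.1 hx'
    exact hg y hy hx
  have hsub : S ∪ S.image g ⊆ univ.filter fun x => f x ≠ x := by
    intro x hx
    rw [mem_filter]
    refine ⟨mem_univ _, ?_⟩
    rcases mem_union.1 hx with hx | hx
    · rw [h1 x hx]
      exact fun e => hg x hx (e.symm ▸ hx)
    · obtain ⟨y, hy, rfl⟩ := mem_image.1 hx
      rw [h2 y hy]
      exact fun e => hg y hy (e ▸ hy)
  have := (card_le_card hsub).trans hm.card_le_matchingNumber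
  rw [card_union_of_disjoint hdisj, card_image_of_injOn hinj] at this
  omega

end Matching


/-! ### Half-integral covers -/

namespace Matching

open Finset

section

variable {V : Type*} [Fintype V]

lemma sum_add_sum_involution {f : V → V} (hf : ∀ x, f (f x) = x) (y : V → ℕ) :
    ∑ a, (y a + y (f a)) = 2 * ∑ a, y a := by
  rw [sum_add_distrib, two_mul, add_right_inj]
  exact (Function.Involutive.bijective hf).sum_comp y

variable [DecidableEq V]

/-- Complementary slackness: a cover of the same size as a matching is tight on its edges. -/
lemma add_eq_one_of_cover {E : V → V → Prop} {f : V → V} (hf : IsMatch E f) {y : V → ℕ}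
    (hy : ∀ a b, E a b → 1 ≤ y a + y b) (heq : #{a | f a ≠ a} = 2 * ∑ a, y a) {a : V}
    (ha : f a ≠ a) : y a + y (f a) = 1 := by
  rw [← sum_add_sum_involution hf.invol y, card_filter] at heq
  have := (sum_eq_sum_iff_of_le fun a _ => ?_).1 heq a (mem_univ a)
  · rw [if_pos ha] at this
    exact this.symm
  · split_ifs with h
    · exact hy _ _ (hf.adj a h)
    · exact Nat.zero_le _

end

variable {n : ℕ} {G : SimpleGraph (Fin n)}

/-- The adjacency relation of the bipartite double cover. -/
def dbl (G : SimpleGraph (Fin n)) (a b : Fin (n + n)) : Prop :=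
  ∃ v w, G.Adj v w ∧
    ((a = Fin.castAdd n v ∧ b = Fin.natAdd n w) ∨ (a = Fin.natAdd n v ∧ b = Fin.castAdd n w))

lemma dbl_symm (a b : Fin (n + n)) (h : dbl G a b) : dbl G b a := by
  obtain ⟨v, w, h, ⟨rfl, rfl⟩ | ⟨rfl, rfl⟩⟩ := h
  · exact ⟨w, v, h.symm, .inr ⟨rfl, rfl⟩⟩
  · exact ⟨w, v, h.symm, .inl ⟨rfl, rfl⟩⟩

lemma dbl_color (a b : Fin (n + n)) (h : dbl G a b) :
    decide ((a : ℕ) < n) ≠ decide ((b : ℕ) < n) := by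
  obtain ⟨v, w, h, ⟨rfl, rfl⟩ | ⟨rfl, rfl⟩⟩ := h <;> simp

lemma dbl_irrefl (a : Fin (n + n)) : ¬ dbl G a a := fun h => dbl_color a a h rfl

/-- The vector `x / 2` is a cover of `G` in which at most `ν` points have the value `1`. -/
structure HalfCover (G : SimpleGraph (Fin n)) (x : Fin n → ℕ) : Prop where
  le_two : ∀ v, x v ≤ 2
  cover : ∀ v w, G.Adj v w → 2 ≤ x v + x w
  card_two : #{v | x v = 2} ≤ matchingNumber G
  le_of_blocking : ∀ B, IsBlockingSet G B → ∑ v, x v ≤ 2 * matchingNumber G + 2 * #B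

/-- The cover of the double cover which is given by the final state of the search. -/
def sideCover (s : State (Fin (n + n))) (a : Fin (n + n)) : ℕ :=
  if a ∈ s.I then 1 else if a ∈ s.O then 0 else if (a : ℕ) < n then 0 else 1

/-- The projection of the cover of the double cover. -/
def foldCover (s : State (Fin (n + n))) (v : Fin n) : ℕ :=
  sideCover s (Fin.castAdd n v) + sideCover s (Fin.natAdd n v)

/-- König's theorem read off the final forest: inner points, and for edges outside the forest the
points of the second copy, cover everything. The cover has one point on each matching edge and none
that is exposed, so its size is that of the matching. -/
lemma halfCover_foldCover {s : State (Fin (n + n))} (h : Good (dbl G) s)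
    (hs : ∀ u v, Stuck (dbl G) s u v) : HalfCover G (foldCover s) := by
  obtain ⟨h1, h2, h3, h4, h5⟩ := h.bipartite hs dbl_color
  have hm := h.isMatch
  have hcov : ∀ a b, dbl G a b → 1 ≤ sideCover s a + sideCover s b := by
    intro a b hab
    by_cases ha : a ∈ s.O
    · have hb := h1 a ha b hab
      simp [sideCover, hb]
    by_cases hb : b ∈ s.O
    · have ha := h1 b hb a (dbl_symm a b hab)
      simp [sideCover, ha]
    have hc := dbl_color a b hab
    unfold sideCover
    split_ifs <;> simp_all
  have htight : ∀ a, s.M a ≠ a → sideCover s a + sideCover s (s.M a) = 1 := by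
    intro a ha
    have hE := hm.adj a ha
    by_cases haI : a ∈ s.I
    · have hO := h4 a haI
      simp [sideCover, haI, hO, h3 _ hO]
    by_cases haO : a ∈ s.O
    · have hI := h1 a haO _ hE
      simp [sideCover, haI, haO, hI]
    · obtain ⟨g1, g2⟩ := h5 a haO haI
      have hc := dbl_color a _ hE
      simp only [sideCover, haI, haO, g1, g2, if_false]
      split_ifs <;> simp_all
  have hfree : ∀ a, s.M a = a → sideCover s a = 0 := fun a ha => by
    have := h2 a ha
    simp [sideCover, this, h3 a this]
  have hsum : #{a | s.M a ≠ a} = 2 * ∑ a, sideCover s a := by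
    rw [← sum_add_sum_involution hm.invol, card_filter]
    refine sum_congr rfl fun a _ => ?_
    split_ifs with ha
    · exact (htight a ha).symm
    · rw [not_not] at ha
      rw [ha, hfree a ha]
  have hfold : ∑ v, foldCover s v = ∑ a, sideCover s a := by
    rw [Fin.sum_univ_add, ← sum_add_distrib]
    rfl
  have hle1 : ∀ a, sideCover s a ≤ 1 := fun a => by
    unfold sideCover
    split_ifs <;> simp
  refine ⟨fun v => ?_, fun v w hvw => ?_, ?_, fun B hB => ?_⟩
  · have := hle1 (Fin.castAdd n v)
    have := hle1 (Fin.natAdd n v)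
    unfold foldCover
    omega
  · have := hcov _ _ ⟨v, w, hvw, .inl ⟨rfl, rfl⟩⟩
    have := hcov _ _ ⟨v, w, hvw, .inr ⟨rfl, rfl⟩⟩
    unfold foldCover
    omega
  -- Exchanging the two sides yields another cover `z` of the same size, which complementary
  -- slackness makes tight on the same matching edges.
  · have hswap : ∀ v w, s.M (Fin.castAdd n v) = Fin.natAdd n w →
        sideCover s (Fin.natAdd n v) + sideCover s (Fin.castAdd n w) = 1 := by
      intro v w hvw
      let z : Fin (n + n) → ℕ := Fin.append (fun v => sideCover s (Fin.natAdd n v))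
        fun v => sideCover s (Fin.castAdd n v)
      have hz : ∀ a b, dbl G a b → 1 ≤ z a + z b := by
        rintro a b ⟨v, w, hvw, ⟨rfl, rfl⟩ | ⟨rfl, rfl⟩⟩
        · simpa [z, -Fin.natAdd_eq_addNat] using hcov _ _ ⟨v, w, hvw, .inr ⟨rfl, rfl⟩⟩
        · simpa [z, -Fin.natAdd_eq_addNat] using hcov _ _ ⟨v, w, hvw, .inl ⟨rfl, rfl⟩⟩
      have hzsum : ∑ a, z a = ∑ a, sideCover s a := by
        rw [Fin.sum_univ_add, Fin.sum_univ_add, add_comm]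
        simp [z, -Fin.natAdd_eq_addNat]
      have hne : s.M (Fin.castAdd n v) ≠ Fin.castAdd n v := by
        rw [hvw]
        intro e
        have := congrArg Fin.val e
        simp at this
        omega
      have := add_eq_one_of_cover hm hz (by rw [hzsum, hsum]) hne
      rw [hvw] at this
      simpa [z, -Fin.natAdd_eq_addNat] using this
    -- If both copies of `v` are in the cover and its first copy is matched with the second copy of
    -- `w`, tightness of the cover and of its exchange leaves both copies of `w` out. As a matching
    -- is injective, so is the choice of `w`.
    have hex : ∀ v, ∃ w, foldCover s v = 2 →
        G.Adj v w ∧ foldCover s w = 0 ∧ s.M (Fin.castAdd n v) = Fin.natAdd n w := by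
      intro v
      by_cases hv : foldCover s v = 2
      · have a1 := hle1 (Fin.castAdd n v)
        have a2 := hle1 (Fin.natAdd n v)
        unfold foldCover at hv
        have hne : s.M (Fin.castAdd n v) ≠ Fin.castAdd n v := fun e => by
          have := hfree _ e
          omega
        obtain ⟨v', w, hvw, ⟨e1, e2⟩ | ⟨e1, e2⟩⟩ := hm.adj _ hne
        · obtain rfl : v = v' := Fin.castAdd_injective n n e1
          refine ⟨w, fun _ => ⟨hvw, ?_, e2⟩⟩
          have b1 := hswap v w e2
          have b2 := htight _ hne
          rw [e2] at b2
          unfold foldCover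
          omega
        · have := congrArg Fin.val e1
          simp at this
          omega
      · exact ⟨v, fun h => absurd h hv⟩
    choose g hg using hex
    refine card_le_matchingNumber_of_injOn (g := g) (fun x hx => ?_) (fun x hx => ?_)
      fun x hx y hy hxy => ?_
    · exact (hg x (by simpa using hx)).1
    · simp [(hg x (by simpa using hx)).2.1]
    · have e1 := (hg x (by simpa using hx)).2.2
      have e2 := (hg y (by simpa using hy)).2.2
      rw [hxy, ← e2] at e1
      have := congrArg s.M e1
      rw [hm.invol, hm.invol] at this
      exact Fin.castAdd_injective n n this
  · obtain ⟨-, x, hx0, hxsum, hxcov⟩ := hB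
    -- Each edge of `B` is charged to one of its ends, here the first component of a representative.
    -- This covers the edges of `B` and adds `#B` to the total.
    let z : Fin n → ℝ := fun v => x v + #{e ∈ B | (Quot.out e).1 = v}
    have hz0 : ∀ v, 0 ≤ z v := fun v => add_nonneg (hx0 v) (Nat.cast_nonneg _)
    have hz : ∀ v w, G.Adj v w → 1 ≤ z v + z w := by
      intro v w hvw
      by_cases hB : s(v, w) ∈ B
      · have hmem : (Quot.out s(v, w)).1 ∈ s(v, w) := Sym2.out_fst_mem _
        have hpos : ∀ u, (Quot.out s(v, w)).1 = u → 1 ≤ z u := fun u hu => by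
          have : 0 < #{e ∈ B | (Quot.out e).1 = u} :=
            card_pos.2 ⟨s(v, w), mem_filter.2 ⟨hB, hu⟩⟩
          have : (1 : ℝ) ≤ #{e ∈ B | (Quot.out e).1 = u} := by exact_mod_cast this
          have := hx0 u
          simp only [z]
          linarith
        rcases Sym2.mem_iff.1 hmem with h | h
        · linarith [hpos _ h, hz0 w]
        · linarith [hpos _ h, hz0 v]
      · have := hxcov v w hvw hB
        simp only [z]
        have g1 : (0 : ℝ) ≤ #{e ∈ B | (Quot.out e).1 = v} := Nat.cast_nonneg _
        have g2 : (0 : ℝ) ≤ #{e ∈ B | (Quot.out e).1 = w} := Nat.cast_nonneg _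
        linarith
    have hzsum : ∑ v, z v ≤ matchingNumber G + #B := by
      have : #B = ∑ v, #{e ∈ B | (Quot.out e).1 = v} :=
        card_eq_sum_card_fiberwise fun _ _ => mem_coe.2 (mem_univ _)
      rw [sum_add_distrib, ← Nat.cast_sum, ← this]
      linarith
    let z' : Fin (n + n) → ℝ := Fin.append z z
    have hz'0 : ∀ a, 0 ≤ z' a := fun a => by
      refine Fin.addCases (fun v => ?_) (fun v => ?_) a <;> simpa [z', -Fin.natAdd_eq_addNat] using hz0 v
    have hz' : ∀ a b, dbl G a b → 1 ≤ z' a + z' b := by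
      rintro a b ⟨v, w, hvw, ⟨rfl, rfl⟩ | ⟨rfl, rfl⟩⟩ <;> simpa [z', -Fin.natAdd_eq_addNat] using hz v w hvw
    have hz'sum : ∑ a, z' a = 2 * ∑ v, z v := by
      rw [Fin.sum_univ_add, two_mul]
      simp [z', -Fin.natAdd_eq_addNat]
    -- Weak duality in the double cover: a fractional cover has at least weight 1 on each matching
    -- edge.
    have hle : (#{a | s.M a ≠ a} : ℝ) ≤ 2 * ∑ a, z' a := by
      have : ∑ a, (z' a + z' (s.M a)) = 2 * ∑ a, z' a := by
        rw [sum_add_distrib, two_mul, add_right_inj]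
        exact (Function.Involutive.bijective hm.invol).sum_comp z'
      rw [← this, card_filter, Nat.cast_sum]
      refine sum_le_sum fun a _ => ?_
      split_ifs with h
      · simpa using hz' _ _ (hm.adj a h)
      · simpa using add_nonneg (hz'0 a) (hz'0 _)
    rw [hsum, ← hfold, hz'sum] at hle
    have : (∑ v, foldCover s v : ℝ) ≤ 2 * matchingNumber G + 2 * #B := by
      push_cast at hle
      linarith
    exact_mod_cast this

/-! ### The greedy algorithm -/

open Classical in
/-- The number of neighbours of `v` on which `x` has the value `1`. -/
noncomputable def unitDegree (G : SimpleGraph (Fin n)) (x : Fin n → ℕ) (v : Fin n) : ℕ :=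
  #{w | x w = 1 ∧ G.Adj v w}

open Classical in
/-- The edges from `v` to points on which `x` has the value `1`. -/
noncomputable def unitEdges (G : SimpleGraph (Fin n)) (x : Fin n → ℕ) (v : Fin n) :
    Finset (Sym2 (Fin n)) := image (fun w => s(v, w)) {w | x w = 1 ∧ G.Adj v w}

/-- Averaging: the degrees in the subgraph induced on the points of value 1 sum to twice its number
of edges, which sparsity bounds. -/
lemma exists_unitDegree_le {ω : ℝ} (hG : IsSparse ω G) {x : Fin n → ℕ} (hx : ∃ v, x v = 1) :
    ∃ v, x v = 1 ∧ (unitDegree G x v : ℝ) ≤ 2 * ω := by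
  classical
  by_contra! hlt
  set S : Finset (Fin n) := {v | x v = 1} with hS
  have hSne : S.Nonempty := by
    obtain ⟨v, hv⟩ := hx
    exact ⟨v, by simpa [hS] using hv⟩
  have hdeg : ∀ v : (S : Set (Fin n)), (G.induce (S : Set (Fin n))).degree v =
      unitDegree G x v := by
    intro v
    rw [← SimpleGraph.card_neighborFinset_eq_degree, unitDegree]
    refine card_bij (fun w _ => (w : Fin n)) (fun w hw => ?_) (fun a _ b _ h => Subtype.ext h)
      fun w hw => ?_
    · have h1 : x w = 1 := by simpa [hS] using w.2
      rw [SimpleGraph.mem_neighborFinset] at hw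
      simpa [h1] using hw
    · have hw' : x w = 1 ∧ G.Adj v w := by simpa using hw
      exact ⟨⟨w, by simpa [hS] using hw'.1⟩, by simpa using hw'.2, rfl⟩
  have hsum := (G.induce (S : Set (Fin n))).sum_degrees_eq_twice_card_edges
  have hsp := hG S
  rw [Set.ncard_eq_toFinset_card', ← SimpleGraph.edgeFinset] at hsp
  have h1 : (∑ v : (S : Set (Fin n)), ((G.induce (S : Set (Fin n))).degree v : ℝ)) ≤
      2 * (ω * #S) := by
    rw [← Nat.cast_sum, hsum]
    push_cast
    linarith
  have h2 : ∑ v : (S : Set (Fin n)), (2 * ω) <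
      ∑ v : (S : Set (Fin n)), ((G.induce (S : Set (Fin n))).degree v : ℝ) := by
    obtain ⟨v, hv⟩ := hSne
    refine sum_lt_sum_of_nonempty ⟨⟨v, hv⟩, mem_univ _⟩ fun w _ => ?_
    rw [hdeg]
    exact hlt w (by simpa [hS] using w.2)
  rw [sum_const, card_univ, nsmul_eq_mul] at h2
  have : Fintype.card (S : Set (Fin n)) = #S := by simp
  rw [this] at h2
  linarith

/-- The vector `x` and the edge set `B` after `k` steps of the greedy algorithm from `x₀`. -/
structure Greedy (G : SimpleGraph (Fin n)) (ω : ℝ) (x₀ : Fin n → ℕ) (k : ℕ) (x : Fin n → ℕ)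
    (B : Finset (Sym2 (Fin n))) : Prop where
  edges : ∀ e ∈ B, e ∈ G.edgeSet
  le_two : ∀ v, x v ≤ 2
  cover : ∀ v w, G.Adj v w → s(v, w) ∉ B → 2 ≤ x v + x w
  card_two : #{v | x v = 2} ≤ matchingNumber G
  card_le : (#B : ℝ) ≤ 2 * ω * k
  sum_add : ∑ v, x v + k = ∑ v, x₀ v
  le_sum : k = 0 ∨ 2 * matchingNumber G ≤ ∑ v, x v

variable {ω : ℝ} {x₀ x : Fin n → ℕ} {k : ℕ} {B : Finset (Sym2 (Fin n))}

lemma greedy_start (h : HalfCover G x) : Greedy G ω x 0 x ∅ where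
  edges := by simp
  le_two := h.le_two
  cover v w hvw _ := h.cover v w hvw
  card_two := h.card_two
  card_le := by simp
  sum_add := rfl
  le_sum := .inl rfl

/-- If all values were 0 or 2, the sum would be twice the number of points of value 2, hence at most
2ν. -/
lemma Greedy.exists_eq_one (h : Greedy G ω x₀ k x B) (hlt : 2 * matchingNumber G < ∑ v, x v) :
    ∃ v, x v = 1 := by
  by_contra! h1
  have : ∑ v, x v = ∑ v, if x v = 2 then 2 else 0 := sum_congr rfl fun v _ => by
    have := h.le_two v
    have := h1 v
    split_ifs <;> omega
  rw [← sum_filter, sum_const, smul_eq_mul] at this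
  have := h.card_two
  omega

/-- An edge from `v` not yet in `B` leads to a point of value 1 or 2. In the first case it is added
to `B`; in the second it remains covered after `v` drops to 0. The minimum degree is at most 2ω by
averaging. -/
lemma Greedy.step (h : Greedy G ω x₀ k x B) (hG : IsSparse ω G)
    (hlt : 2 * matchingNumber G < ∑ v, x v) {v : Fin n} (hv : x v = 1)
    (hmin : ∀ w, x w = 1 → unitDegree G x v ≤ unitDegree G x w) :
    Greedy G ω x₀ (k + 1) (Function.update x v 0) (B ∪ unitEdges G x v) := by
  classical
  have hsum : ∑ w, Function.update x v 0 w + 1 = ∑ w, x w := by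
    have := sum_sdiff (f := x) (subset_univ {v})
    rw [sum_singleton, hv] at this
    rw [sum_update_of_mem (mem_univ v), zero_add, this]
  refine ⟨fun e he => ?_, fun w => ?_, fun a b hab hB => ?_, ?_, ?_, ?_, .inr (by omega)⟩
  · rcases mem_union.1 he with he | he
    · exact h.edges e he
    · obtain ⟨w, hw, rfl⟩ := mem_image.1 he
      exact (mem_filter.1 hw).2.2
  · by_cases e : w = v
    · simp [e]
    · simpa [e] using h.le_two w
  · rw [mem_union, not_or] at hB
    have hab' := h.cover a b hab hB.1
    have hnot : ∀ w, G.Adj v w → s(v, w) ∉ unitEdges G x v → x w ≠ 1 := fun w hw hs h1 =>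
      hs (mem_image_of_mem _ (mem_filter.2 ⟨mem_univ _, h1, hw⟩))
    by_cases ha : a = v
    · subst ha
      have := hnot b hab hB.2
      have := h.le_two b
      rw [Function.update_self, Function.update_of_ne hab.ne']
      omega
    by_cases hb : b = v
    · subst hb
      have := hnot a hab.symm (by rw [Sym2.eq_swap]; exact hB.2)
      have := h.le_two a
      rw [Function.update_self, Function.update_of_ne ha]
      omega
    · rwa [Function.update_of_ne ha, Function.update_of_ne hb]
  · refine (card_le_card fun w hw => ?_).trans h.card_two
    have hw : Function.update x v 0 w = 2 := by simpa using hw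
    by_cases e : w = v
    · subst e
      simp at hw
    · simpa [e] using hw
  · obtain ⟨w, hw, hdeg⟩ := exists_unitDegree_le hG ⟨v, hv⟩
    have h1 : (#(B ∪ unitEdges G x v) : ℝ) ≤ #B + unitDegree G x v := by
      exact_mod_cast (card_union_le _ _).trans (Nat.add_le_add_left card_image_le _)
    have h2 : (unitDegree G x v : ℝ) ≤ unitDegree G x w := by exact_mod_cast hmin w hw
    have := h.card_le
    push_cast
    linarith
  · have := h.sum_add
    omega

lemma Greedy.card_update {v : Fin n} (hv : x v = 1) :
    #{w | Function.update x v 0 w = 1} < #{w | x w = 1} := by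
  refine card_lt_card ⟨fun w hw => ?_, fun hsub => ?_⟩
  · have hw : Function.update x v 0 w = 1 := by simpa using hw
    by_cases e : w = v
    · subst e
      simp at hw
    · simpa [e] using hw
  · have := hsub (mem_filter.2 ⟨mem_univ v, hv⟩)
    simp at this

/-- The final edge set is a small blocking set. -/
lemma Greedy.isBlockingSet (h : Greedy G ω x₀ k x B) (hle : ∑ v, x v ≤ 2 * matchingNumber G) :
    IsBlockingSet G B := by
  refine ⟨h.edges, fun v => x v / 2, fun v => by positivity, ?_, fun v w hvw hB => ?_⟩
  · rw [← sum_div]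
    have : (∑ v, x v : ℝ) ≤ 2 * matchingNumber G := by exact_mod_cast hle
    linarith
  · have : (2 : ℝ) ≤ x v + x w := by exact_mod_cast h.cover v w hvw hB
    linarith

/-- The sum falls by one per step, from at most 2ν + 2|B'| and never below 2ν once a step was made.
So there are at most 2|B'| steps with at most 2ω new edges each. -/
lemma Greedy.card_le_mul (h : Greedy G ω x₀ k x B) (h₀ : HalfCover G x₀) (hω : 1 ≤ ω)
    {B' : Finset (Sym2 (Fin n))} (hB' : IsBlockingSet G B') :
    (#B : ℝ) ≤ (8 * ω + 2) * #B' := by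
  have hk : k ≤ 2 * #B' := by
    rcases h.le_sum with hk | hk
    · omega
    · have := h₀.le_of_blocking B' hB'
      have := h.sum_add
      omega
  have hk' : (k : ℝ) ≤ 2 * #B' := by exact_mod_cast hk
  have h0 : (0 : ℝ) ≤ #B' := Nat.cast_nonneg _
  have := h.card_le
  nlinarith

end Matching


/-! ### The program for blocking sets

The tables: `1` holds the edge set `B`, `2` holds the double cover, `10` holds the vector `x`, `11`
holds the number `n` of points, `12` holds `2ν`, `13` holds the degrees, and `14` holds the chosen
point. -/

namespace Tab

open Finset Matching Tm Prog

/-- Compute the number of points and twice the matching number. -/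
def numberP : Prog :=
  .seq (matchP 0) (.seq (.assign 11 .size)
    (.assign 12 (.sum (.not (.eq (.entry 3 (.var 2)) (.var 2))))))

/-- The adjacency matrix of the double cover. -/
def dblT : Tm :=
  .ite (.lt (.var 0) (.scalar 11))
    (.ite (.lt (.var 1) (.scalar 11)) (.const 0) (.read 0 (.var 0) (.sub (.var 1) (.scalar 11))))
    (.ite (.lt (.var 1) (.scalar 11)) (.read 0 (.sub (.var 0) (.scalar 11)) (.var 1)) (.const 0))

/-- The cover of the double cover. -/
def sideT (i : Tm) : Tm :=
  .ite (.eq (.entry 4 i) (.const 1)) (.const 1)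
    (.ite (.eq (.entry 4 i) (.const 2)) (.const 0) (.ite (.lt i (.scalar 11)) (.const 0) (.const 1)))

/-- Compute a half-integral cover. -/
def coverP : Prog :=
  .seq (.assign 2 dblT) (.seq (matchP 2)
    (.assign 10 (.add (sideT (.var 0)) (sideT (.add (.scalar 11) (.var 0))))))

/-- The degrees among the points of value `1`. -/
def degreeT : Tm :=
  .ite (.eq (.entry 10 (.var 0)) (.const 1))
    (.sum (.ite (.and (.eq (.entry 10 (.var 2)) (.const 1)) (.read 0 (.var 0) (.var 2)))
      (.const 1) (.const 0))) .size

/-- The condition that a point is the first one of minimum degree. -/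
def firstT : Tm :=
  .not (.ex (.or (.lt (.entry 13 (.var 2)) (.entry 13 (.var 0)))
    (.and (.eq (.entry 13 (.var 2)) (.entry 13 (.var 0))) (.lt (.var 2) (.var 0)))))

/-- The new edge set. -/
def edgesT : Tm :=
  .ite (.and (.read 0 (.var 0) (.var 1))
      (.or (.and (.entry 14 (.var 0)) (.eq (.entry 10 (.var 1)) (.const 1)))
        (.and (.entry 14 (.var 1)) (.eq (.entry 10 (.var 0)) (.const 1)))))
    (.const 1) (.read 1 (.var 0) (.var 1))

/-- A step of the greedy algorithm. -/
def stepP : Prog :=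
  .cond (.lt (.scalar 12) (.sum (.entry 10 (.var 2))))
    (.seq (.assign 13 degreeT) (.seq (.assign 14 firstT) (.seq (.assign 1 edgesT)
      (.assign 10 (.ite (.entry 14 (.var 0)) (.const 0) (.entry 10 (.var 0)))))))
    .skip

variable {n : ℕ} {G : SimpleGraph (Fin n)} {T : Tabs}

/-- Input, output and the results of earlier phases survive the search. -/
lemma matchP_writes (e : ℕ) {a : ℕ} (ha : a < 3 ∨ 9 < a) : a ∉ (matchP e).writes := by
  simp [matchP, sweepP, twice, forLoop, actP, compP, mergeP, beforeP, augmentP, growP, startP,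
    writes]
  omega

/-- This serves the graph without vertices, for which scalars cannot be written. -/
lemma run_zero (p : Prog) : ∀ T, p.run 0 T = T := by
  induction p with
  | skip => exact fun _ => rfl
  | assign a t => intro T; funext; simp [run]
  | seq p q hp hq => intro T; rw [run_seq, hp, hq]
  | cond t p q hp hq => intro T; rw [run_cond, hp, hq, ite_self]
  | iter p hp => exact fun _ => rfl

/-- A largest matching moves exactly 2ν points, so counting them gives the budget for doubled
vectors without a division. -/
lemma run_numberP (hn : 0 < n) (hadj : ∀ v w : Fin n, T 0 v w ≠ 0 ↔ G.Adj v w) :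
    numberP.run n T 11 0 0 = n ∧ numberP.run n T 12 0 0 = 2 * matchingNumber G ∧
      numberP.run n T 0 = T 0 ∧ numberP.run n T 1 = T 1 := by
  obtain ⟨s, hrep, hgood, hs⟩ := run_matchP (e := 0) (E := G.Adj) hn (by decide)
    (fun _ _ h => h.symm) (fun a h => G.irrefl h) hadj
  refine ⟨?_, ?_, ?_, ?_⟩
  · rw [numberP, run_seq, run_seq, run_assign_ne (by decide), run_assign_self hn hn, eval_size]
  · rw [numberP, run_seq, run_seq, run_assign_self hn hn, eval_sum, sum_range,
      ← hgood.isMatch.card_eq_matchingNumber fun g hg => hgood.card_fixed_le hs hg, card_filter]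
    refine sum_congr rfl fun v _ => ?_
    rw [Tm.not, eval_ite_of_iff (p := s.M v = v) ?_, eval_const, eval_const, ite_not]
    rw [tr_eq, eval_entry, run_assign_ne (by decide)]
    simp [eval_var, hrep.M v 0 hn, Fin.val_inj]
  all_goals
    rw [numberP, run_seq, run_seq, run_assign_ne (by decide), run_assign_ne (by decide),
      run_of_notMem _ _ (matchP_writes 0 (by decide))]

/-- The program runs at size `n + n`, where `v` and `n + v` are the copies of `v`; comparison with
the number `n` kept in table 11 tells the two sides apart. -/
lemma run_coverP (hn : 0 < n) (hT : T 11 0 0 = n)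
    (hadj : ∀ v w : Fin n, T 0 v w ≠ 0 ↔ G.Adj v w) :
    (∃ x, HalfCover G x ∧ ∀ v : Fin n, coverP.run (n + n) T 10 v 0 = x v) ∧
      ∀ a, a < 2 ∨ 10 < a → coverP.run (n + n) T a = T a := by
  have hdbl : ∀ a b : Fin (n + n), (assign 2 dblT).run (n + n) T 2 a b ≠ 0 ↔ dbl G a b := by
    intro a b
    rw [run_assign_self a.2 b.2, dblT]
    refine Fin.addCases (fun v => ?_) (fun v => ?_) a <;>
      refine Fin.addCases (fun w => ?_) (fun w => ?_) b
    · have : ¬ dbl G (Fin.castAdd n v) (Fin.castAdd n w) := fun h => dbl_color _ _ h (by simp)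
      simp [eval_ite, tr_lt, eval_var, eval_scalar, eval_const, hT, this]
    · have : dbl G (Fin.castAdd n v) (Fin.natAdd n w) ↔ G.Adj v w := by
        refine ⟨?_, fun h => ⟨v, w, h, .inl ⟨rfl, rfl⟩⟩⟩
        rintro ⟨v', w', h, ⟨e1, e2⟩ | ⟨e1, e2⟩⟩
        · rwa [Fin.castAdd_injective n n e1, Fin.natAdd_injective n n e2]
        · have := congrArg Fin.val e1
          simp at this
          omega
      rw [this, ← hadj]
      simp [eval_ite, tr_lt, eval_var, eval_scalar, eval_sub, eval_read, hT]
    · have : dbl G (Fin.natAdd n v) (Fin.castAdd n w) ↔ G.Adj v w := by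
        refine ⟨?_, fun h => ⟨v, w, h, .inr ⟨rfl, rfl⟩⟩⟩
        rintro ⟨v', w', h, ⟨e1, e2⟩ | ⟨e1, e2⟩⟩
        · have := congrArg Fin.val e1
          simp at this
          omega
        · rwa [Fin.natAdd_injective n n e1, Fin.castAdd_injective n n e2]
      rw [this, ← hadj]
      simp [eval_ite, tr_lt, eval_var, eval_scalar, eval_sub, eval_read, hT]
    · have : ¬ dbl G (Fin.natAdd n v) (Fin.natAdd n w) := fun h => dbl_color _ _ h (by simp)
      simp [eval_ite, tr_lt, eval_var, eval_scalar, eval_const, hT, this,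
        -Fin.natAdd_eq_addNat]
  obtain ⟨s, hrep, hgood, hs⟩ := run_matchP (e := 2) (E := dbl G) (by omega) (by decide)
    dbl_symm dbl_irrefl hdbl
  have h11 : (matchP 2).run (n + n) ((assign 2 dblT).run (n + n) T) 11 0 0 = n := by
    rw [run_of_notMem _ _ (matchP_writes 2 (by decide)), run_assign_ne (by decide), hT]
  have hside : ∀ (ρ : List ℕ) (i : Tm) (a : Fin (n + n)),
      i.eval (n + n) ((matchP 2).run (n + n) ((assign 2 dblT).run (n + n) T)) ρ = a →
      (sideT i).eval (n + n) ((matchP 2).run (n + n) ((assign 2 dblT).run (n + n) T)) ρ =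
        sideCover s a := by
    intro ρ i a hi
    have hst := hrep.st a 0 (by omega)
    have hO : ∀ a ∈ s.O, a ∉ s.I := (hgood.bipartite hs dbl_color).2.2.1
    simp only [sideT, eval_ite, tr_eq, tr_lt, eval_entry, eval_const, eval_scalar, hi, h11, hst,
      sideCover]
    have := hO a
    split_ifs <;> simp_all
  refine ⟨⟨foldCover s, halfCover_foldCover hgood hs, fun v => ?_⟩, fun a ha => ?_⟩
  · rw [coverP, run_seq, run_seq, run_assign_self (by omega) (by omega), eval_add,
      hside _ _ (Fin.castAdd n v) (by simp [eval_var]),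
      hside _ _ (Fin.natAdd n v) (by rw [eval_add, eval_scalar, h11]; simp [eval_var, add_comm])]
    rfl
  · rw [coverP, run_seq, run_seq, run_assign_ne (by omega),
      run_of_notMem _ _ (matchP_writes 2 (by omega)), run_assign_ne (by omega)]

/-- The tables hold the vector `x` and the edge set `B` of the greedy algorithm. -/
structure GreedyRep (G : SimpleGraph (Fin n)) (T : Tabs) (x : Fin n → ℕ)
    (B : Finset (Sym2 (Fin n))) : Prop where
  adj : ∀ v w : Fin n, T 0 v w ≠ 0 ↔ G.Adj v w
  bound : T 12 0 0 = 2 * matchingNumber G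
  x : ∀ v : Fin n, T 10 v 0 = x v
  B : ∀ v w : Fin n, T 1 v w = if s(v, w) ∈ B then 1 else 0

/-- Ties among points of minimum degree are broken by the index, so table 14 marks exactly one
point. -/
lemma run_stepP {ω : ℝ} (hG : IsSparse ω G) {x₀ x : Fin n → ℕ} {k : ℕ}
    {B : Finset (Sym2 (Fin n))} (hn : 0 < n) (h : GreedyRep G T x B) (hg : Greedy G ω x₀ k x B) :
    ∃ k' x' B', GreedyRep G (stepP.run n T) x' B' ∧ Greedy G ω x₀ k' x' B' ∧
      (∑ v, x' v ≤ 2 * matchingNumber G ∨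
        2 * matchingNumber G < ∑ v, x v ∧ #{v | x' v = 1} < #{v | x v = 1}) := by
  classical
  rw [stepP, run_cond_of_iff (p := 2 * matchingNumber G < ∑ v, x v) (by
    rw [tr_lt, eval_scalar, h.bound, eval_sum, sum_range]
    simp [eval_entry, eval_var, h.x])]
  split_ifs with hlt
  swap
  · exact ⟨k, x, B, h, hg, .inl (not_lt.1 hlt)⟩
  let S : Finset (Fin n) := {v | x v = 1 ∧ ∀ w, x w = 1 → unitDegree G x v ≤ unitDegree G x w}
  have hS : S.Nonempty := by
    obtain ⟨v, hv⟩ := hg.exists_eq_one hlt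
    obtain ⟨u, hu, hmin⟩ := exists_min_image ({v | x v = 1} : Finset (Fin n)) (unitDegree G x)
      ⟨v, by simpa using hv⟩
    exact ⟨u, mem_filter.2 ⟨mem_univ u, by simpa using hu, fun w hw => hmin w (by simpa using hw)⟩⟩
  obtain ⟨v, hvS, hfirst⟩ : ∃ v ∈ S, ∀ w ∈ S, v ≤ w := ⟨S.min' hS, S.min'_mem hS, S.min'_le⟩
  obtain ⟨-, hv, hmin⟩ := mem_filter.1 hvS
  set T₁ := (assign 13 degreeT).run n T with hT₁
  have e₁ : ∀ a, a ≠ 13 → T₁ a = T a := fun a ha => run_assign_ne ha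
  have hdeg : ∀ u : Fin n, T₁ 13 u 0 = if x u = 1 then unitDegree G x u else n := by
    intro u
    rw [hT₁, run_assign_self u.2 hn, degreeT, eval_ite_of_iff (p := x u = 1)
      (by rw [tr_eq, eval_entry, ← h.x]; rfl), eval_sum, sum_range, eval_size, unitDegree,
      card_filter]
    refine if_congr Iff.rfl (sum_congr rfl fun w _ => ?_) rfl
    refine eval_ite_of_iff ?_
    rw [tr_and, tr_eq, tr_read, eval_entry, ← h.x, ← h.adj]
    rfl
  -- Points of value other than 1 were given the degree `n`. A true degree is smaller, as `v` is not
  -- its own neighbour, so such points are never chosen.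
  have hdlt : unitDegree G x v < n := by
    have : unitDegree G x v < #(univ : Finset (Fin n)) :=
      card_lt_card ⟨subset_univ _, fun hsub => by
        have := hsub (mem_univ v)
        simp at this⟩
    simpa using this
  set T₂ := (assign 14 firstT).run n T₁ with hT₂
  have e₂ : ∀ a, a ≠ 13 → a ≠ 14 → T₂ a = T a := fun a ha ha' => by
    rw [hT₂, run_assign_ne ha', e₁ a ha]
  have hsel : ∀ u : Fin n, T₂ 14 u 0 ≠ 0 ↔ u = v := by
    intro u
    have : T₂ 14 u 0 = firstT.eval n T₁ [↑u, 0] := by rw [hT₂, run_assign_self u.2 hn]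
    rw [this]
    change firstT.Tr n T₁ [↑u, 0] ↔ _
    rw [firstT, tr_not, tr_ex]
    simp only [tr_or, tr_and, tr_lt, tr_eq, eval_entry, eval_var, List.cons_append,
      List.nil_append, List.getD_cons_zero, List.getD_cons_succ]
    constructor
    · intro hu
      by_contra hne
      refine hu ⟨v, v.2, ?_⟩
      rw [hdeg, hdeg, if_pos hv]
      by_cases hu1 : x u = 1
      · rw [if_pos hu1]
        rcases (hmin u hu1).lt_or_eq with hlt | heq
        · exact .inl hlt
        · refine .inr ⟨heq, ?_⟩
          have := hfirst u (mem_filter.2 ⟨mem_univ u, hu1, heq ▸ hmin⟩)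
          exact lt_of_le_of_ne this fun e => hne (Fin.ext e.symm)
      · rw [if_neg hu1]
        exact .inl hdlt
    · rintro rfl ⟨i, hi, hlt⟩
      have hi' := hdeg ⟨i, hi⟩
      simp only at hi'
      rw [hi', hdeg, if_pos hv] at hlt
      by_cases h1 : x ⟨i, hi⟩ = 1
      · rw [if_pos h1] at hlt
        rcases hlt with hlt | ⟨heq, hlt⟩
        · exact absurd (hmin _ h1) (by omega)
        · have := hfirst ⟨i, hi⟩ (mem_filter.2 ⟨mem_univ _, h1, heq ▸ hmin⟩)
          rw [Fin.le_def] at this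
          simp only at this
          omega
      · rw [if_neg h1] at hlt
        omega
  refine ⟨k + 1, Function.update x v 0, B ∪ unitEdges G x v, ?_, hg.step hG hlt hv hmin,
    .inr ⟨hlt, Greedy.card_update hv⟩⟩
  rw [run_seq, run_seq, run_seq, ← hT₁, ← hT₂]
  have e₃ : ∀ a, a ≠ 13 → a ≠ 14 → a ≠ 1 → a ≠ 10 →
      (assign 10 (.ite (.entry 14 (.var 0)) (.const 0) (.entry 10 (.var 0)))).run n
        ((assign 1 edgesT).run n T₂) a = T a := fun a h13 h14 h1 h10 => by
    rw [run_assign_ne h10, run_assign_ne h1, e₂ a h13 h14]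
  refine ⟨fun a b => ?_, ?_, fun a => ?_, fun a b => ?_⟩
  · rw [e₃ 0 (by decide) (by decide) (by decide) (by decide)]
    exact h.adj a b
  · rw [e₃ 12 (by decide) (by decide) (by decide) (by decide)]
    exact h.bound
  · rw [run_assign_self a.2 hn, eval_ite_of_iff (p := a = v)
      (by rw [tr_entry, run_assign_ne (by decide), ← hsel]; rfl), eval_const, eval_entry,
      run_assign_ne (by decide), e₂ 10 (by decide) (by decide), Function.update_apply, ← h.x]
    rfl
  · have hmem : s(a, b) ∈ unitEdges G x v ↔
        G.Adj a b ∧ ((a = v ∧ x b = 1) ∨ (b = v ∧ x a = 1)) := by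
      simp only [unitEdges, mem_image, mem_filter, mem_univ, true_and, Sym2.eq_iff]
      constructor
      · rintro ⟨w, ⟨h1, h2⟩, ⟨rfl, rfl⟩ | ⟨rfl, rfl⟩⟩
        · exact ⟨h2, .inl ⟨rfl, h1⟩⟩
        · exact ⟨h2.symm, .inr ⟨rfl, h1⟩⟩
      · rintro ⟨h1, ⟨rfl, h2⟩ | ⟨rfl, h2⟩⟩
        · exact ⟨b, ⟨h2, h1⟩, .inl ⟨rfl, rfl⟩⟩
        · exact ⟨a, ⟨h2, h1.symm⟩, .inr ⟨rfl, rfl⟩⟩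
    rw [run_assign_ne (by decide), run_assign_self a.2 b.2, edgesT,
      eval_ite_of_iff (p := s(a, b) ∈ unitEdges G x v) (by
        rw [hmem, tr_and, tr_or, tr_and, tr_and, tr_eq, tr_eq, tr_read, tr_entry, tr_entry,
          eval_entry, eval_entry, e₂ 0 (by decide) (by decide), e₂ 10 (by decide) (by decide),
          ← h.adj, ← hsel, ← hsel, ← h.x, ← h.x]
        rfl), eval_const, eval_read, e₂ 1 (by decide) (by decide)]
    simp only [eval_var, List.getD_cons_zero, List.getD_cons_succ, h.B, mem_union]
    split_ifs <;> simp_all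

/-- Each effective step uses up a point of value 1, so after `n` rounds either the budget has been
met or none is left, and then it is met by `Greedy.exists_eq_one`. -/
lemma run_greedy {ω : ℝ} (hG : IsSparse ω G) {x₀ : Fin n → ℕ} (hn : 0 < n)
    (h : GreedyRep G T x₀ ∅) (h₀ : HalfCover G x₀) :
    ∃ k x B, GreedyRep G ((Prog.iter stepP).run n T) x B ∧ Greedy G ω x₀ k x B ∧
      ∑ v, x v ≤ 2 * matchingNumber G := by
  obtain ⟨k, x, B, h1, h2, h3⟩ := run_iter (p := stepP) (N := n) (T := T)
    (P := fun i T' => ∃ k x B, GreedyRep G T' x B ∧ Greedy G ω x₀ k x B ∧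
      (∑ v, x v ≤ 2 * matchingNumber G ∨ #{v | x v = 1} + i ≤ n))
    ⟨0, x₀, ∅, h, greedy_start h₀, .inr (by simpa using card_le_univ {v | x₀ v = 1})⟩
    fun i hi T' ⟨k, x, B, h1, h2, h3⟩ => by
      obtain ⟨k', x', B', g1, g2, g3⟩ := run_stepP hG hn h1 h2
      refine ⟨k', x', B', g1, g2, ?_⟩
      exact g3.imp_right fun g3 => by omega
  refine ⟨k, x, B, h1, h2, ?_⟩
  by_contra hlt
  obtain ⟨v, hv⟩ := h2.exists_eq_one (not_le.1 hlt)
  have : 0 < #{v | x v = 1} := card_pos.2 ⟨v, by simpa using hv⟩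
  omega

end Tab

/-! ### Assembly of the program. -/

open Tab in
/-- There is a program `c` which, given the adjacency matrix of any `ω`-sparse graph `G` on `n`
vertices, halts within polynomially many steps in `n` and outputs a blocking set `B` of `G` whose
size is at most `8ω + 2` times that of every blocking set of `G`. The program and the polynomial
depend on nothing, not even on `ω`. -/
theorem theorem2 :
    ∃ (c : RAM.Cmd) (p : Polynomial ℕ),
      ∀ (ω : ℝ), 1 ≤ ω → ∀ (n : ℕ) (G : SimpleGraph (Fin n)), IsSparse ω G →
        ∃ (m : RAM.Mem) (t : ℕ) (B : Finset (Sym2 (Fin n))),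
          RAM.Exec c (RAM.graphInput G) m t ∧ t ≤ p.eval n ∧
          RAM.OutputsEdges m B ∧ IsBlockingSet G B ∧
          ∀ B' : Finset (Sym2 (Fin n)), IsBlockingSet G B' →
            (B.card : ℝ) ≤ (8 * ω + 2) * (B'.card : ℝ) := by
  obtain ⟨c₁, q₁, i₁⟩ := exists_implements numberP 0
  obtain ⟨c₂, q₂, i₂⟩ := exists_implements coverP 0
  obtain ⟨c₃, q₃, i₃⟩ := exists_implements (.iter stepP) 0
  -- Between the phases the size cell is doubled for the double cover and then restored from table
  -- 11. Hence the bound for the second phase is evaluated at `n + n`.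
  refine ⟨.seq c₁ (.seq (put 0 0 (.add (cell 0 0) (cell 0 0))) (.seq c₂
    (.seq (put 0 0 (cell (arr 11) 0)) c₃))),
    q₁ + q₂.comp (Polynomial.X + Polynomial.X) + q₃ + 30, fun ω hω n G hG => ?_⟩
  let T₀ : Tabs := fun a => RAM.graphInput G (arr a)
  have hT₀ : Holds n (RAM.graphInput G) T₀ := ⟨by simp [RAM.graphInput], fun _ _ _ => rfl⟩
  have hset : ∀ {N N' : ℕ} {m : RAM.Mem} {T : Tabs}, Holds N m T → Holds N' (m.set 0 0 0 N') T :=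
    fun h => ⟨by simp [RAM.Mem.set], fun a i j => by
      rw [← h.2]; simp [RAM.Mem.set, (arr_ne a).1]⟩
  have hadj : ∀ v w : Fin n, T₀ 0 v w ≠ 0 ↔ G.Adj v w := fun v w => by
    simp [T₀, RAM.graphInput, arr]
  obtain ⟨m₁, s₁, e₁, b₁, h₁, -⟩ := i₁ n T₀ _ hT₀
  obtain ⟨m₂, s₂, e₂, b₂, h₂, -⟩ := i₂ (n + n) _ _ (hset (N' := n + n) h₁)
  set T₂ := coverP.run (n + n) (numberP.run n T₀) with hT₂
  have w₁ : RAM.Exec (put 0 0 (.add (cell 0 0) (cell 0 0))) m₁ (m₁.set 0 0 0 (n + n)) 10 := by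
    have := RAM.Exec.write m₁ 0 (.const 0) (.const 0) (.add (cell 0 0) (cell 0 0))
    simpa [RAM.Expr.eval, RAM.Expr.cost, h₁.1] using this
  have h11 : m₂ (arr 11) 0 0 = n := by
    rw [h₂.2]
    rcases Nat.eq_zero_or_pos n with rfl | hn
    · rw [hT₂, run_zero, run_zero]
      simp [T₀, RAM.graphInput, arr]
    · obtain ⟨n1, -, n3, -⟩ := run_numberP hn hadj
      rw [hT₂, (run_coverP hn n1 (by rw [n3]; exact hadj)).2 11 (by decide), n1]
  have w₂ : RAM.Exec (put 0 0 (cell (arr 11) 0)) m₂ (m₂.set 0 0 0 n) 6 := by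
    have := RAM.Exec.write m₂ 0 (.const 0) (.const 0) (cell (arr 11) 0)
    simpa [RAM.Expr.eval, RAM.Expr.cost, h11] using this
  obtain ⟨m₃, s₃, e₃, b₃, h₃, -⟩ := i₃ n _ _ (hset (N' := n) h₂)
  have hexec := e₁.seq (w₁.seq (e₂.seq (w₂.seq e₃)))
  have htime : s₁ + (10 + (s₂ + (6 + s₃))) ≤
      (q₁ + q₂.comp (Polynomial.X + Polynomial.X) + q₃ + 30).eval n := by
    simp
    omega
  -- The statements about the programs need a positive size; without vertices the empty set is a
  -- blocking set.
  rcases Nat.eq_zero_or_pos n with rfl | hn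
  · exact ⟨m₃, _, ∅, hexec, htime, fun i => i.elim0,
      ⟨by simp, 0, fun _ => le_rfl, by simp, fun i => i.elim0⟩, fun B' _ => by simp; positivity⟩
  · obtain ⟨n1, n2, n3, n4⟩ := run_numberP hn hadj
    obtain ⟨⟨x₀, hx₀, hx⟩, hother⟩ := run_coverP hn n1 (by rw [n3]; exact hadj)
    have hrep : GreedyRep G T₂ x₀ ∅ := by
      refine ⟨fun v w => ?_, ?_, hx, fun v w => ?_⟩
      · rw [hT₂, hother 0 (by decide), n3]; exact hadj v w
      · rw [hT₂, hother 12 (by decide), n2]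
      · rw [hT₂, hother 1 (by decide), n4]
        simp [T₀, RAM.graphInput, arr]
    obtain ⟨k, x, B, g1, g2, g3⟩ := run_greedy hG hn hrep hx₀
    refine ⟨m₃, _, B, hexec, htime, fun i j => ?_, g2.isBlockingSet g3,
      fun B' hB' => g2.card_le_mul hx₀ hω hB'⟩
    rw [show 2 = arr 1 from rfl, h₃.2, g1.B]
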